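/- Let $\mathcal{G}$ be a locally compact, Hausdorff, étale groupoid (range and source maps are local homeomorphisms) with compact base space $X=\mathcal{G}^{(0)}$. A $\mathcal{G}$-sheaf is a sheaf of abelian groups on $X$ whose étale space carries a continuous action of $\mathcal{G}$ by isomorphisms of stalks. A sheaf on $X$ is $c$-soft if every section over an open neighbourhood of a compact set $K$ agrees near $K$ with a global section. Let $\mathcal{Z}$ be the $\mathcal{G}$-sheaf of locally constant $\mathbb{Z}$-valued functions on $X$, and let $\mathcal{B}$ be the $\mathcal{G}$-sheaf whose sections over an open set $U\subseteq X$ are the Borel functions $U\to\mathbb{C}$ that are bounded on compact subsets of $U$. For $p\ge 0$ let $\mathcal{G}^{(p)}$ be the space of composable strings $x_0\leftarrow x_1\leftarrow\cdots\leftarrow x_p$, let $\tau_p:\mathcal{G}^{(p)}\to X$ be the map to $x_0$, and for a $\mathcal{G}$-sheaf $\mathcal{S}$ put $\mathcal{S}_p=\tau_p^*\mathcal{S}$. For a resolution $0\to\mathcal{Z}\to\mathcal{S}^0\to\mathcal{S}^1\to\cdots$ by $c$-soft $\mathcal{G}$-sheaves consider the double complex $\Gamma_c(\mathcal{G}^{(p)};\mathcal{S}^q_p)$,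 $p,q\ge 0$, with the vertical maps induced by the resolution and the horizontal maps $\delta=\sum_{i=0}^{p}(-1)^i\delta_i:\Gamma_c(\mathcal{G}^{(p)};\mathcal{S}^q_p)\to\Gamma_c(\mathcal{G}^{(p-1)};\mathcal{S}^q_{p-1})$, where $\delta_i$ sums over the fibres of the face map omitting $x_i$ (after acting by the inverse of the arrow $x_0\leftarrow x_1$ if $i=0$). Its direct sum total complex has $n$-th group $\bigoplus_{p-q=n}\Gamma_c(\mathcal{G}^{(p)};\mathcal{S}^q_p)$, $n\in\mathbb{Z}$. The resolution is called Borel if $\mathcal{S}^0$ is a $\mathcal{G}$-subsheaf of $\mathcal{B}$ containing $\mathcal{Z}$ and $\mathcal{Z}\to\mathcal{S}^0$ is the inclusion. Let $T(\mathcal{G})$ be the set of invariant (regular) Borel probability measures on $X$, i.e. those $\mu$ with $$\int_X\sum_{r(g)=x}f(g)\,d\mu(x)=\int_X\sum_{s(g)=x}f(g)\,d\mu(x)\qquad\text{for all } f\in C_c(\mathcal{G}).$$ Then: (1) Borel resolutions of $\mathcal{Z}$ exist. (2) The zeroth homology $H_0(\mathcal{G})$ of the total complex does not depend on the choice of the resolution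 by $c$-soft $\mathcal{G}$-sheaves: if $H_0(\mathcal{G})$ is the group of families consisting of one class in the zeroth homology of every such resolution, compatible with all morphisms of resolutions, then the projection from $H_0(\mathcal{G})$ to the zeroth homology of each single resolution is an isomorphism. (3) For every Borel resolution, every $\mu\in T(\mathcal{G})$ and every $0$-chain $a=(a_p)_{p\ge 0}\in\bigoplus_{p}\Gamma_c(\mathcal{G}^{(p)};\mathcal{S}^p_p)$, the function $a_0:X\to\mathbb{C}$ is $\mu$-integrable, and $(\mu,a)\mapsto\int_X a_0\,d\mu$ descends to a well-defined pairing $$T(\mathcal{G})\times H_0(\mathcal{G})\to\mathbb{C},$$ additive in the second variable, which is the same for all Borel resolutions. Its values are real. -/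

import Mathlib

open CategoryTheory Topology MeasureTheory

universe u w w'

namespace EtaleGpd

/-! ### Topological groupoids -/

/-- The type of all arrows of a groupoid with base space (set of objects) `X`.  A morphism
`g : x ⟶ y` is an arrow with source `x` and range `y`; the product of arrows written `g h` in
the literature on topological groupoids is the composite `h ≫ g`. -/
@[ext]
structure Arrows (X : Type u) [Groupoid.{u} X] : Type u where
  source : X
  range : X
  hom : source ⟶ range

/-- A composable pair `y ←[g] x`, `z ←[h] y`. -/
structure ComposablePair (X : Type u) [Groupoid.{u} X] : Type u where
  {x : X}
  {y : X}
  {z : X}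
  g : x ⟶ y
  h : y ⟶ z

section Groupoids

variable {X : Type u} [Groupoid.{u} X]

/-- The inclusion of the base space in the arrows. -/
def unitArrow (x : X) : Arrows X := ⟨x, x, 𝟙 x⟩

/-- The inverse of an arrow. -/
def invArrow (a : Arrows X) : Arrows X := ⟨a.range, a.source, Groupoid.inv a.hom⟩

/-- The product of a composable pair. -/
def mulArrow (p : ComposablePair X) : Arrows X := ⟨p.x, p.z, p.g ≫ p.h⟩

/-- Composable pairs carry the subspace topology of the product of two copies of the arrows. -/
instance [TopologicalSpace (Arrows X)] : TopologicalSpace (ComposablePair X) :=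
  .induced (fun p => ((⟨p.y, p.z, p.h⟩ : Arrows X), (⟨p.x, p.y, p.g⟩ : Arrows X))) inferInstance

end Groupoids

/-- `X` is the base space of an étale topological groupoid: the structure maps are continuous and
the range map (equivalently, the source map) is a local homeomorphism.  As the range map and the
inclusion of units are continuous, `X` has the subspace topology from the space of arrows. -/
class IsEtaleGroupoid (X : Type u) [Groupoid.{u} X] [TopologicalSpace X]
    [TopologicalSpace (Arrows X)] : Prop where
  continuous_unit : Continuous (unitArrow : X → Arrows X)
  continuous_inv : Continuous (invArrow : Arrows X → Arrows X)
  continuous_mul : Continuous (mulArrow : ComposablePair X → Arrows X)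
  isLocalHomeomorph_range : IsLocalHomeomorph (Arrows.range : Arrows X → X)

/-- The space `𝒢⁽ⁿ⁾` of composable strings `x₀ ← x₁ ← ⋯ ← xₙ`. -/
def Strings (X : Type u) [Groupoid.{u} X] (n : ℕ) : Type u := (Fin (n + 1))ᵒᵖ ⥤ X

namespace Strings

section Basic

variable {X : Type u} [Groupoid.{u} X] {n : ℕ}

/-- The object `xᵢ` of a string. -/
def vertex (i : Fin (n + 1)) (F : Strings X n) : X := F.obj (.op i)

/-- The composite `xᵢ ← xⱼ` of a string, for `i ≤ j`. -/
def hom (F : Strings X n) {i j : Fin (n + 1)} (h : i ≤ j) : F.vertex j ⟶ F.vertex i :=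
  F.map (homOfLE h).op

/-- The composite `xᵢ ← xⱼ` of a string as an element of the space of arrows. -/
def arrow {i j : Fin (n + 1)} (h : i ≤ j) (F : Strings X n) : Arrows X :=
  ⟨F.vertex j, F.vertex i, F.hom h⟩

/-- The vertices `xᵢ` and the arrows `xᵢ ← xᵢ₊₁` of a string. -/
def coords (F : Strings X n) : (Fin (n + 1) → X) × (Fin n → Arrows X) :=
  (fun i => F.vertex i, fun i => F.arrow i.castSucc_lt_succ.le)

/-- The topology of `𝒢⁽ⁿ⁾`: the topology of the base space if `n = 0`, and the
subspace topology of the `n`-fold product of the space of arrows if `n ≥ 1` (where the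
vertices are continuous functions of the arrows). -/
instance [TopologicalSpace X] [TopologicalSpace (Arrows X)] : TopologicalSpace (Strings X n) :=
  .induced coords inferInstance

/-- The face map `dᵢ`, which omits `xᵢ` (composing the two adjacent arrows if
`0 < i < n + 1`). -/
def face (i : Fin (n + 2)) (F : Strings X (n + 1)) : Strings X n :=
  (Monotone.functor (Fin.strictMono_succAbove i).monotone).op ⋙ F

/-- A point of the base space as a string of length `0`. -/
def ofBase (x : X) : Strings X 0 := (Functor.const _).obj x

lemma vertex_face (i : Fin (n + 2)) (j : Fin (n + 1)) (F : Strings X (n + 1)) :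
    (F.face i).vertex j = F.vertex (i.succAbove j) := rfl

lemma arrow_face (i : Fin (n + 2)) {j k : Fin (n + 1)} (h : j ≤ k) (F : Strings X (n + 1)) :
    (F.face i).arrow h = F.arrow ((Fin.strictMono_succAbove i).monotone h) := rfl

lemma arrow_refl (F : Strings X n) (i : Fin (n + 1)) :
    F.arrow (le_refl i) = unitArrow (F.vertex i) := by
  have : F.hom (le_refl i) = 𝟙 _ := F.map_id _
  simp [arrow, unitArrow, this]

lemma hom_comp (F : Strings X n) {i j k : Fin (n + 1)} (h : i ≤ j) (h' : j ≤ k) :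
    F.hom h' ≫ F.hom h = F.hom (h.trans h') := (F.map_comp _ _).symm

lemma arrow_trans (F : Strings X n) {i j k : Fin (n + 1)} (h : i ≤ j) (h' : j ≤ k) :
    F.arrow (h.trans h') = mulArrow ⟨F.hom h', F.hom h⟩ := by
  simp [arrow, mulArrow, hom_comp]

lemma hom_eq (F : Strings X n) {i j : Fin (n + 1)} (h : i ≤ j) :
    F.hom h = F.hom (Fin.zero_le j) ≫ Groupoid.inv (F.hom (Fin.zero_le i)) := by
  rw [← F.hom_comp (Fin.zero_le i) h]; simp

/-- A string is determined by the composites `x₀ ← xⱼ`. -/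
lemma ext_arrow {F F' : Strings X n}
    (h : ∀ j, F.arrow (Fin.zero_le j) = F'.arrow (Fin.zero_le j)) : F = F' := by
  have hobj : ∀ j, F.vertex j = F'.vertex j := fun j => congrArg Arrows.source (h j)
  have key : ∀ {a b : Arrows X} (e : a = b), a.hom =
      eqToHom (congrArg Arrows.source e) ≫ b.hom ≫ eqToHom (congrArg Arrows.range e).symm := by
    rintro a b rfl; simp
  have key' : ∀ j, F.hom (Fin.zero_le j) =
      eqToHom (hobj j) ≫ F'.hom (Fin.zero_le j) ≫ eqToHom (hobj 0).symm := fun j => key (h j)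
  have gen : ∀ {x₀ x x' y₀ y y' : X} (e₀ : x₀ = y₀) (e : x = y) (e' : x' = y')
      (p : y' ⟶ y₀) (q : y ⟶ y₀), (eqToHom e' ≫ p ≫ eqToHom e₀.symm) ≫
        Groupoid.inv (eqToHom e ≫ q ≫ eqToHom e₀.symm) =
          eqToHom e' ≫ (p ≫ Groupoid.inv q) ≫ eqToHom e.symm := by
    rintro _ _ _ _ _ _ rfl rfl rfl p q
    simp [Groupoid.inv_eq_inv]
  refine CategoryTheory.Functor.ext (fun j => hobj j.unop) fun j i f => ?_
  have h1 := F.hom_eq (leOfHom f.unop)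
  have h2 := F'.hom_eq (leOfHom f.unop)
  change F.hom (leOfHom f.unop) = _ ≫ F'.hom (leOfHom f.unop) ≫ _
  rw [h1, h2, key', key']
  exact gen (hobj 0) (hobj i.unop) (hobj j.unop) _ _

/-- The string with given composites `x₀ ← xⱼ`. -/
def ofArrows (x : X) (b : Fin (n + 1) → Arrows X) (hb : ∀ j, (b j).range = x) : Strings X n where
  obj j := (b j.unop).source
  map {j i} _ := (b j.unop).hom ≫ eqToHom ((hb _).trans (hb _).symm) ≫ Groupoid.inv (b i.unop).hom
  map_id j := by simp
  map_comp f g := by simp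

lemma arrow_ofArrows (x : X) (b : Fin (n + 1) → Arrows X) (hb : ∀ j, (b j).range = x)
    (h0 : b 0 = unitArrow x) (j : Fin (n + 1)) :
    (ofArrows x b hb).arrow (Fin.zero_le j) = b j := by
  have key : ∀ (c d : Arrows X) (e : d.range = c.range), c = unitArrow x →
      (⟨d.source, c.source, d.hom ≫ eqToHom e ≫ Groupoid.inv c.hom⟩ : Arrows X) = d := by
    rintro c ⟨d1, d2, d⟩ e rfl
    dsimp [unitArrow] at e ⊢
    subst e
    simp [Groupoid.inv_eq_inv]
  exact key (b 0) (b j) _ h0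

end Basic

section Top

variable {X : Type u} [Groupoid.{u} X] [TopologicalSpace X] [TopologicalSpace (Arrows X)] {n : ℕ}

lemma continuous_coords : Continuous (coords : Strings X n → _) := continuous_induced_dom

lemma continuous_vertex (i : Fin (n + 1)) : Continuous (vertex i : Strings X n → X) :=
  (continuous_apply i).comp (continuous_fst.comp continuous_coords)

variable [IsEtaleGroupoid X]

lemma continuous_arrow {i j : Fin (n + 1)} (h : i ≤ j) :
    Continuous (arrow h : Strings X n → Arrows X) := by
  revert i
  induction j using Fin.induction with
  | zero =>
    intro i h
    obtain rfl : i = 0 := Fin.le_zero_iff.mp h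
    exact (IsEtaleGroupoid.continuous_unit.comp (continuous_vertex 0)).congr
      fun F => (F.arrow_refl 0).symm
  | succ j ih =>
    intro i h
    rcases h.eq_or_lt with rfl | h'
    · exact (IsEtaleGroupoid.continuous_unit.comp (continuous_vertex _)).congr
        fun F => (F.arrow_refl _).symm
    · have h1 : i ≤ j.castSucc := Fin.le_castSucc_iff.mpr h'
      have h2 : Continuous (arrow j.castSucc_lt_succ.le : Strings X n → Arrows X) :=
        (continuous_apply j).comp (continuous_snd.comp continuous_coords)
      have h3 : Continuous fun F : Strings X n =>
          (⟨F.hom j.castSucc_lt_succ.le, F.hom h1⟩ : ComposablePair X) :=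
        continuous_induced_rng.mpr ((ih h1).prodMk h2)
      exact (IsEtaleGroupoid.continuous_mul.comp h3).congr fun F => (F.arrow_trans _ _).symm

lemma continuous_face (i : Fin (n + 2)) : Continuous (face i : Strings X (n + 1) → Strings X n) :=
  continuous_induced_rng.mpr <|
    (continuous_pi fun _ => continuous_vertex _).prodMk (continuous_pi fun _ => continuous_arrow _)

variable (X) in
lemma t2Space_base [T2Space (Arrows X)] : T2Space X :=
  T2Space.of_injective_continuous (f := (unitArrow : X → Arrows X))
    (fun _ _ h => congrArg Arrows.source h) IsEtaleGroupoid.continuous_unit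

instance [T2Space (Arrows X)] : T2Space (Strings X n) :=
  T2Space.of_injective_continuous (f := fun (F : Strings X n) (j : Fin (n + 1)) =>
    F.arrow (Fin.zero_le j)) (fun _ _ h => ext_arrow (congrFun h))
    (continuous_pi fun _ => continuous_arrow _)

variable (X) in
lemma isLocalHomeomorph_source : IsLocalHomeomorph (Arrows.source : Arrows X → X) := by
  let e : Arrows X ≃ₜ Arrows X :=
    { toFun := invArrow
      invFun := invArrow
      left_inv := fun a => by simp [invArrow, Groupoid.inv_eq_inv]
      right_inv := fun a => by simp [invArrow, Groupoid.inv_eq_inv]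
      continuous_toFun := IsEtaleGroupoid.continuous_inv
      continuous_invFun := IsEtaleGroupoid.continuous_inv }
  exact IsEtaleGroupoid.isLocalHomeomorph_range.comp e.isLocalHomeomorph

lemma isLocalHomeomorph_vertex_zero :
    IsLocalHomeomorph (vertex 0 : Strings X n → X) := by
  have hr := IsEtaleGroupoid.isLocalHomeomorph_range (X := X)
  have hopen : IsOpenMap (vertex 0 : Strings X n → X) := by
    refine IsOpenMap.of_nhds_le fun F₀ => ?_
    let e : Fin (n + 1) → OpenPartialHomeomorph X (Arrows X) :=
      fun j => hr.localInverseAt (F₀.arrow (Fin.zero_le j))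
    let O : Set X := ⋂ j, (e j).source
    have hO : IsOpen O := isOpen_iInter_of_finite fun j => (e j).open_source
    let b : O → Fin (n + 1) → Arrows X :=
      fun x j => if j = 0 then unitArrow x.1 else e j x.1
    have hb : ∀ x j, (b x j).range = x.1 := by
      intro x j
      by_cases hj : j = 0
      · simp [b, hj, unitArrow]
      · simp only [b, hj, if_false]
        exact hr.apply_localInverseAt_of_mem (Set.mem_iInter.mp x.2 j)
    have hbc : ∀ j, Continuous fun x => b x j := by
      intro j
      by_cases hj : j = 0
      · simpa [b, hj] using! IsEtaleGroupoid.continuous_unit.comp continuous_subtype_val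
      · simp only [b, hj, if_false]
        exact (e j).continuousOn.comp_continuous continuous_subtype_val
          fun x => Set.mem_iInter.mp x.2 j
    let γ : O → Strings X n := fun x => ofArrows x.1 (b x) (hb x)
    have hγa : ∀ x j, (γ x).arrow (Fin.zero_le j) = b x j :=
      fun x j => arrow_ofArrows _ _ _ (by simp [b]) j
    have hγ : Continuous γ := by
      refine continuous_induced_rng.mpr (Continuous.prodMk ?_ ?_)
      · exact continuous_pi fun j => (isLocalHomeomorph_source X).continuous.comp (hbc j)
      · refine continuous_pi fun j => ?_
        have h1 : Continuous fun x => (⟨(b x j.succ).hom ≫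
            eqToHom ((hb x j.succ).trans (hb x j.castSucc).symm),
            Groupoid.inv (b x j.castSucc).hom⟩ : ComposablePair X) := by
          refine continuous_induced_rng.mpr (Continuous.prodMk
            (IsEtaleGroupoid.continuous_inv.comp (hbc j.castSucc)) ((hbc j.succ).congr fun x => ?_))
          have key : ∀ (a : Arrows X) (y : X) (e : a.range = y),
              a = ⟨a.source, y, a.hom ≫ eqToHom e⟩ := by
            rintro a _ rfl; simp
          exact key _ _ _
        refine (IsEtaleGroupoid.continuous_mul.comp h1).congr fun x => ?_
        simp [mulArrow, arrow, γ, ofArrows, hom, vertex]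
    have hx : vertex 0 F₀ ∈ O :=
      Set.mem_iInter.mpr fun j => hr.apply_self_mem_localInverseAt_source
    have hγ0 : γ ⟨_, hx⟩ = F₀ := by
      refine ext_arrow fun j => (hγa _ j).trans ?_
      by_cases hj : j = 0
      · subst hj; simp [b, arrow_refl]
      · simp only [b, hj, if_false]
        exact hr.localInverseAt_apply_self
    have hv : vertex 0 ∘ γ = Subtype.val := by
      funext x
      change (b x 0).source = x.1
      simp [b, unitArrow]
    calc 𝓝 (vertex 0 F₀) = (𝓝 (⟨_, hx⟩ : O)).map Subtype.val := (map_nhds_subtype_coe_eq_nhds hx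
          (hO.mem_nhds hx)).symm
      _ = ((𝓝 (⟨_, hx⟩ : O)).map γ).map (vertex 0) := by rw [Filter.map_map, hv]
      _ ≤ (𝓝 F₀).map (vertex 0) := by
        refine Filter.map_mono ?_
        have := hγ.tendsto ⟨_, hx⟩
        rwa [hγ0] at this
  refine isLocalHomeomorph_iff_isOpenEmbedding_restrict.mpr fun F₀ => ?_
  let U : Set (Strings X n) :=
    ⋂ j, arrow (Fin.zero_le j) ⁻¹' (hr.localInverseAt (F₀.arrow (Fin.zero_le j))).target
  have hU : IsOpen U := isOpen_iInter_of_finite fun j =>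
    (hr.localInverseAt (F₀.arrow (Fin.zero_le j))).open_target.preimage (continuous_arrow _)
  refine ⟨U, hU.mem_nhds (Set.mem_iInter.mpr fun j => hr.self_mem_localInverseAt_target),
    IsOpenEmbedding.of_continuous_injective_isOpenMap
      ((continuous_vertex 0).comp continuous_subtype_val) ?_ (hopen.domRestrict hU)⟩
  intro F F' h
  refine Subtype.ext (ext_arrow fun j => ?_)
  exact hr.injOn_localInverseAt_target (Set.mem_iInter.mp F.2 j) (Set.mem_iInter.mp F'.2 j) h

lemma isLocalHomeomorph_vertex (i : Fin (n + 1)) :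
    IsLocalHomeomorph (vertex i : Strings X n → X) := by
  have h : IsLocalHomeomorph (arrow (Fin.zero_le i) : Strings X n → Arrows X) :=
    IsLocalHomeomorph.of_comp (g := Arrows.range) isLocalHomeomorph_vertex_zero
      IsEtaleGroupoid.isLocalHomeomorph_range (continuous_arrow _)
  exact (isLocalHomeomorph_source X).comp h

lemma isLocalHomeomorph_face (i : Fin (n + 2)) :
    IsLocalHomeomorph (face i : Strings X (n + 1) → Strings X n) :=
  IsLocalHomeomorph.of_comp (g := vertex 0) (isLocalHomeomorph_vertex (i.succAbove 0))
    isLocalHomeomorph_vertex_zero (continuous_face i)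

end Top
end Strings


/-! ### Equivariant sheaves -/

/-- The total space of a family of stalks. -/
@[ext]
structure EtaleSpace {X : Type u} (A : X → Type w) : Type (max u w) where
  base : X
  val : A base

/-- A `𝒢`-sheaf of abelian groups on the base space `X` of `𝒢`, given by its étale space: a
family of abelian groups (the stalks), a topology on their disjoint union for which the
projection to `X` is a local homeomorphism and the fibrewise group operations are continuous, and
a continuous action of `𝒢` by group isomorphisms between the stalks. -/
structure GSheaf (X : Type u) [Groupoid.{u} X] [TopologicalSpace X]
    [TopologicalSpace (Arrows X)] where
  stalk : X → Type w
  [grp : ∀ x, AddCommGroup (stalk x)]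
  [top : TopologicalSpace (EtaleSpace stalk)]
  isLocalHomeomorph_base : IsLocalHomeomorph (EtaleSpace.base : EtaleSpace stalk → X)
  /-- Addition is continuous on the fibre product of the étale space with itself. -/
  continuous_add : Continuous[.induced (fun t : Σ x, stalk x × stalk x =>
      ((⟨t.1, t.2.1⟩ : EtaleSpace stalk), (⟨t.1, t.2.2⟩ : EtaleSpace stalk))) inferInstance, top]
    (fun t => ⟨t.1, t.2.1 + t.2.2⟩)
  continuous_neg : Continuous (fun e : EtaleSpace stalk => (⟨e.base, -e.val⟩ : EtaleSpace stalk))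
  /-- The action `e ↦ g e` of an arrow `g` with source `x` and range `y`. -/
  act : ∀ {x y : X}, (x ⟶ y) → stalk x →+ stalk y
  act_id : ∀ (x : X) (e : stalk x), act (𝟙 x) e = e
  act_comp : ∀ {x y z : X} (g : x ⟶ y) (h : y ⟶ z) (e : stalk x), act (g ≫ h) e = act h (act g e)
  /-- The action is continuous on the fibre product of the arrows (along the source map) with the
  étale space. -/
  continuous_act : Continuous[.induced (fun t : Σ a : Arrows X, stalk a.source =>
      (t.1, (⟨t.1.source, t.2⟩ : EtaleSpace stalk))) inferInstance, top]
    (fun t => ⟨t.1.range, act t.1.hom t.2⟩)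

attribute [instance] GSheaf.grp GSheaf.top

/-- A morphism of `𝒢`-sheaves. -/
@[ext]
structure GSheafHom {X : Type u} [Groupoid.{u} X] [TopologicalSpace X]
    [TopologicalSpace (Arrows X)] (S : GSheaf.{u, w} X) (T : GSheaf.{u, w'} X) where
  app : ∀ x, S.stalk x →+ T.stalk x
  continuous_app :
    Continuous (fun e : EtaleSpace S.stalk => (⟨e.base, app e.base e.val⟩ : EtaleSpace T.stalk))
  app_act : ∀ {x y : X} (g : x ⟶ y) (e : S.stalk x), app y (S.act g e) = T.act g (app x e)

namespace GSheaf

section Sections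

variable {X : Type u} [Groupoid.{u} X] [TopologicalSpace X] [TopologicalSpace (Arrows X)]
  (S : GSheaf.{u, w} X) {Y : Type*} [TopologicalSpace Y]

/-- `s` restricts to a section of `S` over `U` (the values of `s` outside `U` are irrelevant). -/
def IsSectionOn (U : Set X) (s : ∀ x, S.stalk x) : Prop :=
  ContinuousOn (fun x => (⟨x, s x⟩ : EtaleSpace S.stalk)) U

/-- A sheaf is `c`-soft if every section over an open neighbourhood of a compact set agrees, in
some smaller neighbourhood, with a global section. -/
def IsCSoft : Prop :=
  ∀ (K U : Set X) (s : ∀ x, S.stalk x), IsCompact K → IsOpen U → K ⊆ U → S.IsSectionOn U s →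
    ∃ (V : Set X) (t : ∀ x, S.stalk x), IsOpen V ∧ K ⊆ V ∧ V ⊆ U ∧ S.IsSectionOn Set.univ t ∧
      ∀ x ∈ V, t x = s x

/-- For `τ : Y → X`, the function `σ` is a continuous section over `Y` of the pullback sheaf
`τ^* S`, whose étale space is the fibre product of `Y` and the étale space of `S`. -/
def IsSectionAlong (τ : Y → X) (σ : ∀ y, S.stalk (τ y)) : Prop :=
  Continuous (fun y => (⟨τ y, σ y⟩ : EtaleSpace S.stalk))

variable {S} {τ : Y → X}

lemma IsSectionAlong.zero (hτ : Continuous τ) : S.IsSectionAlong τ (fun _ => 0) := by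
  refine continuous_iff_continuousAt.mpr fun y => ?_
  let e := S.isLocalHomeomorph_base.localInverseAt (⟨τ y, 0⟩ : EtaleSpace S.stalk)
  have hy : τ y ∈ e.source := S.isLocalHomeomorph_base.apply_self_mem_localInverseAt_source
  have he : ContinuousAt (fun y' => e (τ y')) y :=
    (e.continuousAt hy).comp hτ.continuousAt
  have hadd : ContinuousAt (fun y' => (⟨(e (τ y')).base, (e (τ y')).val + -(e (τ y')).val⟩ :
      EtaleSpace S.stalk)) y := by
    have h2 : ContinuousAt (fun e' : EtaleSpace S.stalk =>
        (⟨e'.base, e'.val + -e'.val⟩ : EtaleSpace S.stalk)) (e (τ y)) := by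
      refine Continuous.continuousAt ?_
      let _ : TopologicalSpace (Σ x, S.stalk x × S.stalk x) := .induced (fun t =>
        ((⟨t.1, t.2.1⟩ : EtaleSpace S.stalk), (⟨t.1, t.2.2⟩ : EtaleSpace S.stalk))) inferInstance
      exact S.continuous_add.comp (f := fun e' : EtaleSpace S.stalk =>
        (⟨e'.base, e'.val, -e'.val⟩ : Σ x, S.stalk x × S.stalk x))
        (continuous_induced_rng.mpr (continuous_id.prodMk S.continuous_neg))
    exact ContinuousAt.comp (f := fun y' => e (τ y')) h2 he
  refine hadd.congr ?_
  filter_upwards [hτ.continuousAt.preimage_mem_nhds (e.open_source.mem_nhds hy)] with y' hy'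
  have hb : (e (τ y')).base = τ y' := S.isLocalHomeomorph_base.apply_localInverseAt_of_mem hy'
  simp only [add_neg_cancel]
  rw [hb]

lemma IsSectionAlong.add {σ σ' : ∀ y, S.stalk (τ y)} (h : S.IsSectionAlong τ σ)
    (h' : S.IsSectionAlong τ σ') : S.IsSectionAlong τ (fun y => σ y + σ' y) := by
  let _ : TopologicalSpace (Σ x, S.stalk x × S.stalk x) := .induced (fun t =>
    ((⟨t.1, t.2.1⟩ : EtaleSpace S.stalk), (⟨t.1, t.2.2⟩ : EtaleSpace S.stalk))) inferInstance
  exact S.continuous_add.comp (f := fun y =>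
    (⟨τ y, σ y, σ' y⟩ : Σ x, S.stalk x × S.stalk x)) (continuous_induced_rng.mpr (h.prodMk h'))

lemma IsSectionAlong.neg {σ : ∀ y, S.stalk (τ y)} (h : S.IsSectionAlong τ σ) :
    S.IsSectionAlong τ (fun y => -σ y) := S.continuous_neg.comp h

lemma IsSectionAlong.sum {ι : Type*} (t : Finset ι) (hτ : Continuous τ)
    {σ : ι → ∀ y, S.stalk (τ y)} (h : ∀ i ∈ t, S.IsSectionAlong τ (σ i)) :
    S.IsSectionAlong τ (fun y => ∑ i ∈ t, σ i y) := by
  classical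
  induction t using Finset.induction_on with
  | empty => simpa using IsSectionAlong.zero hτ
  | insert i t hi ih =>
    simp only [Finset.sum_insert hi]
    exact (h i (by simp)).add (ih fun j hj => h j (by simp [hj]))

lemma IsSectionAlong.act {a : Y → Arrows X} (ha : Continuous a)
    {σ : ∀ y, S.stalk (a y).source} (h : S.IsSectionAlong (fun y => (a y).source) σ) :
    S.IsSectionAlong (fun y => (a y).range) (fun y => S.act (a y).hom (σ y)) := by
  let _ : TopologicalSpace (Σ a : Arrows X, S.stalk a.source) := .induced (fun t =>
    (t.1, (⟨t.1.source, t.2⟩ : EtaleSpace S.stalk))) inferInstance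
  exact S.continuous_act.comp (f := fun y => (⟨a y, σ y⟩ : Σ a : Arrows X, S.stalk a.source))
    (continuous_induced_rng.mpr (ha.prodMk h))

variable (S)

/-- The group `Γ_c(Y; τ^* S)` of compactly supported sections of the pullback of `S` along the
continuous map `τ : Y → X`. -/
def sectionsC {τ : Y → X} (hτ : Continuous τ) : AddSubgroup (∀ y, S.stalk (τ y)) where
  carrier := {σ | S.IsSectionAlong τ σ ∧ IsCompact (closure {y | σ y ≠ 0})}
  zero_mem' := ⟨IsSectionAlong.zero hτ, by simp⟩
  add_mem' := by
    rintro σ σ' ⟨h, hc⟩ ⟨h', hc'⟩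
    refine ⟨h.add h', (hc.union hc').of_isClosed_subset isClosed_closure ?_⟩
    rw [← closure_union]
    refine closure_mono fun y hy => ?_
    by_contra hn
    simp only [Set.mem_union, Set.mem_ofPred_eq, not_or, not_not] at hn
    exact hy (by simp [hn.1, hn.2])
  neg_mem' := by
    rintro σ ⟨h, hc⟩
    exact ⟨h.neg, by simpa using hc⟩

end Sections

section Push

variable {X : Type u} [Groupoid.{u} X] [TopologicalSpace X] [TopologicalSpace (Arrows X)]
  (S : GSheaf.{u, w} X) {Y Z : Type*} [TopologicalSpace Y] [TopologicalSpace Z]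

lemma finite_fiber [T1Space Z] {f : Y → Z} (hf : IsLocalHomeomorph f) {K : Set Y}
    (hK : IsCompact K) (z : Z) : (K ∩ f ⁻¹' {z}).Finite := by
  refine (hK.inter_right (isClosed_singleton.preimage hf.continuous)).finite ?_
  have : Subsingleton (f '' (K ∩ f ⁻¹' {z})) :=
    Set.subsingleton_coe _ |>.mpr <| Set.subsingleton_singleton.anti <| by
      rintro _ ⟨y, hy, rfl⟩; exact hy.2
  exact ⟨hf.isLocalHomeomorphOn.discreteTopology_of_image⟩

/-- Transport of stalks along an equality of points of `X`. -/
def castStalk {x y : X} (h : x = y) : S.stalk x →+ S.stalk y := S.act (eqToHom h)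

@[simp]
lemma castStalk_rfl {x : X} (e : S.stalk x) : S.castStalk rfl e = e := S.act_id x e

lemma mk_castStalk {x y : X} (h : x = y) (e : S.stalk x) :
    (⟨y, S.castStalk h e⟩ : EtaleSpace S.stalk) = ⟨x, e⟩ := by
  subst h; simp

/-- Summation along the fibres of `f`: `(f_! σ)(z) = ∑ σ(y)`, the sum over all `y` with
`f y = z`. -/
noncomputable def pushFun (f : Y → Z) (ρ : Z → X) (σ : ∀ y, S.stalk (ρ (f y))) (z : Z) :
    S.stalk (ρ z) :=
  ∑ᶠ y : {y // f y = z}, S.castStalk (congrArg ρ y.2) (σ y.1)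

variable {S} {f : Y → Z} {ρ : Z → X}

lemma hasFiniteSupport_push [T1Space Z] (hf : IsLocalHomeomorph f) {σ : ∀ y, S.stalk (ρ (f y))}
    (hσ : IsCompact (closure {y | σ y ≠ 0})) (z : Z) :
    (Function.support fun y : {y // f y = z} =>
      S.castStalk (congrArg ρ y.2) (σ y.1)).Finite := by
  refine Set.Finite.of_finite_image (f := Subtype.val) ?_ Subtype.val_injective.injOn
  refine (finite_fiber hf hσ z).subset ?_
  rintro _ ⟨⟨y, hy⟩, h, rfl⟩
  refine ⟨subset_closure fun h0 => h ?_, hy⟩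
  simp [h0]

lemma pushFun_add [T1Space Z] (hf : IsLocalHomeomorph f) {σ σ' : ∀ y, S.stalk (ρ (f y))}
    (hσ : IsCompact (closure {y | σ y ≠ 0})) (hσ' : IsCompact (closure {y | σ' y ≠ 0})) (z : Z) :
    S.pushFun f ρ (σ + σ') z = S.pushFun f ρ σ z + S.pushFun f ρ σ' z := by
  unfold pushFun
  rw [← finsum_add_distrib (hasFiniteSupport_push hf hσ z) (hasFiniteSupport_push hf hσ' z)]
  simp

lemma exists_of_pushFun_ne_zero {Y Z : Type*} {f : Y → Z} {ρ : Z → X} {σ : ∀ y, S.stalk (ρ (f y))} {z : Z}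
    (h : S.pushFun f ρ σ z ≠ 0) : ∃ y, f y = z ∧ σ y ≠ 0 := by
  by_contra! hn
  refine h (finsum_eq_zero_of_forall_eq_zero fun y => ?_)
  simp [hn y.1 y.2]

lemma isCompact_push [T2Space Z] (hf : IsLocalHomeomorph f) {σ : ∀ y, S.stalk (ρ (f y))}
    (hσ : IsCompact (closure {y | σ y ≠ 0})) :
    IsCompact (closure {z | S.pushFun f ρ σ z ≠ 0}) := by
  refine (hσ.image hf.continuous).of_isClosed_subset isClosed_closure
    (closure_minimal ?_ (hσ.image hf.continuous).isClosed)
  intro z hz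
  obtain ⟨y, rfl, hy⟩ := exists_of_pushFun_ne_zero hz
  exact ⟨y, subset_closure hy, rfl⟩

lemma isSectionAlong_push [T2Space Y] [T2Space Z] (hf : IsLocalHomeomorph f) (hρ : Continuous ρ)
    {σ : ∀ y, S.stalk (ρ (f y))} (h : S.IsSectionAlong (fun y => ρ (f y)) σ)
    (hσ : IsCompact (closure {y | σ y ≠ 0})) : S.IsSectionAlong ρ (S.pushFun f ρ σ) := by
  classical
  refine continuous_iff_continuousAt.mpr fun z₀ => ?_
  set K := closure {y | σ y ≠ 0} with hK
  have hfin := finite_fiber hf hσ z₀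
  obtain ⟨U, hU, hUd⟩ := hfin.t2_separation
  let e : Y → OpenPartialHomeomorph Z Y := fun y => hf.localInverseAt y
  let V : Y → Set Y := fun y => U y ∩ (e y).target
  have hV : ∀ y, IsOpen (V y) := fun y => (hU y).2.inter (e y).open_target
  let T := hfin.toFinset
  let N : Set Y := ⋃ y ∈ T, V y
  have hN : IsOpen N := isOpen_biUnion fun y _ => hV y
  let W : Set Z := (⋂ y ∈ T, f '' V y) ∩ (f '' (K \ N))ᶜ
  have hW : IsOpen W := (isOpen_biInter_finset fun y _ => hf.isOpenMap _ (hV y)).inter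
    ((hσ.diff hN).image hf.continuous).isClosed.isOpen_compl
  have hT : ∀ y ∈ T, f y = z₀ := fun y hy => (hfin.mem_toFinset.mp hy).2
  have hTV : ∀ y, y ∈ V y := fun y => ⟨(hU y).1, hf.self_mem_localInverseAt_target⟩
  have hz₀ : z₀ ∈ W := by
    refine ⟨Set.mem_iInter₂.mpr fun y hy => ⟨y, hTV y, hT y hy⟩, ?_⟩
    rintro ⟨y, ⟨hyK, hyN⟩, hy⟩
    exact hyN (Set.mem_biUnion (hfin.mem_toFinset.mpr ⟨hyK, hy⟩) (hTV y))
  have hsrc : ∀ y ∈ T, ∀ z ∈ W, z ∈ (e y).source ∧ e y z ∈ V y := by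
    intro y hy z hz
    obtain ⟨y', hy', rfl⟩ := Set.mem_iInter₂.mp hz.1 y hy
    have h1 : (e y).symm y' = f y' := by simp [e]
    have h2 : e y (f y') = y' := by rw [← h1]; exact (e y).right_inv hy'.2
    rw [h2, ← h1]
    exact ⟨(e y).map_target hy'.2, hy'⟩
  have hfe : ∀ y ∈ T, ∀ z ∈ W, f (e y z) = z := fun y hy z hz =>
    hf.apply_localInverseAt_of_mem (hsrc y hy z hz).1
  rw [← continuousWithinAt_iff_continuousAt (hW.mem_nhds hz₀)]
  refine ContinuousOn.continuousWithinAt ?_ hz₀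
  rw [continuousOn_iff_continuous_domRestrict]
  have hcont : S.IsSectionAlong (fun z : W => ρ z.1) fun z =>
      ∑ y : T, S.castStalk (congrArg ρ (hfe y.1 y.2 z.1 z.2)) (σ (e y.1 z.1)) := by
    refine IsSectionAlong.sum _ (hρ.comp continuous_subtype_val) fun y _ => ?_
    have h1 : Continuous fun z : W => e y.1 z.1 :=
      (e y.1).continuousOn.comp_continuous continuous_subtype_val
        fun z => (hsrc y.1 y.2 z.1 z.2).1
    exact (h.comp h1).congr fun z => (S.mk_castStalk _ _).symm
  refine hcont.congr fun z => ?_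
  change (⟨ρ z.1, _⟩ : EtaleSpace S.stalk) = ⟨ρ z.1, S.pushFun f ρ σ z.1⟩
  congr 1
  let j : T → {y // f y = z.1} := fun y => ⟨e y.1 z.1, hfe y.1 y.2 z.1 z.2⟩
  have hj : Function.Injective j := by
    intro y y' hyy
    have h1 : e y.1 z.1 = e y'.1 z.1 := congrArg Subtype.val hyy
    by_contra hne
    refine Set.disjoint_left.mp (hUd (hfin.mem_toFinset.mp y.2) (hfin.mem_toFinset.mp y'.2)
      fun h' => hne (Subtype.ext h')) (hsrc y.1 y.2 z.1 z.2).2.1 ?_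
    rw [h1]
    exact (hsrc y'.1 y'.2 z.1 z.2).2.1
  have hsupp : (Function.support fun y : {y // f y = z.1} =>
      S.castStalk (congrArg ρ y.2) (σ y.1)) ⊆ Finset.univ.image j := by
    rintro ⟨y, hy⟩ hne
    have hyK : y ∈ K := subset_closure fun h0 => hne (by simp [h0])
    have hyN : y ∈ N := by
      by_contra hyN
      exact z.2.2 ⟨y, ⟨hyK, hyN⟩, hy⟩
    obtain ⟨y', hy', hyV⟩ := Set.mem_iUnion₂.mp hyN
    simp only [Finset.coe_image, Finset.coe_univ, Set.image_univ]
    refine ⟨⟨y', hy'⟩, Subtype.ext ?_⟩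
    have h1 : (e y').symm y = f y := by simp [e]
    change e y' z.1 = y
    rw [← hy, ← h1]
    exact (e y').right_inv hyV.2
  rw [pushFun, finsum_eq_sum_of_support_subset _ hsupp, Finset.sum_image fun a _ b _ h => hj h]

variable (S) in
/-- Summation along the fibres of a local homeomorphism, on compactly supported sections. -/
noncomputable def push [T2Space Y] [T2Space Z] (hf : IsLocalHomeomorph f) (hρ : Continuous ρ) :
    S.sectionsC (hρ.comp hf.continuous) →+ S.sectionsC hρ where
  toFun σ := ⟨S.pushFun f ρ σ.1, isSectionAlong_push hf hρ σ.2.1 σ.2.2,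
    isCompact_push hf σ.2.2⟩
  map_zero' := by
    refine Subtype.ext (funext fun z => finsum_eq_zero_of_forall_eq_zero fun y => ?_)
    exact map_zero _
  map_add' σ σ' := Subtype.ext (funext fun z => pushFun_add hf σ.2.2 σ'.2.2 z)

end Push

section Bar

variable {X : Type u} [Groupoid.{u} X] [TopologicalSpace X] [TopologicalSpace (Arrows X)]
  [IsEtaleGroupoid X] (S : GSheaf.{u, w} X)

/-- The group `Γ_c(𝒢⁽ᵖ⁾; S_p)`, where `S_p` is the pullback of `S` along `x₀ ← ⋯ ← x_p ↦ x₀`. -/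
abbrev barGroup (p : ℕ) :
    AddSubgroup (∀ F : Strings X p, S.stalk (F.vertex 0)) :=
  S.sectionsC (Strings.continuous_vertex 0)

/-- The inverse of the arrow `x₀ ← x` of a string, where `x` is the initial vertex of the `i`-th
face.  It is a unit unless `i = 0`. -/
def faceHom {p : ℕ} (i : Fin (p + 2)) (F : Strings X (p + 1)) : F.vertex 0 ⟶ (F.face i).vertex 0 :=
  Groupoid.inv (F.hom (Fin.zero_le (i.succAbove 0)))

/-- The isomorphism between the pullbacks of `S` along `x₀` and along the vertex `x₀` of the
`i`-th face, given by the action of the inverse of the arrow between these two points. -/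
def twist (p : ℕ) (i : Fin (p + 2)) : S.barGroup (p + 1) →+
    S.sectionsC ((Strings.continuous_vertex (X := X) (n := p) 0).comp
      (Strings.isLocalHomeomorph_face i).continuous) where
  toFun σ := ⟨fun F => S.act (faceHom i F) (σ.1 F), by
      exact IsSectionAlong.act (a := fun F : Strings X (p + 1) =>
        invArrow (F.arrow (Fin.zero_le (i.succAbove 0))))
        (IsEtaleGroupoid.continuous_inv.comp (Strings.continuous_arrow _)) σ.2.1,
    σ.2.2.of_isClosed_subset isClosed_closure (closure_mono fun F hF h0 => hF <|
      (congrArg (S.act (faceHom i F)) h0).trans (map_zero _))⟩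
  map_zero' := Subtype.ext (funext fun F => map_zero _)
  map_add' σ σ' := Subtype.ext (funext fun F => map_add _ _ _)

/-- The map `δᵢ`, which sums over the fibres of the face map `dᵢ`. -/
noncomputable def faceSum [T2Space (Arrows X)] (p : ℕ) (i : Fin (p + 2)) :
    S.barGroup (p + 1) →+ S.barGroup p :=
  (S.push (Strings.isLocalHomeomorph_face i) (Strings.continuous_vertex 0)).comp (S.twist p i)

/-- The horizontal differential `δ = ∑ (-1)ⁱ δᵢ`. -/
noncomputable def barDifferential [T2Space (Arrows X)] (p : ℕ) :
    S.barGroup (p + 1) →+ S.barGroup p :=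
  ∑ i : Fin (p + 2), (-1 : ℤ) ^ (i : ℕ) • S.faceSum p i

end Bar

end GSheaf

/-! ### Homology -/

namespace GSheafHom

variable {X : Type u} [Groupoid.{u} X] [TopologicalSpace X] [TopologicalSpace (Arrows X)]
  {S : GSheaf.{u, w} X} {T : GSheaf.{u, w'} X}

/-- The map induced by a morphism of `𝒢`-sheaves on compactly supported sections. -/
def mapC (φ : GSheafHom S T) {Y : Type*} [TopologicalSpace Y] {τ : Y → X} (hτ : Continuous τ) :
    S.sectionsC hτ →+ T.sectionsC hτ where
  toFun σ := ⟨fun y => φ.app (τ y) (σ.1 y), φ.continuous_app.comp σ.2.1,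
    σ.2.2.of_isClosed_subset isClosed_closure (closure_mono fun y hy h0 => hy <|
      (congrArg (φ.app (τ y)) h0).trans (map_zero _))⟩
  map_zero' := Subtype.ext (funext fun _ => map_zero _)
  map_add' _ _ := Subtype.ext (funext fun _ => map_add _ _ _)

variable [IsEtaleGroupoid X]

/-- The map induced by a morphism of `𝒢`-sheaves on `Γ_c(𝒢⁽ᵖ⁾; -)`. -/
def bar (φ : GSheafHom S T) (p : ℕ) : S.barGroup p →+ T.barGroup p :=
  φ.mapC (Strings.continuous_vertex 0)

lemma bar_faceSum [T2Space (Arrows X)] (φ : GSheafHom S T) (p : ℕ) (i : Fin (p + 2))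
    (σ : S.barGroup (p + 1)) :
    φ.bar p (S.faceSum p i σ) = T.faceSum p i (φ.bar (p + 1) σ) := by
  refine Subtype.ext (funext fun F => ?_)
  change φ.app (F.vertex 0) (∑ᶠ G : {G : Strings X (p + 1) // G.face i = F},
      S.castStalk _ (S.act (GSheaf.faceHom i G.1) (σ.1 G.1))) =
    ∑ᶠ G : {G : Strings X (p + 1) // G.face i = F},
      T.castStalk _ (T.act (GSheaf.faceHom i G.1) (φ.app (G.1.vertex 0) (σ.1 G.1)))
  rw [AddMonoidHom.map_finsum]
  · refine finsum_congr fun G => ?_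
    rw [GSheaf.castStalk, app_act, app_act]
    rfl
  · exact GSheaf.hasFiniteSupport_push (ρ := Strings.vertex 0) (Strings.isLocalHomeomorph_face i)
      (S.twist p i σ).2.2 F

lemma bar_barDifferential [T2Space (Arrows X)] (φ : GSheafHom S T) (p : ℕ)
    (σ : S.barGroup (p + 1)) :
    φ.bar p (S.barDifferential p σ) = T.barDifferential p (φ.bar (p + 1) σ) := by
  simp only [GSheaf.barDifferential, AddMonoidHom.finsetSum_apply, map_sum,
    AddMonoidHom.smul_apply, map_zsmul, bar_faceSum]

end GSheafHom

section Resolutions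

variable {X : Type u} [Groupoid.{u} X] [TopologicalSpace X] [TopologicalSpace (Arrows X)]

/-- A resolution `0 → A → S⁰ → S¹ → ⋯` of a `𝒢`-sheaf by `c`-soft `𝒢`-sheaves.  Exactness is
exactness on stalks. -/
structure CSoftResolution (A : GSheaf.{u, w} X) where
  sheaf : ℕ → GSheaf.{u, u} X
  augmentation : GSheafHom A (sheaf 0)
  d : ∀ q, GSheafHom (sheaf q) (sheaf (q + 1))
  augmentation_injective : ∀ x, Function.Injective (augmentation.app x)
  exact_zero : ∀ x, Function.Exact (augmentation.app x) ((d 0).app x)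
  exact_succ : ∀ q x, Function.Exact ((d q).app x) ((d (q + 1)).app x)
  isCSoft : ∀ q, (sheaf q).IsCSoft

/-- A morphism of resolutions of `A` (inducing the identity on `A`). -/
structure ResolutionHom {A : GSheaf.{u, w} X} (R R' : CSoftResolution A) where
  hom : ∀ q, GSheafHom (R.sheaf q) (R'.sheaf q)
  hom_augmentation : ∀ x e, (hom 0).app x (R.augmentation.app x e) = R'.augmentation.app x e
  hom_d : ∀ q x e, (hom (q + 1)).app x ((R.d q).app x e) = (R'.d q).app x ((hom q).app x e)

variable [IsEtaleGroupoid X] [T2Space (Arrows X)] {A : GSheaf.{u, w} X}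

namespace CSoftResolution

/-- The direct sum `⨁_{p, q ≥ 0} Γ_c(𝒢⁽ᵖ⁾; S_p^q)` of all terms of the double complex. -/
abbrev Total (R : CSoftResolution A) : Type u :=
  DirectSum (ℕ × ℕ) fun pq => (R.sheaf pq.2).barGroup pq.1

open Classical in
/-- The total differential.  On `Γ_c(𝒢⁽ᵖ⁾; S_p^q)` it is the sum of the horizontal differential
`δ` to `Γ_c(𝒢⁽ᵖ⁻¹⁾; S_{p-1}^q)` (if `p ≥ 1`) and of `(-1)ᵖ` times the map to
`Γ_c(𝒢⁽ᵖ⁾; S_p^{q+1})` induced by the resolution. -/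
noncomputable def differential (R : CSoftResolution A) : R.Total →+ R.Total :=
  DirectSum.toAddMonoid fun
    | (0, q) => (DirectSum.of (fun pq : ℕ × ℕ => (R.sheaf pq.2).barGroup pq.1) (0, q + 1)).comp
        ((R.d q).bar 0)
    | (p + 1, q) =>
      (DirectSum.of (fun pq : ℕ × ℕ => (R.sheaf pq.2).barGroup pq.1) (p, q)).comp
        ((R.sheaf q).barDifferential p) +
      (-1 : ℤ) ^ (p + 1) •
        (DirectSum.of (fun pq : ℕ × ℕ => (R.sheaf pq.2).barGroup pq.1) (p + 1, q + 1)).comp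
          ((R.d q).bar (p + 1))

/-- The `n`-th group `⨁_{p - q = n} Γ_c(𝒢⁽ᵖ⁾; S_p^q)` of the total complex, for `n : ℤ`. -/
def chains (R : CSoftResolution A) (n : ℤ) : AddSubgroup R.Total where
  carrier := {a | ∀ p q : ℕ, (p : ℤ) - q ≠ n → a (p, q) = 0}
  zero_mem' := fun _ _ _ => rfl
  add_mem' := fun {a b} ha hb p q h => by
    rw [DirectSum.add_apply, ha p q h, hb p q h, add_zero]
  neg_mem' := fun {a} ha p q h => by
    rw [DFinsupp.neg_apply, ha p q h, neg_zero]

/-- The `n`-cycles of the total complex. -/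
noncomputable def cycles (R : CSoftResolution A) (n : ℤ) : AddSubgroup R.Total :=
  R.chains n ⊓ R.differential.ker

/-- The `n`-boundaries of the total complex. -/
noncomputable def boundaries (R : CSoftResolution A) (n : ℤ) : AddSubgroup R.Total :=
  (R.chains (n + 1)).map R.differential

/-- The `n`-th homology group of the total complex: cycles modulo boundaries (the differential
squares to zero, so that boundaries are cycles). -/
abbrev Homology (R : CSoftResolution A) (n : ℤ) : Type u :=
  R.cycles n ⧸ (R.boundaries n).addSubgroupOf (R.cycles n)

/-- The homology class of a cycle. -/
noncomputable def homologyClass (R : CSoftResolution A) (n : ℤ) : R.cycles n →+ R.Homology n :=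
  QuotientAddGroup.mk' _

end CSoftResolution

namespace ResolutionHom

variable {R R' : CSoftResolution A}

/-- The map of total complexes induced by a morphism of resolutions. -/
noncomputable def total (f : ResolutionHom R R') : R.Total →+ R'.Total :=
  DirectSum.map fun pq => (f.hom pq.2).bar pq.1

lemma total_differential (f : ResolutionHom R R') (a : R.Total) :
    f.total (R.differential a) = R'.differential (f.total a) := by
  classical
  have h : f.total.comp R.differential = R'.differential.comp f.total := by
    refine DirectSum.addHom_ext' fun pq => AddMonoidHom.ext fun σ => ?_
    obtain ⟨p, q⟩ := pq
    have hd : ∀ (p : ℕ) (σ : (R.sheaf q).barGroup p),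
        (f.hom (q + 1)).bar p ((R.d q).bar p σ) = (R'.d q).bar p ((f.hom q).bar p σ) :=
      fun p σ => Subtype.ext (funext fun F => f.hom_d q _ _)
    cases p with
    | zero => simp [total, CSoftResolution.differential, hd]
    | succ p =>
      simp [total, CSoftResolution.differential, hd, GSheafHom.bar_barDifferential]
  exact DFunLike.congr_fun h a

lemma total_mem_chains (f : ResolutionHom R R') {n : ℤ} {a : R.Total} (ha : a ∈ R.chains n) :
    f.total a ∈ R'.chains n := by
  intro p q h
  simp [total, ha p q h]

/-- The map of cycles induced by a morphism of resolutions. -/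
noncomputable def mapCycles (f : ResolutionHom R R') (n : ℤ) : R.cycles n →+ R'.cycles n :=
  (f.total.comp (R.cycles n).subtype).codRestrict (R'.cycles n) fun a =>
    ⟨f.total_mem_chains a.2.1, by
      have h : R.differential a.1 = 0 := a.2.2
      change R'.differential (f.total a.1) = 0
      rw [← total_differential, h, map_zero]⟩

/-- The map on homology induced by a morphism of resolutions. -/
noncomputable def mapHomology (f : ResolutionHom R R') (n : ℤ) : R.Homology n →+ R'.Homology n :=
  QuotientAddGroup.map _ _ (f.mapCycles n) <| by
    rintro a ⟨b, hb, hba⟩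
    exact ⟨f.total b, f.total_mem_chains hb,
      (f.total_differential b).symm.trans (congrArg f.total hba)⟩

end ResolutionHom

/-- The homology group `H_n(𝒢; A)`.  Every resolution `R` of `A` by `c`-soft `𝒢`-sheaves computes
it as `R.Homology n`; an element of `H_n(𝒢; A)` consists of one class in each of these groups, such
that the classes correspond to each other under all morphisms of resolutions. -/
def groupoidHomology (A : GSheaf.{u, w} X) (n : ℤ) :
    AddSubgroup (∀ R : CSoftResolution A, R.Homology n) where
  carrier := {c | ∀ (R R' : CSoftResolution A) (f : ResolutionHom R R'),
    f.mapHomology n (c R) = c R'}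
  zero_mem' := fun _ _ _ => map_zero _
  add_mem' := fun {c c'} hc hc' R R' f => by
    rw [Pi.add_apply, Pi.add_apply, map_add, hc R R' f, hc' R R' f]
  neg_mem' := fun {c} hc R R' f => by
    rw [Pi.neg_apply, Pi.neg_apply, map_neg, hc R R' f]

end Resolutions

/-! ### The sheaves of integers and of Borel functions -/

section BorelFunctions

variable {X : Type u} [TopologicalSpace X] [MeasurableSpace X]

/-- `f` restricts to a section over the open set `U` of the sheaf `𝓑`: its restriction to `U`
is a Borel function which is bounded on all compact subsets of `U` (the values of `f` outside `U`
are irrelevant). -/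
def IsBorelSection (U : Set X) (f : X → ℂ) : Prop :=
  Measurable (fun x : U => f x) ∧ ∀ K ⊆ U, IsCompact K → ∃ C : ℝ, ∀ x ∈ K, ‖f x‖ ≤ C

lemma IsBorelSection.mono {U V : Set X} {f : X → ℂ} (h : IsBorelSection U f) (hVU : V ⊆ U) :
    IsBorelSection V f :=
  ⟨h.1.comp (measurable_inclusion hVU), fun K hK => h.2 K (hK.trans hVU)⟩

lemma IsBorelSection.add {U : Set X} {f g : X → ℂ} (h : IsBorelSection U f)
    (h' : IsBorelSection U g) : IsBorelSection U (f + g) := by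
  refine ⟨h.1.add h'.1, fun K hK hKc => ?_⟩
  obtain ⟨C, hC⟩ := h.2 K hK hKc
  obtain ⟨C', hC'⟩ := h'.2 K hK hKc
  exact ⟨C + C', fun x hx => (norm_add_le _ _).trans (add_le_add (hC x hx) (hC' x hx))⟩

lemma IsBorelSection.neg {U : Set X} {f : X → ℂ} (h : IsBorelSection U f) :
    IsBorelSection U (-f) := by
  refine ⟨h.1.neg, fun K hK hKc => ?_⟩
  obtain ⟨C, hC⟩ := h.2 K hK hKc
  exact ⟨C, fun x hx => by simpa using hC x hx⟩

lemma isBorelSection_const (c : ℂ) (U : Set X) : IsBorelSection U (fun _ => c) :=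
  ⟨measurable_const, fun _ _ _ => ⟨‖c‖, fun _ _ => le_rfl⟩⟩

/-- The stalk of `𝓑` at `x`: the group of germs at `x` of sections of `𝓑` over open
neighbourhoods of `x`. -/
def borelGerms (x : X) : AddSubgroup (Filter.Germ (𝓝 x) ℂ) where
  carrier := {γ | ∃ (U : Set X) (f : X → ℂ), IsOpen U ∧ x ∈ U ∧ IsBorelSection U f ∧ γ = ↑f}
  zero_mem' := ⟨Set.univ, 0, isOpen_univ, trivial, isBorelSection_const 0 _, rfl⟩
  add_mem' := by
    rintro _ _ ⟨U, f, hU, hx, hf, rfl⟩ ⟨V, g, hV, hx', hg, rfl⟩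
    exact ⟨U ∩ V, f + g, hU.inter hV, ⟨hx, hx'⟩,
      (hf.mono Set.inter_subset_left).add (hg.mono Set.inter_subset_right), rfl⟩
  neg_mem' := by
    rintro _ ⟨U, f, hU, hx, hf, rfl⟩
    exact ⟨U, -f, hU, hx, hf.neg, rfl⟩

lemma borelGerms_mk_inj {x : X} {a b : borelGerms x}
    (h : (⟨x, a⟩ : EtaleSpace (fun x : X => borelGerms x)) = ⟨x, b⟩) : a = b := by
  cases h; rfl

variable (X) in
/-- A section of `𝓑` over an open set. -/
structure BorelSection where
  dom : Set X
  toFun : X → ℂ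
  isOpen_dom : IsOpen dom
  isBorelSection : IsBorelSection dom toFun

/-- The germ of a section of `𝓑` at a point of its domain. -/
def BorelSection.germ (f : BorelSection X) (x : f.dom) :
    EtaleSpace (fun x : X => borelGerms x) :=
  ⟨x.1, ↑f.toFun, f.dom, f.toFun, f.isOpen_dom, x.2, f.isBorelSection, rfl⟩

/-- The étale space topology: the finest topology for which the maps `x ↦ germ of f at x` are
continuous, for all sections `f` over open sets. -/
instance borelTopology : TopologicalSpace (EtaleSpace (fun x : X => borelGerms x)) :=
  ⨆ f : BorelSection X, .coinduced f.germ inferInstance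

namespace BorelSection

lemma continuous_germ (f : BorelSection X) : Continuous f.germ :=
  continuous_iff_coinduced_le.mpr (le_iSup (fun f : BorelSection X =>
    TopologicalSpace.coinduced f.germ inferInstance) f)

lemma exists_germ (e : EtaleSpace (fun x : X => borelGerms x)) :
    ∃ (f : BorelSection X) (h : e.base ∈ f.dom), f.germ ⟨e.base, h⟩ = e := by
  obtain ⟨x, _, U, f, hU, hx, hf, rfl⟩ := e
  exact ⟨⟨U, f, hU, hf⟩, hx, rfl⟩

lemma germ_eq_germ_iff {f g : BorelSection X} {x : X} (h : x ∈ f.dom) (h' : x ∈ g.dom) :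
    f.germ ⟨x, h⟩ = g.germ ⟨x, h'⟩ ↔ f.toFun =ᶠ[𝓝 x] g.toFun := by
  rw [← Filter.Germ.coe_eq]
  constructor
  · intro e
    exact congrArg Subtype.val (borelGerms_mk_inj e)
  · intro e
    exact congrArg (EtaleSpace.mk x) (Subtype.ext e)

lemma isOpenMap_germ (f : BorelSection X) : IsOpenMap f.germ := by
  intro V hV
  refine isOpen_iSup_iff.mpr fun g => isOpen_coinduced.mpr ?_
  refine isOpen_iff_mem_nhds.mpr ?_
  rintro ⟨x, hx⟩ ⟨⟨y, hy⟩, (hyV : (⟨y, hy⟩ : f.dom) ∈ V), hyx⟩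
  obtain rfl : y = x := congrArg EtaleSpace.base hyx
  rw [germ_eq_germ_iff] at hyx
  obtain ⟨V', hV', rfl⟩ := isOpen_induced_iff.mp hV
  have h1 : ∀ᶠ w in 𝓝 y, w ∈ V' ∧ w ∈ f.dom ∧ f.toFun =ᶠ[𝓝 w] g.toFun :=
    (hV'.eventually_mem (show y ∈ V' from hyV)).and ((f.isOpen_dom.eventually_mem hy).and hyx.eventually_nhds)
  filter_upwards [continuous_subtype_val.continuousAt.eventually h1] with w hw
  exact ⟨⟨w.1, hw.2.1⟩, hw.1, (germ_eq_germ_iff _ _).mpr hw.2.2⟩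

/-- Points near a germ of `f` are germs of `f`. -/
lemma eventually_eq_germ (f : BorelSection X) (x : f.dom) :
    ∀ᶠ e in 𝓝 (f.germ x), ∃ h : e.base ∈ f.dom, e = f.germ ⟨e.base, h⟩ := by
  have : Set.range f.germ ∈ 𝓝 (f.germ x) := f.isOpenMap_germ.isOpen_range.mem_nhds ⟨x, rfl⟩
  filter_upwards [this] with e he
  obtain ⟨y, rfl⟩ := he
  exact ⟨y.2, rfl⟩

lemma eventually_germ_mem (f : BorelSection X) (x : f.dom)
    {W : Set (EtaleSpace (fun x : X => borelGerms x))} (hW : W ∈ 𝓝 (f.germ x)) :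
    ∀ᶠ y in 𝓝 x.1, ∀ h : y ∈ f.dom, f.germ ⟨y, h⟩ ∈ W := by
  have h1 := f.continuous_germ.continuousAt.preimage_mem_nhds hW
  rw [nhds_subtype_eq_comap, Filter.mem_comap] at h1
  obtain ⟨V, hV, hVW⟩ := h1
  filter_upwards [hV] with y hy h
  exact hVW (show (⟨y, h⟩ : f.dom).1 ∈ V from hy)

lemma continuous_base :
    Continuous (EtaleSpace.base : EtaleSpace (fun x : X => borelGerms x) → X) :=
  continuous_iSup_dom.mpr fun _ => continuous_coinduced_dom.mpr continuous_subtype_val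

lemma isLocalHomeomorph_base :
    IsLocalHomeomorph (EtaleSpace.base : EtaleSpace (fun x : X => borelGerms x) → X) := by
  have hopen : IsOpenMap (EtaleSpace.base : EtaleSpace (fun x : X => borelGerms x) → X) := by
    intro W hW
    refine isOpen_iff_mem_nhds.mpr ?_
    rintro _ ⟨e, he, rfl⟩
    obtain ⟨f, h, hfe⟩ := exists_germ e
    have h1 := f.eventually_germ_mem ⟨e.base, h⟩ (W := W) (by rw [hfe]; exact hW.mem_nhds he)
    filter_upwards [h1, f.isOpen_dom.mem_nhds h] with y hy hyd
    exact ⟨_, hy hyd, rfl⟩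
  refine isLocalHomeomorph_iff_isOpenEmbedding_restrict.mpr fun e => ?_
  obtain ⟨f, h, hfe⟩ := exists_germ e
  have hr : IsOpen (Set.range f.germ) := f.isOpenMap_germ.isOpen_range
  refine ⟨_, hr.mem_nhds ⟨_, hfe⟩, IsOpenEmbedding.of_continuous_injective_isOpenMap
    (continuous_base.comp continuous_subtype_val) ?_ (hopen.domRestrict hr)⟩
  rintro ⟨_, x, rfl⟩ ⟨_, y, rfl⟩ hxy
  exact Subtype.ext (congrArg f.germ (Subtype.ext hxy))

end BorelSection

end BorelFunctions

section Sheaves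

variable (X : Type u) [Groupoid.{u} X] [TopologicalSpace X] [TopologicalSpace (Arrows X)]

/-- The `𝒢`-sheaf `𝒵` of locally constant `ℤ`-valued functions: its étale space is `X × ℤ`, with
the action of `𝒢` on the first factor. -/
def constInt [IsEtaleGroupoid X] : GSheaf.{u, 0} X where
  stalk _ := ℤ
  top := .induced (fun e => (e.base, e.val)) inferInstance
  isLocalHomeomorph_base := by
    let _ : TopologicalSpace (EtaleSpace fun _ : X => ℤ) :=
      .induced (fun e => (e.base, e.val)) inferInstance
    have hval : Continuous (EtaleSpace.val : EtaleSpace (fun _ : X => ℤ) → ℤ) :=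
      continuous_snd.comp (continuous_induced_dom (f := fun e : EtaleSpace (fun _ : X => ℤ) =>
        (e.base, e.val)))
    let h : EtaleSpace (fun _ : X => ℤ) ≃ₜ X × ℤ :=
      { toFun := fun e => (e.base, e.val)
        invFun := fun p => ⟨p.1, p.2⟩
        left_inv := fun _ => rfl
        right_inv := fun _ => rfl
        continuous_toFun := continuous_induced_dom
        continuous_invFun := continuous_induced_rng.mpr continuous_id }
    have hfst : IsLocalHomeomorph (Prod.fst : X × ℤ → X) := by
      refine isLocalHomeomorph_iff_isOpenEmbedding_restrict.mpr fun p => ?_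
      have hp : IsOpen (Prod.snd ⁻¹' {p.2} : Set (X × ℤ)) :=
        (isOpen_discrete _).preimage continuous_snd
      refine ⟨_, hp.mem_nhds rfl, IsOpenEmbedding.of_continuous_injective_isOpenMap
        (continuous_fst.comp continuous_subtype_val) ?_ (isOpenMap_fst.domRestrict hp)⟩
      rintro ⟨⟨x, m⟩, hm⟩ ⟨⟨y, n⟩, hn⟩ hxy
      exact Subtype.ext (Prod.ext hxy (hm.trans hn.symm))
    exact hfst.comp h.isLocalHomeomorph
  continuous_add := by
    let _ : TopologicalSpace (EtaleSpace fun _ : X => ℤ) :=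
      .induced (fun e => (e.base, e.val)) inferInstance
    have hc : Continuous (fun e : EtaleSpace (fun _ : X => ℤ) => (e.base, e.val)) :=
      continuous_induced_dom
    let _ : TopologicalSpace (Σ _ : X, ℤ × ℤ) := .induced (fun t =>
      ((⟨t.1, t.2.1⟩ : EtaleSpace (fun _ : X => ℤ)),
        (⟨t.1, t.2.2⟩ : EtaleSpace (fun _ : X => ℤ)))) inferInstance
    have hd : Continuous (fun t : Σ _ : X, ℤ × ℤ => ((⟨t.1, t.2.1⟩ : EtaleSpace (fun _ : X => ℤ)),
        (⟨t.1, t.2.2⟩ : EtaleSpace (fun _ : X => ℤ)))) := continuous_induced_dom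
    have h1 : Continuous (fun t : Σ _ : X, ℤ × ℤ => (t.1, t.2.1)) :=
      hc.comp (continuous_fst.comp hd)
    have h2 : Continuous (fun t : Σ _ : X, ℤ × ℤ => (t.1, t.2.2)) :=
      hc.comp (continuous_snd.comp hd)
    exact continuous_induced_rng.mpr
      ((continuous_fst.comp h1).prodMk (h1.snd.add h2.snd))
  continuous_neg := by
    let _ : TopologicalSpace (EtaleSpace fun _ : X => ℤ) :=
      .induced (fun e => (e.base, e.val)) inferInstance
    have hc : Continuous (fun e : EtaleSpace (fun _ : X => ℤ) => (e.base, e.val)) :=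
      continuous_induced_dom
    exact continuous_induced_rng.mpr
      ((continuous_fst.comp hc).prodMk (continuous_snd.comp hc).neg)
  act _ := AddMonoidHom.id ℤ
  act_id _ _ := rfl
  act_comp _ _ _ := rfl
  continuous_act := by
    let _ : TopologicalSpace (EtaleSpace fun _ : X => ℤ) :=
      .induced (fun e => (e.base, e.val)) inferInstance
    have hc : Continuous (fun e : EtaleSpace (fun _ : X => ℤ) => (e.base, e.val)) :=
      continuous_induced_dom
    let _ : TopologicalSpace (Σ _ : Arrows X, ℤ) := .induced (fun t =>
      (t.1, (⟨t.1.source, t.2⟩ : EtaleSpace (fun _ : X => ℤ)))) inferInstance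
    have hd : Continuous (fun t : Σ _ : Arrows X, ℤ =>
        (t.1, (⟨t.1.source, t.2⟩ : EtaleSpace (fun _ : X => ℤ)))) := continuous_induced_dom
    exact continuous_induced_rng.mpr
      ((IsEtaleGroupoid.isLocalHomeomorph_range.continuous.comp (continuous_fst.comp hd)).prodMk
        (continuous_snd.comp (hc.comp (continuous_snd.comp hd))))

variable {X}

section Theta

variable [IsEtaleGroupoid X]

/-- The germ at `r(a)` of a homeomorphism defined by an arrow `a`: on a neighbourhood of `r(a)`
it maps `r(b)` to `s(b)`, for all `b` in an open bisection that contains `a`. -/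
noncomputable def theta (a : Arrows X) (w : X) : X :=
  ((IsEtaleGroupoid.isLocalHomeomorph_range (X := X)).localInverseAt a w).source

/-- The domain of a continuous local inverse of the range map that takes the value `a`. -/
def thetaDom (a : Arrows X) : Set X :=
  ((IsEtaleGroupoid.isLocalHomeomorph_range (X := X)).localInverseAt a).source

/-- The image of a continuous local inverse of the range map that takes the value `a`. -/
def bisec (a : Arrows X) : Set (Arrows X) :=
  ((IsEtaleGroupoid.isLocalHomeomorph_range (X := X)).localInverseAt a).target

lemma isOpen_thetaDom (a : Arrows X) : IsOpen (thetaDom a) := OpenPartialHomeomorph.open_source _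

lemma range_mem_thetaDom (a : Arrows X) : a.range ∈ thetaDom a :=
  IsEtaleGroupoid.isLocalHomeomorph_range.apply_self_mem_localInverseAt_source

lemma isOpen_bisec (a : Arrows X) : IsOpen (bisec a) := OpenPartialHomeomorph.open_target _

lemma self_mem_bisec (a : Arrows X) : a ∈ bisec a :=
  IsEtaleGroupoid.isLocalHomeomorph_range.self_mem_localInverseAt_target

lemma theta_range {a b : Arrows X} (h : b ∈ bisec a) : theta a b.range = b.source := by
  have hr := IsEtaleGroupoid.isLocalHomeomorph_range (X := X)
  have h1 : (hr.localInverseAt a).symm b = b.range := by simp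
  have h2 := (hr.localInverseAt a).right_inv h
  rw [h1] at h2
  exact congrArg Arrows.source h2

lemma continuousOn_theta (a : Arrows X) : ContinuousOn (theta a) (thetaDom a) :=
  (Strings.isLocalHomeomorph_source X).continuous.comp_continuousOn
    (OpenPartialHomeomorph.continuousOn _)

lemma tendsto_theta (a : Arrows X) : Filter.Tendsto (theta a) (𝓝 a.range) (𝓝 a.source) := by
  have := ((continuousOn_theta a).continuousAt
    ((isOpen_thetaDom a).mem_nhds (range_mem_thetaDom a))).tendsto
  rwa [theta_range (self_mem_bisec a)] at this

/-- Near `r(a)`, every point is the range of an arrow near `a` with source given by `theta a`. -/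
lemma eventually_exists_arrow (a : Arrows X) {N : Set (Arrows X)} (hN : N ∈ 𝓝 a) :
    ∀ᶠ w in 𝓝 a.range, ∃ b ∈ N, b.range = w ∧ b.source = theta a w := by
  have hr := IsEtaleGroupoid.isLocalHomeomorph_range (X := X)
  have hc : ContinuousAt (hr.localInverseAt a) a.range :=
    (hr.localInverseAt a).continuousAt (range_mem_thetaDom a)
  have hN' : N ∈ 𝓝 (hr.localInverseAt a a.range) := by rwa [hr.localInverseAt_apply_self]
  filter_upwards [hc.preimage_mem_nhds hN',
    (isOpen_thetaDom a).mem_nhds (range_mem_thetaDom a)] with w h1 h2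
  exact ⟨_, h1, hr.apply_localInverseAt_of_mem h2, rfl⟩

lemma theta_eventuallyEq {a b : Arrows X} (h : b ∈ bisec a) : theta b =ᶠ[𝓝 b.range] theta a := by
  filter_upwards [eventually_exists_arrow b ((isOpen_bisec a).mem_nhds h)] with w hw
  obtain ⟨c, hc, rfl, hcs⟩ := hw
  rw [← hcs, theta_range hc]

lemma theta_unit (x : X) : theta (unitArrow x) =ᶠ[𝓝 x] id := by
  have : (unitArrow : X → Arrows X) ⁻¹' bisec (unitArrow x) ∈ 𝓝 x :=
    IsEtaleGroupoid.continuous_unit.continuousAt.preimage_mem_nhds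
      ((isOpen_bisec _).mem_nhds (self_mem_bisec _))
  filter_upwards [this] with w hw
  exact theta_range hw

lemma theta_mul (p : ComposablePair X) : theta (mulArrow p) =ᶠ[𝓝 p.z]
    theta ⟨p.x, p.y, p.g⟩ ∘ theta ⟨p.y, p.z, p.h⟩ := by
  have h1 : mulArrow ⁻¹' bisec (mulArrow p) ∈ 𝓝 p :=
    IsEtaleGroupoid.continuous_mul.continuousAt.preimage_mem_nhds
      ((isOpen_bisec _).mem_nhds (self_mem_bisec _))
  rw [nhds_induced, Filter.mem_comap] at h1
  obtain ⟨M, hM, hMsub⟩ := h1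
  obtain ⟨B, hB, C, hC, hBC⟩ := mem_nhds_prod_iff.mp hM
  have h2 := eventually_exists_arrow ⟨p.y, p.z, p.h⟩ hB
  have h3 := (tendsto_theta ⟨p.y, p.z, p.h⟩).eventually
    (eventually_exists_arrow ⟨p.x, p.y, p.g⟩ hC)
  filter_upwards [h2, h3] with w hw hw'
  obtain ⟨⟨b₁, b₂, b⟩, hbB, hbr, hbs⟩ := hw
  obtain ⟨⟨c₁, c₂, c⟩, hcC, hcr, hcs⟩ := hw'
  dsimp only at hbr hbs hcr hcs
  have h4 : c₂ = b₁ := hcr.trans hbs.symm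
  subst h4 hbr
  have h5 : mulArrow ⟨c, b⟩ ∈ bisec (mulArrow p) := hMsub (hBC ⟨hbB, hcC⟩)
  exact (theta_range h5).trans hcs

end Theta

section Borel

variable [MeasurableSpace X]

lemma IsBorelSection.comp_theta [BorelSpace X] [IsEtaleGroupoid X] {U : Set X} {f : X → ℂ}
    (h : IsBorelSection U f) (a : Arrows X) :
    IsBorelSection (thetaDom a ∩ theta a ⁻¹' U) (f ∘ theta a) := by
  have hc : ContinuousOn (theta a) (thetaDom a ∩ theta a ⁻¹' U) :=
    (continuousOn_theta a).mono Set.inter_subset_left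
  refine ⟨?_, fun K hK hKc => ?_⟩
  · have h1 : Continuous fun x : (thetaDom a ∩ theta a ⁻¹' U : Set X) =>
        (⟨theta a x.1, x.2.2⟩ : U) :=
      (continuousOn_iff_continuous_domRestrict.mp hc).subtype_mk _
    exact h.1.comp h1.measurable
  · obtain ⟨C, hC⟩ := h.2 (theta a '' K) (by rintro _ ⟨x, hx, rfl⟩; exact (hK hx).2)
      (hKc.image_of_continuousOn (hc.mono hK))
    exact ⟨C, fun x hx => hC _ ⟨x, hx, rfl⟩⟩

/-- The action of an arrow on germs: the germ of `f` at the source is mapped to the germ at the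
range of the composite of `f` with the local homeomorphism `r(b) ↦ s(b)`. -/
noncomputable def borelAct [BorelSpace X] [IsEtaleGroupoid X] {x y : X} (g : x ⟶ y) :
    borelGerms x →+ borelGerms y where
  toFun γ := ⟨γ.1.compTendsto (theta ⟨x, y, g⟩) (tendsto_theta ⟨x, y, g⟩), by
    have hr := range_mem_thetaDom ⟨x, y, g⟩
    obtain ⟨_, U, f, hU, hx, hf, rfl⟩ := γ
    refine ⟨thetaDom ⟨x, y, g⟩ ∩ theta ⟨x, y, g⟩ ⁻¹' U, f ∘ theta ⟨x, y, g⟩, ?_, ⟨hr, ?_⟩,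
      hf.comp_theta ⟨x, y, g⟩, rfl⟩
    · exact (continuousOn_theta _).isOpen_inter_preimage (isOpen_thetaDom _) hU
    · change theta ⟨x, y, g⟩ y ∈ U
      rwa [show theta ⟨x, y, g⟩ y = x from theta_range (self_mem_bisec ⟨x, y, g⟩)]⟩
  map_zero' := rfl
  map_add' := by
    rintro ⟨_, U, f, hU, hx, hf, rfl⟩ ⟨_, V, f', hV, hx', hf', rfl⟩
    rfl

end Borel

variable (X) in
/-- The `𝒢`-sheaf `𝓑` whose sections over `U` are the Borel functions `U → ℂ` which are
bounded on compact subsets of `U`. -/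
noncomputable def borelSheaf [MeasurableSpace X] [BorelSpace X] [IsEtaleGroupoid X] :
    GSheaf.{u, u} X where
  stalk x := borelGerms x
  top := borelTopology
  isLocalHomeomorph_base := BorelSection.isLocalHomeomorph_base
  continuous_add := by
    let _ : TopologicalSpace (Σ x : X, borelGerms x × borelGerms x) := .induced (fun t =>
      ((⟨t.1, t.2.1⟩ : EtaleSpace (fun x : X => borelGerms x)),
        (⟨t.1, t.2.2⟩ : EtaleSpace (fun x : X => borelGerms x)))) inferInstance
    have hd : Continuous (fun t : Σ x : X, borelGerms x × borelGerms x =>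
      ((⟨t.1, t.2.1⟩ : EtaleSpace (fun x : X => borelGerms x)),
        (⟨t.1, t.2.2⟩ : EtaleSpace (fun x : X => borelGerms x)))) := continuous_induced_dom
    refine continuous_iff_continuousAt.mpr ?_
    rintro ⟨x, ⟨_, U, f, hU, hx, hf, rfl⟩, ⟨_, V, g, hV, hx', hg, rfl⟩⟩ W hW
    let φ : BorelSection X := ⟨U, f, hU, hf⟩
    let ψ : BorelSection X := ⟨V, g, hV, hg⟩
    let χ : BorelSection X := ⟨U ∩ V, f + g, hU.inter hV,
      (hf.mono Set.inter_subset_left).add (hg.mono Set.inter_subset_right)⟩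
    let t₀ : Σ x : X, borelGerms x × borelGerms x :=
      ⟨x, (φ.germ ⟨x, hx⟩).val, (ψ.germ ⟨x, hx'⟩).val⟩
    have h1 := ((continuous_fst.comp hd).tendsto t₀).eventually (φ.eventually_eq_germ ⟨x, hx⟩)
    have h2 := ((continuous_snd.comp hd).tendsto t₀).eventually (ψ.eventually_eq_germ ⟨x, hx'⟩)
    have h3 := ((BorelSection.continuous_base.comp (continuous_fst.comp hd)).tendsto t₀).eventually
      (χ.eventually_germ_mem ⟨x, hx, hx'⟩ hW)
    refine Filter.mem_map.mpr ?_
    filter_upwards [h1, h2, h3]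
    rintro ⟨y, γ, γ'⟩ ⟨hy, e⟩ ⟨hy', e'⟩ h
    have hγ : γ = (φ.germ ⟨y, hy⟩).val := borelGerms_mk_inj e
    have hγ' : γ' = (ψ.germ ⟨y, hy'⟩).val := borelGerms_mk_inj e'
    change (⟨y, γ + γ'⟩ : EtaleSpace (fun x : X => borelGerms x)) ∈ W
    rw [hγ, hγ']
    exact h ⟨hy, hy'⟩
  continuous_neg := by
    refine continuous_iff_continuousAt.mpr ?_
    rintro ⟨x, _, U, f, hU, hx, hf, rfl⟩ W hW
    let φ : BorelSection X := ⟨U, f, hU, hf⟩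
    let χ : BorelSection X := ⟨U, -f, hU, hf.neg⟩
    have h1 := φ.eventually_eq_germ ⟨x, hx⟩
    have h2 := (BorelSection.continuous_base.tendsto (φ.germ ⟨x, hx⟩)).eventually
      (χ.eventually_germ_mem ⟨x, hx⟩ hW)
    refine Filter.mem_map.mpr ?_
    filter_upwards [h1, h2]
    rintro ⟨y, γ⟩ ⟨hy, e⟩ h
    have hγ : γ = (φ.germ ⟨y, hy⟩).val := borelGerms_mk_inj e
    change (⟨y, -γ⟩ : EtaleSpace (fun x : X => borelGerms x)) ∈ W
    rw [hγ]
    exact h hy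
  act := borelAct
  act_id x := by
    rintro ⟨_, U, f, hU, hx, hf, rfl⟩
    refine Subtype.ext (Filter.Germ.coe_eq.mpr ?_)
    filter_upwards [theta_unit x] with w hw
    exact congrArg f hw
  act_comp {x y z} g h := by
    rintro ⟨_, U, f, hU, hx, hf, rfl⟩
    refine Subtype.ext (Filter.Germ.coe_eq.mpr ?_)
    filter_upwards [theta_mul ⟨g, h⟩] with w hw
    exact congrArg f hw
  continuous_act := by
    let _ : TopologicalSpace (Σ a : Arrows X, borelGerms a.source) := .induced (fun t =>
      (t.1, (⟨t.1.source, t.2⟩ : EtaleSpace (fun x : X => borelGerms x)))) inferInstance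
    have hd : Continuous (fun t : Σ a : Arrows X, borelGerms a.source =>
      (t.1, (⟨t.1.source, t.2⟩ : EtaleSpace (fun x : X => borelGerms x)))) :=
      continuous_induced_dom
    refine continuous_iff_continuousAt.mpr ?_
    rintro ⟨a, _, U, f, hU, hx, hf, rfl⟩ W hW
    let φ : BorelSection X := ⟨U, f, hU, hf⟩
    let χ : BorelSection X := ⟨thetaDom a ∩ theta a ⁻¹' U, f ∘ theta a,
      (continuousOn_theta _).isOpen_inter_preimage (isOpen_thetaDom _) hU, hf.comp_theta a⟩
    have hχ : a.range ∈ χ.dom := ⟨range_mem_thetaDom a, by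
      change theta a a.range ∈ U
      rwa [theta_range (self_mem_bisec a)]⟩
    let t₀ : Σ a : Arrows X, borelGerms a.source := ⟨a, (φ.germ ⟨_, hx⟩).val⟩
    have h1 := ((continuous_snd.comp hd).tendsto t₀).eventually (φ.eventually_eq_germ ⟨_, hx⟩)
    have h2 := ((continuous_fst.comp hd).tendsto t₀).eventually
      ((isOpen_bisec a).eventually_mem (self_mem_bisec a))
    have h3 := ((IsEtaleGroupoid.isLocalHomeomorph_range.continuous.comp
      (continuous_fst.comp hd)).tendsto t₀).eventually
        ((χ.eventually_germ_mem ⟨_, hχ⟩ hW).and (χ.isOpen_dom.eventually_mem hχ))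
    refine Filter.mem_map.mpr ?_
    filter_upwards [h1, h2, h3]
    rintro ⟨b, γ⟩ ⟨hb, e⟩ hba ⟨h, h'⟩
    have hγ : γ = (φ.germ ⟨b.source, hb⟩).val := borelGerms_mk_inj e
    change (⟨b.range, borelAct b.hom γ⟩ : EtaleSpace (fun x : X => borelGerms x)) ∈ W
    rw [hγ]
    have key := h h'
    have hEq : χ.germ ⟨b.range, h'⟩ = ⟨b.range, borelAct b.hom (φ.germ ⟨b.source, hb⟩).val⟩ := by
      refine congrArg (EtaleSpace.mk b.range) (Subtype.ext (Filter.Germ.coe_eq.mpr ?_))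
      filter_upwards [theta_eventuallyEq hba] with w hw
      exact (congrArg f hw).symm
    change χ.germ ⟨b.range, h'⟩ ∈ W at key
    rw [hEq] at key
    exact key

/-- The inclusion `𝒵 → 𝓑` of the locally constant `ℤ`-valued functions. -/
noncomputable def constToBorel (X : Type u) [Groupoid.{u} X] [TopologicalSpace X]
    [TopologicalSpace (Arrows X)] [MeasurableSpace X] [BorelSpace X] [IsEtaleGroupoid X] :
    GSheafHom (constInt X) (borelSheaf X) where
  app x :=
    { toFun := fun n : ℤ => (⟨((fun _ => (n : ℂ) : X → ℂ) : Filter.Germ (𝓝 x) ℂ), Set.univ, _,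
        isOpen_univ, trivial, isBorelSection_const (n : ℂ) _, rfl⟩ : borelGerms x)
      map_zero' := Subtype.ext (Filter.Germ.coe_eq.mpr (.of_forall fun _ => Int.cast_zero))
      map_add' := fun m n =>
        Subtype.ext (Filter.Germ.coe_eq.mpr (.of_forall fun _ => Int.cast_add m n)) }
  continuous_app := by
    let _ : TopologicalSpace (EtaleSpace fun _ : X => ℤ) :=
      .induced (fun e => (e.base, e.val)) inferInstance
    have hc : Continuous (fun e : EtaleSpace (fun _ : X => ℤ) => (e.base, e.val)) :=
      continuous_induced_dom
    refine continuous_iff_continuousAt.mpr ?_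
    rintro ⟨x, n⟩ W hW
    change ℤ at n
    let φ : BorelSection X := ⟨Set.univ, fun _ => (n : ℂ), isOpen_univ,
      isBorelSection_const _ _⟩
    change W ∈ 𝓝 (φ.germ ⟨x, trivial⟩) at hW
    have h1 := (hc.fst.tendsto (⟨x, n⟩ : EtaleSpace (fun _ : X => ℤ))).eventually
      (φ.eventually_germ_mem ⟨x, trivial⟩ hW)
    have h2 := (hc.snd.tendsto (⟨x, n⟩ : EtaleSpace (fun _ : X => ℤ))).eventually
      ((isOpen_discrete {n}).eventually_mem rfl)
    refine Filter.mem_map.mpr ?_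
    filter_upwards [h1, h2]
    rintro ⟨y, m⟩ h (rfl : m = n)
    exact h trivial
  app_act _ _ := rfl

end Sheaves

/-! ### Invariant measures and Borel resolutions -/

section Pairing

variable (X : Type u) [Groupoid.{u} X] [TopologicalSpace X] [TopologicalSpace (Arrows X)]
  [MeasurableSpace X]

variable {X} in
/-- A measure `μ` on the base space is invariant if `r^* μ = s^* μ`, that is, if the functionals
`f ↦ ∫ ∑_{r(g) = x} f(g) dμ(x)` and `f ↦ ∫ ∑_{s(g) = x} f(g) dμ(x)` on `C_c(𝒢)` are equal. -/
def IsInvariantMeasure (μ : Measure X) : Prop :=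
  ∀ f : Arrows X → ℂ, Continuous f → HasCompactSupport f →
    ∫ x, ∑ᶠ g : {g : Arrows X // g.range = x}, f g ∂μ =
      ∫ x, ∑ᶠ g : {g : Arrows X // g.source = x}, f g ∂μ

/-- The space `T(𝒢)` of invariant (regular) Borel probability measures on the base space. -/
def invariantMeasures : Set (ProbabilityMeasure X) :=
  {μ | (μ : Measure X).Regular ∧ IsInvariantMeasure (μ : Measure X)}

variable [BorelSpace X] [IsEtaleGroupoid X]

/-- A Borel resolution: a resolution `0 → 𝒵 → S⁰ → S¹ → ⋯` by `c`-soft `𝒢`-sheaves such that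
`S⁰` is a subsheaf of `𝓑` (through the monomorphism `inclusion`) and `𝒵 → S⁰` is the
inclusion. -/
structure BorelResolution extends CSoftResolution (constInt X) where
  inclusion : GSheafHom (sheaf 0) (borelSheaf X)
  inclusion_injective : ∀ x, Function.Injective (inclusion.app x)
  inclusion_augmentation : ∀ x n,
    inclusion.app x (augmentation.app x n) = (constToBorel X).app x n

variable {X}

/-- The component `a₀` in `Γ_c(𝒢⁽⁰⁾; S⁰)` of an element `a` of the total complex, as a function
on the base space. -/
noncomputable def BorelResolution.baseFunction [T2Space (Arrows X)] (R : BorelResolution X)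
    (a : R.Total) (x : X) : ℂ :=
  (R.inclusion.app x ((a (0, 0)).1 (Strings.ofBase x))).1.value

end Pairing

end EtaleGpd

open EtaleGpd

/-! Existence. Borel functions can be multiplied by indicator functions of open sets, so the sheaf
of `V`-valued functions in `𝓑` is `c`-soft for every subgroup `V` of `ℂ`
(`isCSoft_valuedBorelSheaf`). To continue a monomorphism from `𝒵` to a resolution, each cokernel is
embedded in a coinduced sheaf `r_* s^* M` whose sections are arbitrary functions on the arrows with
values in injective groups. Such a sheaf is `c`-soft, since functions without any continuity extend
(`isCSoft_coind`), and it is an injective `𝒢`-sheaf, since morphisms to it amount to homomorphisms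
on stalks (`exists_extend_coind`). This gives `resolve`.

Independence. There is a resolution `I` by injective `𝒢`-sheaves; every `c`-soft resolution maps to
`I`, uniquely up to homotopy (`exists_hom_injectiveResolution`, `exists_homotopy`), and homotopic
morphisms agree on homology. It remains to see that each morphism of `c`-soft resolutions induces
isomorphisms on homology. Its mapping cone is an exact sequence of soft sheaves. All kernels are
then soft too (`kerSoft_of_exact`), and sections of compact support of the pullback along a local
homeomorphism lift with compact support (`exists_lift_compactSupport`). So every column of the cone
of double complexes is exact. A chain lives in finitely many columns, and a cycle is made a boundary
by removing its columns one at a time, from the highest (`exists_cone_boundary`,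
`mapHomology_bijective`). Compatible families of classes therefore correspond to classes of `I`,
hence to classes of any single resolution (`groupoidHomology_bijective`).

Pairing. The component `a₀` of a boundary is `δ` of an element of `Γ_c(𝒢⁽¹⁾; S⁰)`. In terms of
values, this is the difference of the sums of one bounded Borel function of compact support over the
fibres of source and range. Invariance of `μ` is assumed on `C_c(𝒢)` only; on an open bisection it
says that two regular measures agree on continuous functions of compact support, hence are equal
(`comap_eq_comap`), and a partition into Borel pieces extends it to Borel functions
(`isBalanced_of_isCompact`). So the integral of `a₀` vanishes on boundaries
(`integral_barDifferential`).

All Borel resolutions give the same pairing, because each maps to one that begins with all of `𝓑`,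
by a morphism that does not change `a₀` (`exists_hom_borelResolution`). The values are real because
the real-valued Borel functions also begin a Borel resolution: there `a₀` itself is real. -/

namespace EtaleGpd

open Filter

universe w₁ w₂ w₃ v

/-! ### Sheaves described by their local sections -/

/-- A sheaf of abelian groups given by its stalks and by its sections near points: `sec x s` says
that `s` is a section in a neighbourhood of `x` (the values elsewhere are irrelevant). -/
structure LocSheaf (X : Type u) [TopologicalSpace X] where
  stalk : X → Type w
  [grp : ∀ x, AddCommGroup (stalk x)]
  sec : X → (∀ x, stalk x) → Prop
  sec_congr : ∀ {x : X} {s t : ∀ x, stalk x}, sec x s → (∀ᶠ y in 𝓝 x, s y = t y) → sec x t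
  sec_eventually : ∀ {x : X} {s : ∀ x, stalk x}, sec x s → ∀ᶠ y in 𝓝 x, sec y s
  sec_sub : ∀ {x : X} {s t : ∀ x, stalk x}, sec x s → sec x t → sec x (fun y => s y - t y)
  exists_sec : ∀ (x : X) (e : stalk x), ∃ s, sec x s ∧ s x = e
  eventually_zero : ∀ {x : X} {s : ∀ x, stalk x}, sec x s → s x = 0 → ∀ᶠ y in 𝓝 x, s y = 0

attribute [instance] LocSheaf.grp

namespace LocSheaf

section Basic

variable {X : Type u} [TopologicalSpace X] (L : LocSheaf.{u, w} X)

lemma sec_zero (x : X) : L.sec x (fun _ => 0) := by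
  obtain ⟨s, hs, -⟩ := L.exists_sec x 0
  simpa using L.sec_sub hs hs

variable {L}

lemma sec_neg {x : X} {s : ∀ x, L.stalk x} (h : L.sec x s) : L.sec x (fun y => -s y) := by
  simpa using L.sec_sub (L.sec_zero x) h

lemma sec_add {x : X} {s t : ∀ x, L.stalk x} (h : L.sec x s) (h' : L.sec x t) :
    L.sec x (fun y => s y + t y) := by
  simpa using L.sec_sub h (sec_neg h')

lemma sec_eventuallyEq {x : X} {s t : ∀ x, L.stalk x} (h : L.sec x s) (h' : L.sec x t)
    (e : s x = t x) : ∀ᶠ y in 𝓝 x, s y = t y := by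
  filter_upwards [L.eventually_zero (L.sec_sub h h') (by simp [e])] with y hy
  exact sub_eq_zero.mp hy

lemma sec_of_eventually_zero {x : X} {s : ∀ x, L.stalk x} (h : ∀ᶠ y in 𝓝 x, s y = 0) :
    L.sec x s := L.sec_congr (L.sec_zero x) (h.mono fun _ e => e.symm)

variable (L) in
/-- A section through a point of the étale space. -/
noncomputable def through {x : X} (e : L.stalk x) : ∀ y, L.stalk y := (L.exists_sec x e).choose

lemma sec_through {x : X} (e : L.stalk x) : L.sec x (L.through e) :=
  (L.exists_sec x e).choose_spec.1

lemma through_self {x : X} (e : L.stalk x) : L.through e x = e := (L.exists_sec x e).choose_spec.2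

variable (L) in
/-- The topology of the étale space. -/
abbrev etaleTopology : TopologicalSpace (EtaleSpace L.stalk) where
  IsOpen W := ∀ x s, L.sec x s → (⟨x, s x⟩ : EtaleSpace L.stalk) ∈ W →
    ∀ᶠ y in 𝓝 x, (⟨y, s y⟩ : EtaleSpace L.stalk) ∈ W
  isOpen_univ _ _ _ _ := .of_forall fun _ => trivial
  isOpen_inter W W' h h' x s hs hx := (h x s hs hx.1).and (h' x s hs hx.2)
  isOpen_sUnion 𝒲 h x s hs := by
    rintro ⟨W, hW, hx⟩
    exact (h W hW x s hs hx).mono fun y hy => ⟨W, hW, hy⟩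

lemma eventually_mem_of_sec {x : X} {s : ∀ x, L.stalk x} (h : L.sec x s)
    {W : Set (EtaleSpace L.stalk)} (hW : W ∈ @nhds _ L.etaleTopology ⟨x, s x⟩) :
    ∀ᶠ y in 𝓝 x, (⟨y, s y⟩ : EtaleSpace L.stalk) ∈ W := by
  let _ := L.etaleTopology
  obtain ⟨W', hW', ho, hx⟩ := mem_nhds_iff.mp hW
  exact (ho x s h hx).mono fun y hy => hW' hy

/-- The values of `s` over an open set on which it is a section form an open set: another section
through one of these values agrees with `s` nearby. -/
lemma eventually_eq_of_sec {x : X} {s : ∀ x, L.stalk x} (h : L.sec x s) :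
    ∀ᶠ e in @nhds _ L.etaleTopology ⟨x, s x⟩, e = (⟨e.base, s e.base⟩ : EtaleSpace L.stalk) := by
  let _ := L.etaleTopology
  obtain ⟨V, hV, hVo, hx⟩ := eventually_nhds_iff.mp (L.sec_eventually h)
  have ho : IsOpen {e : EtaleSpace L.stalk | e.base ∈ V ∧ e.val = s e.base} := by
    rintro y t ht ⟨hy, hty⟩
    filter_upwards [sec_eventuallyEq ht (hV y hy) hty, hVo.mem_nhds hy] with z hz hzV
    exact ⟨hzV, hz⟩
  filter_upwards [ho.mem_nhds ⟨hx, rfl⟩] with e he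
  exact EtaleSpace.ext rfl (heq_of_eq he.2)

/-- A function continuous at `x` has to run along the section through its value at `x`, because the
image of that section is a neighbourhood of the value. Thus the étale topology has no more sections
than `sec` prescribes. -/
lemma continuousAt_iff_sec {x : X} {s : ∀ x, L.stalk x} :
    @ContinuousAt _ _ _ L.etaleTopology (fun y => (⟨y, s y⟩ : EtaleSpace L.stalk)) x ↔
      L.sec x s := by
  let _ := L.etaleTopology
  refine ⟨fun h => ?_, fun h W hW => eventually_mem_of_sec h hW⟩
  obtain ⟨t, ht, e⟩ := L.exists_sec x (s x)
  have h1 := eventually_eq_of_sec ht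
  rw [e] at h1
  refine L.sec_congr ht ?_
  filter_upwards [h.eventually h1] with y hy
  cases EtaleSpace.mk.inj hy with
  | intro _ h2 => exact (eq_of_heq h2).symm

lemma continuous_base : @Continuous _ _ L.etaleTopology _ (EtaleSpace.base : EtaleSpace L.stalk → X) := by
  let _ := L.etaleTopology
  exact ⟨fun U hU x s _ hx => hU.mem_nhds hx⟩

lemma isLocalHomeomorph_base :
    @IsLocalHomeomorph _ _ L.etaleTopology _ (EtaleSpace.base : EtaleSpace L.stalk → X) := by
  let _ := L.etaleTopology
  have hopen : IsOpenMap (EtaleSpace.base : EtaleSpace L.stalk → X) := by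
    intro W hW
    refine isOpen_iff_mem_nhds.mpr ?_
    rintro _ ⟨⟨x, e⟩, he, rfl⟩
    obtain ⟨s, hs, rfl⟩ := L.exists_sec x e
    filter_upwards [hW x s hs he] with y hy
    exact ⟨_, hy, rfl⟩
  refine isLocalHomeomorph_iff_isOpenEmbedding_restrict.mpr ?_
  rintro ⟨x, e⟩
  obtain ⟨s, hs, rfl⟩ := L.exists_sec x e
  obtain ⟨N, hN, hNo, hxN⟩ := eventually_nhds_iff.mp (eventually_eq_of_sec hs)
  refine ⟨N, hNo.mem_nhds hxN, IsOpenEmbedding.of_continuous_injective_isOpenMap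
    (continuous_base.comp continuous_subtype_val) ?_ (hopen.domRestrict hNo)⟩
  rintro ⟨e, he⟩ ⟨e', he'⟩ (h : e.base = e'.base)
  refine Subtype.ext ?_
  change e = e'
  rw [hN e he, hN e' he', h]

/-- Pullback of sheaves along a continuous map. -/
abbrev pull (L : LocSheaf.{u, w} X) {Y : Type v} [TopologicalSpace Y] {τ : Y → X}
    (hτ : Continuous τ) : LocSheaf.{v, w} Y where
  stalk y := L.stalk (τ y)
  sec y σ := ∃ s, L.sec (τ y) s ∧ ∀ᶠ y' in 𝓝 y, σ y' = s (τ y')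
  sec_congr := by
    rintro y σ σ' ⟨s, hs, h⟩ h'
    exact ⟨s, hs, by filter_upwards [h, h'] with z h1 h2 using h2.symm.trans h1⟩
  sec_eventually := by
    rintro y σ ⟨s, hs, h⟩
    filter_upwards [h.eventually_nhds, hτ.continuousAt.eventually (L.sec_eventually hs)] with z h1 h2
    exact ⟨s, h2, h1⟩
  sec_sub := by
    rintro y σ σ' ⟨s, hs, h⟩ ⟨s', hs', h'⟩
    exact ⟨_, L.sec_sub hs hs', by filter_upwards [h, h'] with z h1 h2 using by rw [h1, h2]⟩
  exists_sec y e := by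
    obtain ⟨s, hs, rfl⟩ := L.exists_sec _ e
    exact ⟨fun y => s (τ y), ⟨s, hs, .of_forall fun _ => rfl⟩, rfl⟩
  eventually_zero := by
    rintro y σ ⟨s, hs, h⟩ h0
    have h1 : s (τ y) = 0 := by rw [← h0, h.self_of_nhds]
    filter_upwards [h, hτ.continuousAt.eventually (L.eventually_zero hs h1)] with z h2 h3
    rw [h2, h3]

/-- The direct sum of two sheaves. -/
abbrev prod (L : LocSheaf.{u, w} X) (L' : LocSheaf.{u, w'} X) : LocSheaf.{u, max w w'} X where
  stalk x := L.stalk x × L'.stalk x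
  sec x s := L.sec x (fun y => (s y).1) ∧ L'.sec x (fun y => (s y).2)
  sec_congr h e := ⟨L.sec_congr h.1 (e.mono fun _ h => congrArg _ h),
    L'.sec_congr h.2 (e.mono fun _ h => congrArg _ h)⟩
  sec_eventually h := (L.sec_eventually h.1).and (L'.sec_eventually h.2)
  sec_sub h h' := ⟨L.sec_sub h.1 h'.1, L'.sec_sub h.2 h'.2⟩
  exists_sec x e := by
    obtain ⟨s, hs, h⟩ := L.exists_sec x e.1
    obtain ⟨s', hs', h'⟩ := L'.exists_sec x e.2
    exact ⟨fun y => (s y, s' y), ⟨hs, hs'⟩, Prod.ext h h'⟩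
  eventually_zero h e := ((L.eventually_zero h.1 (congrArg Prod.fst e)).and
    (L'.eventually_zero h.2 (congrArg Prod.snd e))).mono fun _ h => Prod.ext h.1 h.2

/-- A morphism of sheaves. -/
structure Hom (L : LocSheaf.{u, w} X) (L' : LocSheaf.{u, w'} X) where
  app : ∀ x, L.stalk x →+ L'.stalk x
  map_sec : ∀ {x s}, L.sec x s → L'.sec x (fun y => app y (s y))

end Basic

end LocSheaf

/-! ### Translation between `𝒢`-sheaves and local sections -/

namespace GSheaf

section ToLoc

variable {X : Type u} [Groupoid.{u} X] [TopologicalSpace X] [TopologicalSpace (Arrows X)]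
  (S : GSheaf.{u, w} X)

/-- Turns a map to the étale space that lies over `τ` near `y` into a dependent function over `τ`,
by transport along the equality of base points; where the base points differ, the value is `0`. -/
lemma continuousAt_mk_castStalk {Y : Type*} [TopologicalSpace Y] {τ : Y → X}
    {σ : Y → EtaleSpace S.stalk} {y : Y} (hσ : ContinuousAt σ y)
    (h : ∀ᶠ z in 𝓝 y, (σ z).base = τ z) :
    ∃ σ' : ∀ y, S.stalk (τ y), (∀ᶠ z in 𝓝 y, (⟨τ z, σ' z⟩ : EtaleSpace S.stalk) = σ z) ∧
      ContinuousAt (fun z => (⟨τ z, σ' z⟩ : EtaleSpace S.stalk)) y := by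
  classical
  let σ' : ∀ y, S.stalk (τ y) := fun z =>
    if e : (σ z).base = τ z then S.castStalk e (σ z).val else 0
  have h1 : ∀ᶠ z in 𝓝 y, (⟨τ z, σ' z⟩ : EtaleSpace S.stalk) = σ z := by
    filter_upwards [h] with z hz
    simp only [σ', dif_pos hz, mk_castStalk]
  exact ⟨σ', h1, hσ.congr (h1.mono fun _ h => h.symm)⟩

-- The projection is injective on a neighbourhood `N` of the value at `x`; near that value both a
-- point and the value of `s` below it lie in `N`, so they coincide.
variable {S} in
lemma eventually_eq_of_continuousAt {x : X} {s : ∀ x, S.stalk x}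
    (h : ContinuousAt (fun y => (⟨y, s y⟩ : EtaleSpace S.stalk)) x) :
    ∀ᶠ e in 𝓝 (⟨x, s x⟩ : EtaleSpace S.stalk), e = ⟨e.base, s e.base⟩ := by
  have hb := S.isLocalHomeomorph_base
  obtain ⟨N, hN, hemb⟩ := isLocalHomeomorph_iff_isOpenEmbedding_restrict.mp hb ⟨x, s x⟩
  have h1 : ∀ᶠ e in 𝓝 (⟨x, s x⟩ : EtaleSpace S.stalk), (⟨e.base, s e.base⟩ : EtaleSpace S.stalk) ∈ N :=
    (hb.continuous.continuousAt (x := (⟨x, s x⟩ : EtaleSpace S.stalk))).eventually (h.eventually hN)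
  filter_upwards [h1, hN] with e h2 h3
  exact congrArg Subtype.val (@hemb.injective ⟨e, h3⟩ ⟨_, h2⟩ rfl)

/-- The stalks and sections of a `𝒢`-sheaf. -/
abbrev toLoc : LocSheaf.{u, w} X where
  stalk := S.stalk
  sec x s := ContinuousAt (fun y => (⟨y, s y⟩ : EtaleSpace S.stalk)) x
  sec_congr h e := h.congr (e.mono fun y h => congrArg (EtaleSpace.mk y) h)
  sec_eventually := by
    intro x s h
    -- Continuity at the single point `x` already forces `s` to coincide near `x` with a local
    -- inverse of the projection, which is continuous on an open set.
    let e := S.isLocalHomeomorph_base.localInverseAt (⟨x, s x⟩ : EtaleSpace S.stalk)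
    have hx : x ∈ e.source := S.isLocalHomeomorph_base.apply_self_mem_localInverseAt_source
    have hex : e x = ⟨x, s x⟩ := S.isLocalHomeomorph_base.localInverseAt_apply_self
    have h1 := eventually_eq_of_continuousAt h
    rw [← hex] at h1
    have h2 : ∀ᶠ y in 𝓝 x, e y = ⟨y, s y⟩ := by
      filter_upwards [(e.continuousAt hx).eventually h1, e.open_source.mem_nhds hx] with y hy hys
      rw [hy, S.isLocalHomeomorph_base.apply_localInverseAt_of_mem hys]
    filter_upwards [h2.eventually_nhds, e.open_source.mem_nhds hx] with y hy hys
    exact (e.continuousAt hys).congr hy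
  sec_sub {x s t} h h' := by
    let _ : TopologicalSpace (Σ x, S.stalk x × S.stalk x) := .induced (fun t =>
      ((⟨t.1, t.2.1⟩ : EtaleSpace S.stalk), (⟨t.1, t.2.2⟩ : EtaleSpace S.stalk))) inferInstance
    have h1 : ContinuousAt (fun y => (⟨y, s y, -t y⟩ : Σ x, S.stalk x × S.stalk x)) x :=
      (Topology.IsInducing.mk rfl).continuousAt_iff.mpr
        (h.prodMk ((S.continuous_neg.continuousAt (x := (⟨x, t x⟩ : EtaleSpace S.stalk))).comp
          (f := fun y => (⟨y, t y⟩ : EtaleSpace S.stalk)) h'))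
    have h2 : ContinuousAt _ (⟨x, s x, -t x⟩ : Σ x, S.stalk x × S.stalk x) :=
      S.continuous_add.continuousAt
    have h3 := ContinuousAt.comp (f := fun y => (⟨y, s y, -t y⟩ : Σ x, S.stalk x × S.stalk x)) h2 h1
    simpa only [sub_eq_add_neg] using! h3
  exists_sec x e := by
    have hb := S.isLocalHomeomorph_base
    let i := hb.localInverseAt (⟨x, e⟩ : EtaleSpace S.stalk)
    have hx : x ∈ i.source := hb.apply_self_mem_localInverseAt_source
    obtain ⟨s, h1, h2⟩ := S.continuousAt_mk_castStalk (τ := id) (i.continuousAt hx) (by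
      filter_upwards [i.open_source.mem_nhds hx] with y hy
      exact hb.apply_localInverseAt_of_mem hy)
    refine ⟨s, h2, ?_⟩
    have h3 := h1.self_of_nhds.trans hb.localInverseAt_apply_self
    cases EtaleSpace.mk.inj h3 with
    | intro _ h => exact eq_of_heq h
  eventually_zero {x s} h h0 := by
    have hz : ContinuousAt (fun y => (⟨y, 0⟩ : EtaleSpace S.stalk)) x :=
      (IsSectionAlong.zero (S := S) continuous_id).continuousAt
    have h1 := eventually_eq_of_continuousAt (s := fun _ => 0) hz
    rw [show (0 : S.stalk x) = s x from h0.symm] at h1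
    filter_upwards [h.eventually h1] with y hy
    cases EtaleSpace.mk.inj hy with
    | intro _ h => exact eq_of_heq h

variable {S}

lemma isSectionOn_iff {U : Set X} (hU : IsOpen U) {s : ∀ x, S.stalk x} :
    S.IsSectionOn U s ↔ ∀ x ∈ U, S.toLoc.sec x s :=
  hU.continuousOn_iff

lemma isSectionOn_univ_iff {s : ∀ x, S.stalk x} :
    S.IsSectionOn Set.univ s ↔ ∀ x, S.toLoc.sec x s := by
  simp [isSectionOn_iff isOpen_univ]

/-- Near `y`, a map to the étale space that is continuous at `y` stays on the image of a section of
`S` through its value, so it is the pullback of that section. -/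
lemma continuousAt_along_iff {Y : Type v} [TopologicalSpace Y] {τ : Y → X} (hτ : Continuous τ)
    {σ : ∀ y, S.stalk (τ y)} {y : Y} :
    ContinuousAt (fun y => (⟨τ y, σ y⟩ : EtaleSpace S.stalk)) y ↔ (S.toLoc.pull hτ).sec y σ := by
  constructor
  · intro h
    obtain ⟨s, hs, e⟩ := S.toLoc.exists_sec (τ y) (σ y)
    refine ⟨s, hs, ?_⟩
    have h1 := eventually_eq_of_continuousAt (S := S) hs
    rw [show s (τ y) = σ y from e] at h1
    filter_upwards [h.eventually h1] with z hz
    cases EtaleSpace.mk.inj hz with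
    | intro _ h => exact eq_of_heq h
  · rintro ⟨s, hs, h⟩
    have h1 : ContinuousAt (fun y => (⟨τ y, s (τ y)⟩ : EtaleSpace S.stalk)) y :=
      ContinuousAt.comp (f := τ) (g := fun x => (⟨x, s x⟩ : EtaleSpace S.stalk)) hs hτ.continuousAt
    exact h1.congr (h.mono fun z hz => congrArg (EtaleSpace.mk (τ z)) hz.symm)

lemma isSectionAlong_iff {Y : Type v} [TopologicalSpace Y] {τ : Y → X} (hτ : Continuous τ)
    {σ : ∀ y, S.stalk (τ y)} :
    S.IsSectionAlong τ σ ↔ ∀ y, (S.toLoc.pull hτ).sec y σ :=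
  continuous_iff_continuousAt.trans (forall_congr' fun _ => continuousAt_along_iff hτ)

end ToLoc

section OfLoc

variable {X : Type u} [Groupoid.{u} X] [TopologicalSpace X] [TopologicalSpace (Arrows X)]

/-- The `𝒢`-sheaf with given stalks and sections. -/
def ofLoc (hr : Continuous (Arrows.range : Arrows X → X)) (L : LocSheaf.{u, w} X)
    (act : ∀ {x y : X}, (x ⟶ y) → L.stalk x →+ L.stalk y)
    (act_id : ∀ (x : X) (e : L.stalk x), act (𝟙 x) e = e)
    (act_comp : ∀ {x y z : X} (g : x ⟶ y) (h : y ⟶ z) (e : L.stalk x),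
      act (g ≫ h) e = act h (act g e))
    (act_sec : ∀ (a : Arrows X) (s : ∀ x, L.stalk x), L.sec a.source s →
      ∃ t, L.sec a.range t ∧ ∀ᶠ b in 𝓝 a, act b.hom (s b.source) = t b.range) :
    GSheaf.{u, w} X where
  stalk := L.stalk
  top := L.etaleTopology
  isLocalHomeomorph_base := L.isLocalHomeomorph_base
  continuous_add := by
    let _ := L.etaleTopology
    let _ : TopologicalSpace (Σ x, L.stalk x × L.stalk x) := .induced (fun t =>
      ((⟨t.1, t.2.1⟩ : EtaleSpace L.stalk), (⟨t.1, t.2.2⟩ : EtaleSpace L.stalk))) inferInstance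
    have hd : Continuous (fun t : Σ x, L.stalk x × L.stalk x =>
      ((⟨t.1, t.2.1⟩ : EtaleSpace L.stalk), (⟨t.1, t.2.2⟩ : EtaleSpace L.stalk))) :=
      continuous_induced_dom
    refine continuous_iff_continuousAt.mpr ?_
    rintro ⟨x, e, e'⟩
    obtain ⟨s, hs, rfl⟩ := L.exists_sec x e
    obtain ⟨s', hs', rfl⟩ := L.exists_sec x e'
    intro W hW
    have h1 := (hd.fst.tendsto (⟨x, s x, s' x⟩ : Σ x, L.stalk x × L.stalk x)).eventually
      (LocSheaf.eventually_eq_of_sec hs)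
    have h2 := (hd.snd.tendsto (⟨x, s x, s' x⟩ : Σ x, L.stalk x × L.stalk x)).eventually
      (LocSheaf.eventually_eq_of_sec hs')
    have h3 := ((L.continuous_base.comp hd.fst).tendsto
      (⟨x, s x, s' x⟩ : Σ x, L.stalk x × L.stalk x)).eventually
      (LocSheaf.eventually_mem_of_sec (LocSheaf.sec_add hs hs') hW)
    refine Filter.mem_map.mpr ?_
    filter_upwards [h1, h2, h3]
    rintro ⟨y, f, f'⟩ hf hf' hy
    obtain rfl : f = s y := eq_of_heq (EtaleSpace.mk.inj hf).2
    obtain rfl : f' = s' y := eq_of_heq (EtaleSpace.mk.inj hf').2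
    exact hy
  continuous_neg := by
    let _ := L.etaleTopology
    refine continuous_iff_continuousAt.mpr ?_
    rintro ⟨x, e⟩
    obtain ⟨s, hs, rfl⟩ := L.exists_sec x e
    intro W hW
    refine Filter.mem_map.mpr ?_
    filter_upwards [LocSheaf.eventually_eq_of_sec hs,
      (L.continuous_base.tendsto (⟨x, s x⟩ : EtaleSpace L.stalk)).eventually
        (LocSheaf.eventually_mem_of_sec (LocSheaf.sec_neg hs) hW)]
    rintro ⟨y, f⟩ hf hy
    obtain rfl : f = s y := eq_of_heq (EtaleSpace.mk.inj hf).2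
    exact hy
  act := act
  act_id := act_id
  act_comp := act_comp
  continuous_act := by
    let _ := L.etaleTopology
    let _ : TopologicalSpace (Σ a : Arrows X, L.stalk a.source) := .induced (fun t =>
      (t.1, (⟨t.1.source, t.2⟩ : EtaleSpace L.stalk))) inferInstance
    have hd : Continuous (fun t : Σ a : Arrows X, L.stalk a.source =>
      (t.1, (⟨t.1.source, t.2⟩ : EtaleSpace L.stalk))) := continuous_induced_dom
    refine continuous_iff_continuousAt.mpr ?_
    rintro ⟨a, e⟩
    obtain ⟨s, hs, rfl⟩ := L.exists_sec _ e
    intro W hW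
    -- Near the given point, all points of the fibre product have the form `(b, s (b.source))`, and
    -- `act` sends them to values of the single section `t`.
    obtain ⟨t, ht, hst⟩ := act_sec a s hs
    change W ∈ 𝓝 (⟨a.range, act a.hom (s a.source)⟩ : EtaleSpace L.stalk) at hW
    rw [hst.self_of_nhds] at hW
    let t₀ : Σ a : Arrows X, L.stalk a.source := ⟨a, s a.source⟩
    refine Filter.mem_map.mpr ?_
    filter_upwards [(hd.snd.tendsto t₀).eventually (LocSheaf.eventually_eq_of_sec hs),
      (hd.fst.tendsto t₀).eventually hst,
      ((hr.comp hd.fst).tendsto t₀).eventually (LocSheaf.eventually_mem_of_sec ht hW)]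
    rintro ⟨b, f⟩ hf hb hy
    obtain rfl : f = s b.source := eq_of_heq (EtaleSpace.mk.inj hf).2
    change (⟨b.range, act b.hom (s b.source)⟩ : EtaleSpace L.stalk) ∈ W
    rw [hb]
    exact hy

lemma ofLoc_sec {hr : Continuous (Arrows.range : Arrows X → X)} {L : LocSheaf.{u, w} X}
    {act : ∀ {x y : X}, (x ⟶ y) → L.stalk x →+ L.stalk y} {act_id act_comp act_sec}
    {x : X} {s : ∀ x, L.stalk x} :
    (ofLoc hr L act act_id act_comp act_sec).toLoc.sec x s ↔ L.sec x s :=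
  LocSheaf.continuousAt_iff_sec

end OfLoc

section Act

variable {X : Type u} [Groupoid.{u} X] [TopologicalSpace X] [TopologicalSpace (Arrows X)]
  [IsEtaleGroupoid X] (S : GSheaf.{u, w} X)

/-- Translates of sections by arrows near a given arrow are values of a section. -/
lemma exists_sec_act (a : Arrows X) {s : ∀ x, S.stalk x} (hs : S.toLoc.sec a.source s) :
    ∃ t, S.toLoc.sec a.range t ∧ ∀ᶠ b in 𝓝 a, S.act b.hom (s b.source) = t b.range := by
  have hr := IsEtaleGroupoid.isLocalHomeomorph_range (X := X)
  let _ : TopologicalSpace (Σ a : Arrows X, S.stalk a.source) := .induced (fun t =>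
    (t.1, (⟨t.1.source, t.2⟩ : EtaleSpace S.stalk))) inferInstance
  have h1 : ContinuousAt (fun b : Arrows X => (⟨b, s b.source⟩ : Σ a : Arrows X, S.stalk a.source))
      a := (Topology.IsInducing.mk rfl).continuousAt_iff.mpr (continuousAt_id.prodMk
        (ContinuousAt.comp (f := Arrows.source)
          (g := fun x => (⟨x, s x⟩ : EtaleSpace S.stalk)) hs
          (Strings.isLocalHomeomorph_source X).continuous.continuousAt))
  have h2 : ContinuousAt _ (⟨a, s a.source⟩ : Σ a : Arrows X, S.stalk a.source) :=
    S.continuous_act.continuousAt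
  have h3 : ContinuousAt (fun b : Arrows X =>
      (⟨b.range, S.act b.hom (s b.source)⟩ : EtaleSpace S.stalk)) a :=
    ContinuousAt.comp (f := fun b : Arrows X =>
      (⟨b, s b.source⟩ : Σ a : Arrows X, S.stalk a.source)) h2 h1
  exact (continuousAt_along_iff hr.continuous).mp h3

end Act

end GSheaf

namespace GSheafHom

variable {X : Type u} [Groupoid.{u} X] [TopologicalSpace X] [TopologicalSpace (Arrows X)]
  {S : GSheaf.{u, w} X} {T : GSheaf.{u, w'} X}

lemma map_sec (φ : GSheafHom S T) {x : X} {s : ∀ x, S.stalk x} (h : S.toLoc.sec x s) :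
    T.toLoc.sec x (fun y => φ.app y (s y)) :=
  ContinuousAt.comp (f := fun y => (⟨y, s y⟩ : EtaleSpace S.stalk))
    φ.continuous_app.continuousAt h

/-- The morphism of `𝒢`-sheaves with given values. -/
def ofSec (app : ∀ x, S.stalk x →+ T.stalk x)
    (map_sec : ∀ x s, S.toLoc.sec x s → T.toLoc.sec x (fun y => app y (s y)))
    (app_act : ∀ {x y : X} (g : x ⟶ y) (e : S.stalk x), app y (S.act g e) = T.act g (app x e)) :
    GSheafHom S T where
  app := app
  continuous_app := by
    refine continuous_iff_continuousAt.mpr ?_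
    rintro ⟨x, e⟩
    obtain ⟨s, hs, rfl⟩ := S.toLoc.exists_sec x e
    have h1 : ContinuousAt (fun e : EtaleSpace S.stalk =>
        (⟨e.base, app e.base (s e.base)⟩ : EtaleSpace T.stalk)) ⟨x, s x⟩ :=
      ContinuousAt.comp (f := EtaleSpace.base)
        (g := fun y => (⟨y, app y (s y)⟩ : EtaleSpace T.stalk)) (map_sec x s hs)
        S.isLocalHomeomorph_base.continuous.continuousAt
    -- Near a value of `s` all points of the étale space are values of `s`, so it suffices to know
    -- continuity along sections.
    refine h1.congr ?_
    filter_upwards [GSheaf.eventually_eq_of_continuousAt hs]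
    rintro ⟨y, f⟩ hf
    obtain rfl : f = s y := eq_of_heq (EtaleSpace.mk.inj hf).2
    rfl
  app_act := app_act

end GSheafHom

/-! ### Soft sheaves and the lifting of sections with compact support -/

namespace LocSheaf

variable {X : Type u} [TopologicalSpace X]

/-- Sections near a compact set extend to global sections, up to shrinking the neighbourhood. -/
def IsSoft (L : LocSheaf.{u, w} X) : Prop :=
  ∀ (K : Set X) (s : ∀ x, L.stalk x), IsCompact K → (∀ x ∈ K, L.sec x s) →
    ∃ t, (∀ x, L.sec x t) ∧ ∀ᶠ y in 𝓝ˢ K, t y = s y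

/-- The kernel of the morphism is a soft sheaf. -/
def Hom.KerSoft {L : LocSheaf.{u, w} X} {L' : LocSheaf.{u, w'} X} (φ : L.Hom L') : Prop :=
  ∀ (K : Set X) (s : ∀ x, L.stalk x), IsCompact K → (∀ x ∈ K, L.sec x s) →
    (∀ᶠ y in 𝓝ˢ K, φ.app y (s y) = 0) →
      ∃ t, (∀ x, L.sec x t) ∧ (∀ x, φ.app x (t x) = 0) ∧ ∀ᶠ y in 𝓝ˢ K, t y = s y

lemma Hom.kerSoft_of_injective {L : LocSheaf.{u, w} X} {L' : LocSheaf.{u, w'} X} (φ : L.Hom L')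
    (h : ∀ x e, φ.app x e = 0 → e = 0) : φ.KerSoft := fun _ _ _ _ h0 =>
  ⟨fun _ => 0, fun x => L.sec_zero x, fun _ => map_zero _, h0.mono fun _ e => (h _ _ e).symm⟩

lemma eventually_nhdsSet_sec {L : LocSheaf.{u, w} X} {K : Set X} {s : ∀ x, L.stalk x}
    (h : ∀ x ∈ K, L.sec x s) : ∀ᶠ y in 𝓝ˢ K, L.sec y s :=
  eventually_nhdsSet_iff_forall.mpr fun x hx => L.sec_eventually (h x hx)

/-- Two functions that agree near the intersection of two closed sets can be glued. -/
lemma exists_glue [NormalSpace X] {α : X → Type*} {E F : Set X} (hE : IsClosed E)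
    (hF : IsClosed F) {b b' : ∀ x, α x} (h : ∀ᶠ y in 𝓝ˢ (E ∩ F), b y = b' y) :
    ∃ c : ∀ x, α x, (∀ᶠ y in 𝓝ˢ E, c y = b y) ∧ ∀ᶠ y in 𝓝ˢ F, c y = b' y := by
  classical
  obtain ⟨N, hN, hEF, hb⟩ := eventually_nhdsSet_iff_exists.mp h
  have hd : Disjoint (E \ N) (F \ N) :=
    Set.disjoint_left.mpr fun x hx hx' => hx.2 (hEF ⟨hx.1, hx'.1⟩)
  -- Outside `N`, where `b` and `b'` agree, the two closed sets are disjoint and can be separated.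
  -- Near `E` the glued function is `b`; near `F` it is `b'`, since a point of `Q` outside `N` is
  -- not in `P`.
  obtain ⟨P, Q, hP, hQ, hEP, hFQ, hPQ⟩ := normal_separation (hE.sdiff hN) (hF.sdiff hN) hd
  refine ⟨fun y => if y ∈ P ∪ N then b y else b' y, ?_, ?_⟩
  · refine eventually_nhdsSet_iff_exists.mpr ⟨P ∪ N, hP.union hN, fun x hx => ?_,
      fun x hx => if_pos hx⟩
    by_cases hxN : x ∈ N
    exacts [Or.inr hxN, Or.inl (hEP ⟨hx, hxN⟩)]
  · refine eventually_nhdsSet_iff_exists.mpr ⟨Q ∪ N, hQ.union hN, fun x hx => ?_, ?_⟩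
    · by_cases hxN : x ∈ N
      exacts [Or.inr hxN, Or.inl (hFQ ⟨hx, hxN⟩)]
    · intro x hx
      by_cases hxN : x ∈ N
      · simp [hxN, hb x hxN]
      · have hxP : x ∉ P := fun h => Set.disjoint_left.mp hPQ h (hx.resolve_right hxN)
        simp [hxN, hxP]

section Pull

variable {Y : Type v} [TopologicalSpace Y] {τ : Y → X}

lemma pull_eventually_zero {L : LocSheaf.{u, w} X} {σ : ∀ y, L.stalk (τ y)} {y : Y}
    (hy : y ∉ closure {y | σ y ≠ 0}) : ∀ᶠ z in 𝓝 y, σ z = 0 := by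
  filter_upwards [isClosed_closure.isOpen_compl.mem_nhds hy] with z hz
  by_contra h
  exact hz (subset_closure h)

lemma notMem_closure_support {L : LocSheaf.{u, w} X} {σ : ∀ y, L.stalk (τ y)} {y : Y}
    (h : ∀ᶠ z in 𝓝 y, σ z = 0) : y ∉ closure {y | σ y ≠ 0} := by
  rw [mem_closure_iff_frequently, not_frequently]
  exact h.mono fun z hz => not_not.mpr hz

/-- A section over an open set on which the local homeomorphism is injective descends. -/
lemma exists_descend (hτ : IsLocalHomeomorph τ) {L : LocSheaf.{u, w} X}
    {σ : ∀ y, L.stalk (τ y)} (hσ : ∀ y, (L.pull hτ.continuous).sec y σ) {U : Set Y}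
    (hU : IsOpen U) (hinj : Set.InjOn τ U) :
    ∃ s : ∀ x, L.stalk x, (∀ y ∈ U, s (τ y) = σ y) ∧ ∀ y ∈ U, L.sec (τ y) s := by
  classical
  let s : ∀ x, L.stalk x := fun x =>
    if h : ∃ y ∈ U, τ y = x then h.choose_spec.2 ▸ σ h.choose else 0
  have hsσ : ∀ y ∈ U, s (τ y) = σ y := by
    intro y hy
    have h : ∃ y' ∈ U, τ y' = τ y := ⟨y, hy, rfl⟩
    simp only [s, dif_pos h]
    have key : ∀ (y' : Y) (e : τ y' = τ y), y' = y → (e ▸ σ y' : L.stalk (τ y)) = σ y := by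
      rintro y' e rfl; rfl
    exact key _ _ (hinj h.choose_spec.1 hy h.choose_spec.2)
  refine ⟨s, hsσ, fun y hy => ?_⟩
  obtain ⟨t, ht, h⟩ := hσ y
  refine L.sec_congr ht ?_
  have h1 : ∀ᶠ z in 𝓝 y, t (τ z) = s (τ z) := by
    filter_upwards [h, hU.mem_nhds hy] with z hz hzU
    rw [hsσ z hzU, hz]
  rw [← hτ.map_nhds_eq y]
  exact h1

/-- Extension by zero of a section supported in the image of an open set on which the local
homeomorphism is injective. -/
lemma exists_extend_zero [CompactSpace X] [T2Space Y] (hτ : IsLocalHomeomorph τ) {L : LocSheaf.{u, w} X}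
    {U : Set Y} (hU : IsOpen U) (hinj : Set.InjOn τ U) {b : ∀ x, L.stalk x}
    (hb : ∀ x, L.sec x b) (hb0 : ∀ᶠ x in 𝓝ˢ (τ '' U)ᶜ, b x = 0) :
    ∃ β : ∀ y, L.stalk (τ y), (∀ y, (L.pull hτ.continuous).sec y β) ∧
      IsCompact (closure {y | β y ≠ 0}) ∧ closure {y | β y ≠ 0} ⊆ U ∧
      (∀ y ∈ U, β y = b (τ y)) ∧ ∀ y ∉ U, β y = 0 := by
  classical
  obtain ⟨N, hN, hUN, hbN⟩ := eventually_nhdsSet_iff_exists.mp hb0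
  let e : U → X := fun y => τ y
  have he : IsOpenEmbedding e := IsOpenEmbedding.of_continuous_injective_isOpenMap
    (hτ.continuous.comp continuous_subtype_val)
    (fun y y' h => Subtype.ext (hinj y.2 y'.2 h)) (hτ.isOpenMap.domRestrict hU)
  -- `b` vanishes on `N`, and the complement of `N` is compact and contained in `τ '' U`. Its
  -- preimage in `U` is therefore compact and carries the support of the extension.
  have hc : IsCompact (Subtype.val '' (e ⁻¹' Nᶜ)) := by
    refine (he.isInducing.isCompact_preimage' hN.isClosed_compl.isCompact ?_).image
      continuous_subtype_val
    intro x hx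
    by_contra hn
    exact hx (hUN fun ⟨y, hy, h⟩ => hn ⟨⟨y, hy⟩, h⟩)
  let β : ∀ y, L.stalk (τ y) := fun y => if y ∈ U then b (τ y) else 0
  have hsub : closure {y | β y ≠ 0} ⊆ Subtype.val '' (e ⁻¹' Nᶜ) := by
    refine closure_minimal (fun y hy => ?_) hc.isClosed
    by_cases hyU : y ∈ U
    · exact ⟨⟨y, hyU⟩, fun hn => hy (by simp only [β, if_pos hyU]; exact hbN _ hn), rfl⟩
    · exact absurd (if_neg hyU) hy
  have hsubU : closure {y | β y ≠ 0} ⊆ U := fun y hy => by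
    obtain ⟨z, -, rfl⟩ := hsub hy
    exact z.2
  refine ⟨β, fun y => ?_, hc.of_isClosed_subset isClosed_closure hsub, hsubU,
    fun y hy => if_pos hy, fun y hy => if_neg hy⟩
  by_cases hy : y ∈ U
  · exact ⟨b, hb _, by filter_upwards [hU.mem_nhds hy] with z hz using if_pos hz⟩
  · exact sec_of_eventually_zero (L := L.pull hτ.continuous)
      (pull_eventually_zero fun h => hy (hsubU h))

end Pull

section Exact

variable [CompactSpace X] [T2Space X] {B : LocSheaf.{u, w₁} X} {C : LocSheaf.{u, w₂} X}
  {D : LocSheaf.{u, w₃} X} {φ : B.Hom C} {ψ : C.Hom D}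

/-- Lifts exist near each point by exactness on stalks. Two lifts differ near the intersection of
their domains by a section of the kernel of `φ`; softness of the kernel extends this difference to
all of `X`, and correcting one lift by it makes them agree where they overlap. -/
lemma exists_lift_near (hex : ∀ x, Function.Exact (φ.app x) (ψ.app x)) (hφ : φ.KerSoft)
    {K : Set X} (hK : IsCompact K) {s : ∀ x, C.stalk x} (hs : ∀ x ∈ K, C.sec x s)
    (h0 : ∀ᶠ y in 𝓝ˢ K, ψ.app y (s y) = 0) :
    ∃ b, ∀ᶠ y in 𝓝ˢ K, B.sec y b ∧ φ.app y (b y) = s y := by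
  -- The induction over subsets of `K` is run on their closures, so that the intersections to which
  -- softness is applied are compact.
  suffices h : ∃ b, ∀ᶠ y in 𝓝ˢ (closure K), B.sec y b ∧ φ.app y (b y) = s y by
    rwa [hK.isClosed.closure_eq] at h
  refine hK.induction_on (p := fun E => ∃ b, ∀ᶠ y in 𝓝ˢ (closure E),
    B.sec y b ∧ φ.app y (b y) = s y) ⟨fun _ => 0, by simp⟩ ?_ ?_ ?_
  · rintro E F hEF ⟨b, hb⟩
    exact ⟨b, hb.filter_mono (nhdsSet_mono (closure_mono hEF))⟩
  · rintro E F ⟨b, hb⟩ ⟨b', hb'⟩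
    rw [closure_union]
    have hbE := eventually_nhdsSet_iff_forall.mp hb
    have hbF := eventually_nhdsSet_iff_forall.mp hb'
    obtain ⟨a, ha, ha0, hab⟩ := hφ (closure E ∩ closure F) (fun y => b y - b' y)
      (isClosed_closure.inter isClosed_closure).isCompact
      (fun x hx => B.sec_sub (hbE x hx.1).self_of_nhds.1 (hbF x hx.2).self_of_nhds.1)
      (by
        filter_upwards [hb.filter_mono (nhdsSet_mono Set.inter_subset_left),
          hb'.filter_mono (nhdsSet_mono Set.inter_subset_right)] with y h1 h2
        rw [map_sub, h1.2, h2.2, sub_self])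
    obtain ⟨c, hcE, hcF⟩ := exists_glue (b := b) (b' := fun y => b' y + a y)
      (isClosed_closure (s := E)) (isClosed_closure (s := F))
      (hab.mono fun y hy => by rw [hy]; abel)
    refine ⟨c, ?_⟩
    rw [nhdsSet_union, eventually_sup]
    constructor
    · have hcE' := eventually_nhdsSet_iff_forall.mp hcE
      refine eventually_nhdsSet_iff_forall.mpr fun x hx => ?_
      filter_upwards [hbE x hx, (hcE' x hx).eventually_nhds] with y h1 h2
      exact ⟨B.sec_congr h1.1 (h2.mono fun _ h => h.symm), by rw [h2.self_of_nhds, h1.2]⟩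
    · have hcF' := eventually_nhdsSet_iff_forall.mp hcF
      refine eventually_nhdsSet_iff_forall.mpr fun x hx => ?_
      filter_upwards [hbF x hx, (hcF' x hx).eventually_nhds] with y h1 h2
      exact ⟨B.sec_congr (sec_add h1.1 (ha y)) (h2.mono fun _ h => h.symm), by
        rw [h2.self_of_nhds, map_add, h1.2, ha0, add_zero]⟩
  · intro x hx
    have h0x : ψ.app x (s x) = 0 := (eventually_nhdsSet_iff_forall.mp h0 x hx).self_of_nhds
    obtain ⟨e, he⟩ := (hex x _).mp h0x
    obtain ⟨b, hb, rfl⟩ := B.exists_sec x e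
    have h1 : ∀ᶠ y in 𝓝 x, B.sec y b ∧ φ.app y (b y) = s y :=
      (B.sec_eventually hb).and (sec_eventuallyEq (φ.map_sec hb) (hs x hx) he)
    obtain ⟨O, hO, hOo, hxO⟩ := eventually_nhds_iff.mp h1
    obtain ⟨F, hF, hFc, hFO⟩ := exists_mem_nhds_isClosed_subset (hOo.mem_nhds hxO)
    refine ⟨F, mem_nhdsWithin_of_mem_nhds hF, b, ?_⟩
    rw [hFc.closure_eq]
    exact eventually_nhdsSet_iff_exists.mpr ⟨O, hOo, hFO, hO⟩

/-- A quotient of a soft sheaf by a soft sheaf is soft: lift near `K`, extend the lift to a global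
section of `B`, and apply `φ`. -/
lemma kerSoft_of_exact (hex : ∀ x, Function.Exact (φ.app x) (ψ.app x)) (hφ : φ.KerSoft)
    (hB : B.IsSoft) : ψ.KerSoft := by
  intro K s hK hs h0
  obtain ⟨b, hb⟩ := exists_lift_near hex hφ hK hs h0
  have hb' := eventually_nhdsSet_iff_forall.mp hb
  obtain ⟨t, ht, htb⟩ := hB K b hK fun x hx => (hb' x hx).self_of_nhds.1
  refine ⟨fun y => φ.app y (t y), fun x => φ.map_sec (ht x), fun x => (hex x _).mpr ⟨_, rfl⟩, ?_⟩
  filter_upwards [hb, htb] with y h1 h2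
  rw [h2, h1.2]

/-- Lifting of sections with control of the support. -/
lemma exists_lift_support (hex : ∀ x, Function.Exact (φ.app x) (ψ.app x)) (hφ : φ.KerSoft)
    {F : Set X} (hF : IsClosed F) {s : ∀ x, C.stalk x} (hs : ∀ x, C.sec x s)
    (h0 : ∀ x, ψ.app x (s x) = 0) (hsF : ∀ᶠ y in 𝓝ˢ F, s y = 0) :
    ∃ b, (∀ x, B.sec x b) ∧ (∀ x, φ.app x (b x) = s x) ∧ ∀ᶠ y in 𝓝ˢ F, b y = 0 := by
  obtain ⟨b, hb⟩ := exists_lift_near hex hφ isCompact_univ (fun x _ => hs x) (.of_forall h0)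
  simp only [nhdsSet_univ, eventually_top] at hb
  -- Near `F` an arbitrary lift `b` lies in the kernel of `φ`, so it extends from there to a global
  -- section `a` of the kernel; `b - a` is still a lift and vanishes near `F`.
  obtain ⟨a, ha, ha0, hab⟩ := hφ F b hF.isCompact (fun x _ => (hb x).1)
    (hsF.mono fun y hy => by rw [(hb y).2, hy])
  exact ⟨fun y => b y - a y, fun x => B.sec_sub (hb x).1 (ha x),
    fun x => by rw [map_sub, (hb x).2, ha0, sub_zero], hab.mono fun y hy => sub_eq_zero.mpr hy.symm⟩

section Pull

variable {Y : Type v} [TopologicalSpace Y] {τ : Y → X}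

/-- Lifting of compactly supported sections of pullbacks along local homeomorphisms. -/
theorem exists_lift_compactSupport [T2Space Y] (hτ : IsLocalHomeomorph τ)
    (hex : ∀ x, Function.Exact (φ.app x) (ψ.app x)) (hφ : φ.KerSoft) (hψ : ψ.KerSoft)
    {σ : ∀ y, C.stalk (τ y)} (hσ : ∀ y, (C.pull hτ.continuous).sec y σ)
    (hc : IsCompact (closure {y | σ y ≠ 0})) (h0 : ∀ y, ψ.app (τ y) (σ y) = 0) :
    ∃ β : ∀ y, B.stalk (τ y), (∀ y, (B.pull hτ.continuous).sec y β) ∧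
      IsCompact (closure {y | β y ≠ 0}) ∧ ∀ y, φ.app (τ y) (β y) = σ y := by
  classical
  have hloc : ∀ y : Y, ∃ U : Set Y, IsOpen U ∧ y ∈ U ∧ Set.InjOn τ U := fun y =>
    ⟨(hτ.localInverseAt y).target, (hτ.localInverseAt y).open_target,
      hτ.self_mem_localInverseAt_target, hτ.injOn_localInverseAt_target⟩
  choose U hUo hUy hUinj using hloc
  obtain ⟨T, hT⟩ := hc.elim_finite_subcover U hUo fun y _ => Set.mem_iUnion.mpr ⟨y, hUy y⟩
  clear hUy
  -- The support is covered by finitely many open sets on which `τ` is injective; each step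
  -- subtracts the image of a section supported in one of them, so that the others cover what
  -- remains.
  induction T using Finset.induction_on generalizing σ with
  | empty =>
    have hz : ∀ y, σ y = 0 := by
      intro y
      by_contra h
      simpa using hT (subset_closure h)
    exact ⟨fun _ => 0, fun y => (B.pull hτ.continuous).sec_zero y, by simp,
      fun y => by rw [hz, map_zero]⟩
  | insert i T _ ih =>
    set K := closure {y | σ y ≠ 0} with hK
    set V : Set Y := ⋃ j ∈ T, U j with hV
    have hVo : IsOpen V := isOpen_biUnion fun j _ => hUo j
    have hKU : K ⊆ U i ∪ V := by simpa [hV] using hT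
    obtain ⟨s, hsσ, hs⟩ := exists_descend hτ hσ (hUo i) (hUinj i)
    have hKVU : K \ V ⊆ U i := fun y hy => (hKU hy.1).resolve_right hy.2
    have hO : IsOpen (τ '' U i) := hτ.isOpenMap _ (hUo i)
    -- The part of the support that only `U i` covers is `K \ V`; it is compact, and `V'` is a
    -- neighbourhood of its image whose closure stays in the image of `U i`.
    obtain ⟨V', hV'o, hKV', hV'U⟩ := normal_exists_closure_subset
      (((hc.diff hVo).image hτ.continuous).isClosed) hO (Set.image_mono hKVU)
    have hs0 : ∀ y ∈ U i, y ∉ K → ∀ᶠ x in 𝓝 (τ y), s x = 0 := by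
      intro y hy hyK
      rw [← hτ.map_nhds_eq y, eventually_map]
      filter_upwards [pull_eventually_zero hyK, (hUo i).mem_nhds hy] with z h1 h2
      rw [hsσ z h2, h1]
    -- The cut-off `s'` may fail to be a section along the frontier of `V'`. On `Q` it is one: a
    -- frontier point in `Q` comes from a point of `U i` outside `V`, which is not in `K` since
    -- otherwise its image would lie in `V'`; so `s` vanishes near it.
    let s' : ∀ x, C.stalk x := fun x => if x ∈ V' then s x else 0
    let Q : Set X := (τ '' (U i ∩ V))ᶜ
    have hQ : IsClosed Q := (hτ.isOpenMap _ ((hUo i).inter hVo)).isClosed_compl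
    have hs'V : ∀ x ∈ V', ∀ᶠ z in 𝓝 x, s z = s' z := fun x hx =>
      (hV'o.eventually_mem hx).mono fun z hz => (if_pos hz).symm
    have hs'C : ∀ x ∉ closure V', ∀ᶠ z in 𝓝 x, s' z = 0 := fun x hx =>
      (isClosed_closure.isOpen_compl.eventually_mem hx).mono fun z hz => if_neg fun h => hz (subset_closure h)
    have hs'0 : ∀ y ∈ U i, y ∉ K → ∀ᶠ x in 𝓝 (τ y), s' x = 0 := fun y hy hyK =>
      (hs0 y hy hyK).mono fun x hx => by simp only [s', hx, ite_self]
    have hs' : ∀ x ∈ Q, C.sec x s' := by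
      intro x hx
      by_cases hxV' : x ∈ V'
      · obtain ⟨y, hy, rfl⟩ := hV'U (subset_closure hxV')
        exact C.sec_congr (hs y hy) (hs'V _ hxV')
      · refine sec_of_eventually_zero ?_
        by_cases hxc : x ∈ closure V'
        · obtain ⟨y, hy, rfl⟩ := hV'U hxc
          have hyV : y ∉ V := fun h => hx ⟨y, ⟨hy, h⟩, rfl⟩
          exact hs'0 y hy fun hyK => hxV' (hKV' ⟨y, ⟨hyK, hyV⟩, rfl⟩)
        · exact hs'C x hxc
    have hψs' : ∀ x, ψ.app x (s' x) = 0 := by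
      intro x
      by_cases hx : x ∈ V'
      · obtain ⟨y, hy, rfl⟩ := hV'U (subset_closure hx)
        simp only [s', if_pos hx, hsσ y hy, h0]
      · simp only [s', if_neg hx, map_zero]
    -- Softness of the kernel of `ψ` replaces `s'` by a global section with the same germs on `Q`.
    -- In particular `t` vanishes near the complement of `τ '' U i`, so it has a lift that extends
    -- by zero from `U i`.
    obtain ⟨t, ht, hψt, hts'⟩ := hψ Q s' hQ.isCompact hs' (.of_forall hψs')
    have hts := eventually_nhdsSet_iff_forall.mp hts'
    have ht0 : ∀ᶠ x in 𝓝ˢ (τ '' U i)ᶜ, t x = 0 := by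
      refine eventually_nhdsSet_iff_forall.mpr fun x hx => ?_
      have hxQ : x ∈ Q := fun ⟨y, hy, h⟩ => hx ⟨y, hy.1, h⟩
      filter_upwards [hts x hxQ, hs'C x fun h => hx (hV'U h)] with z h1 h2
      rw [h1, h2]
    obtain ⟨b, hb, hbt, hb0⟩ := exists_lift_support hex hφ hO.isClosed_compl ht hψt ht0
    obtain ⟨β, hβ, hβc, hβU, hβb, hβ0⟩ := exists_extend_zero hτ (hUo i) (hUinj i) hb hb0
    have hφβ : ∀ y, (C.pull hτ.continuous).sec y fun y => φ.app (τ y) (β y) := by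
      intro y
      obtain ⟨r, hr, h⟩ := hβ y
      exact ⟨_, φ.map_sec hr, h.mono fun z hz => congrArg (φ.app (τ z)) hz⟩
    -- Outside `V` the germs of `φ β` are those of `σ`: in `U i` because `t` agrees with `s'` near
    -- `Q`, elsewhere because both vanish.
    have hvan : ∀ y ∉ V, ∀ᶠ z in 𝓝 y, σ z - φ.app (τ z) (β z) = 0 := by
      intro y hyV
      by_cases hy : y ∈ U i
      · have hyQ : τ y ∈ Q := by
          rintro ⟨z, ⟨hz, hzV⟩, h⟩
          exact hyV (hUinj i hz hy h ▸ hzV)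
        have h1 : ∀ᶠ z in 𝓝 y, z ∈ U i ∧ φ.app (τ z) (β z) = s' (τ z) := by
          filter_upwards [hτ.continuous.continuousAt.eventually (hts _ hyQ),
            (hUo i).mem_nhds hy] with z h1 h2
          exact ⟨h2, by rw [hβb z h2, hbt, h1]⟩
        by_cases hyV' : τ y ∈ V'
        · filter_upwards [h1, hτ.continuous.continuousAt.eventually (hs'V _ hyV')] with z h2 h3
          rw [h2.2, ← h3, hsσ z h2.1, sub_self]
        · have hyK : y ∉ K := fun h => hyV' (hKV' ⟨y, ⟨h, hyV⟩, rfl⟩)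
          filter_upwards [h1, hτ.continuous.continuousAt.eventually (hs'0 y hy hyK),
            pull_eventually_zero hyK] with z h2 h3 h4
          rw [h2.2, h3, h4, sub_self]
      · have hyK : y ∉ K := fun h => (hKU h).elim hy hyV
        filter_upwards [pull_eventually_zero hyK,
          pull_eventually_zero fun h => hy (hβU h)] with z h1 h2
        rw [h1, h2, map_zero, sub_zero]
    have hsubK : {y | σ y - φ.app (τ y) (β y) ≠ 0} ⊆ K ∪ closure {y | β y ≠ 0} := by
      intro y hy
      by_contra hn
      rw [Set.mem_union, not_or] at hn
      have h1 : σ y = 0 := (pull_eventually_zero hn.1).self_of_nhds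
      have h2 : β y = 0 := (pull_eventually_zero hn.2).self_of_nhds
      exact hy (by rw [h1, h2, map_zero, sub_zero])
    obtain ⟨β', hβ', hβ'c, hφβ'⟩ := ih (σ := fun y => σ y - φ.app (τ y) (β y))
      (fun y => (C.pull hτ.continuous).sec_sub (hσ y) (hφβ y))
      ((hc.union hβc).of_isClosed_subset isClosed_closure
        (closure_minimal hsubK (isClosed_closure.union isClosed_closure)))
      (fun y => by rw [map_sub, h0, (hex _ _).mpr ⟨_, rfl⟩, sub_zero])
      (fun y hy => by
        by_contra hn
        exact notMem_closure_support (L := C) (hvan y hn) hy)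
    refine ⟨fun y => β y + β' y, fun y => sec_add (L := B.pull hτ.continuous) (hβ y) (hβ' y),
      (hβc.union hβ'c).of_isClosed_subset isClosed_closure
        (closure_minimal (fun y hy => ?_) (isClosed_closure.union isClosed_closure)),
      fun y => by rw [map_add, hφβ']; abel⟩
    by_contra hn
    rw [Set.mem_union, not_or] at hn
    have h1 : β y = 0 := (pull_eventually_zero hn.1).self_of_nhds
    have h2 : β' y = 0 := (pull_eventually_zero hn.2).self_of_nhds
    exact hy (by dsimp only; rw [h1, h2, add_zero])

end Pull

end Exact

end LocSheaf

/-! ### Injective hulls of abelian groups -/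

/-- An abelian group to which homomorphisms extend. -/
def ExtendsHoms (Q : Type w) [AddCommGroup Q] : Prop :=
  ∀ {A : Type w₁} {B : Type w₂} [AddCommGroup A] [AddCommGroup B] (f : A →+ B) (g : A →+ Q),
    (∀ a, f a = 0 → g a = 0) → ∃ h : B →+ Q, ∀ a, h (f a) = g a

/-- An injective abelian group that contains `A`. -/
abbrev CharHull (A : Type w) [AddCommGroup A] : Type w := CharacterModule A → AddCircle (1 : ℚ)

/-- The embedding in `CharHull`. -/
def toCharHull (A : Type w) [AddCommGroup A] : A →+ CharHull A where
  toFun a c := c a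
  map_zero' := funext fun c => map_zero c
  map_add' a b := funext fun c => map_add c a b

lemma eq_zero_of_toCharHull {A : Type w} [AddCommGroup A] {a : A} (h : toCharHull A a = 0) :
    a = 0 := CharacterModule.eq_zero_of_character_apply fun c => congrFun h c

/-- `ℚ / ℤ` is divisible, so homomorphisms to it extend along injections. As `g` vanishes on the
kernel of `f`, it factors through the range of `f`, which injects into `B`. -/
lemma extendsHoms_addCircle : ExtendsHoms.{0, w₁, w₂} (AddCircle (1 : ℚ)) := by
  intro A B _ _ f g h
  have hker : f.rangeRestrict.ker ≤ g.ker := fun a ha => h a (congrArg Subtype.val ha)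
  obtain ⟨k, hk⟩ := (Module.Baer.of_divisible (AddCircle (1 : ℚ))).extension_property_addMonoidHom
    f.range.subtype Subtype.val_injective
    (f.rangeRestrict.liftOfSurjective f.rangeRestrict_surjective ⟨g, hker⟩)
  refine ⟨k, fun a => ?_⟩
  have h1 := DFunLike.congr_fun hk (f.rangeRestrict a)
  exact h1.trans (AddMonoidHom.liftOfRightInverse_comp_apply _ _ _ _ a)

/-- Extension to a product is done one coordinate at a time. -/
lemma extendsHoms_charHull (A : Type w) [AddCommGroup A] :
    ExtendsHoms.{w, w₁, w₂} (CharHull A) := by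
  intro B C _ _ f g h
  have h1 : ∀ c, ∃ k : C →+ AddCircle (1 : ℚ), ∀ b, k (f b) = g b c := fun c =>
    extendsHoms_addCircle f ((Pi.evalAddMonoidHom _ c).comp g) fun b hb => congrFun (h b hb) c
  choose k hk using h1
  exact ⟨AddMonoidHom.pi k, fun b => funext fun c => hk c b⟩

/-! ### Coinduced sheaves -/

section Coind

variable {X : Type u} [Groupoid.{u} X]

/-- The product `b⁻¹ g`. -/
def divArrow (b g : Arrows X) (h : b.range = g.range) : Arrows X :=
  ⟨g.source, b.source, g.hom ≫ eqToHom h.symm ≫ Groupoid.inv b.hom⟩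

section Div

variable {M : X → Type w} (φ : ∀ g : Arrows X, M g.source)

/-- The identities between quotients of arrows needed below hold with the same endpoints on both
sides, so values of `φ` can be compared without transport between groups. -/
lemma apply_hom_congr {x y : X} {h h' : x ⟶ y} (e : h = h') :
    (φ ⟨x, y, h⟩ : M x) = φ ⟨x, y, h'⟩ := by rw [e]

lemma apply_divArrow_unit {b g : Arrows X} (hb : b = unitArrow g.range) (h : b.range = g.range) :
    φ (divArrow b g h) = φ g := by
  subst hb
  exact apply_hom_congr φ (by simp [unitArrow, Groupoid.inv_eq_inv])

lemma apply_divArrow_inv (g : Arrows X) :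
    φ (divArrow (invArrow g) (unitArrow g.source) rfl) = φ g :=
  apply_hom_congr φ (by simp [unitArrow, invArrow, Groupoid.inv_eq_inv])

lemma apply_divArrow_mul (p : ComposablePair X) (k : Arrows X) (h : p.z = k.range) :
    φ (divArrow (mulArrow p) k h) =
      φ (divArrow ⟨p.x, p.y, p.g⟩ (divArrow ⟨p.y, p.z, p.h⟩ k h) rfl) :=
  apply_hom_congr φ (by simp [mulArrow, divArrow, Groupoid.inv_eq_inv])

end Div

variable [TopologicalSpace X] [TopologicalSpace (Arrows X)]
  (M : X → Type w) [∀ x, AddCommGroup (M x)]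

/-- The functions on the arrows that vanish on all arrows with range near `x`. -/
def coindNull (x : X) : AddSubgroup (∀ g : Arrows X, M g.source) where
  carrier := {φ | ∀ᶠ y in 𝓝 x, ∀ g : Arrows X, g.range = y → φ g = 0}
  zero_mem' := .of_forall fun _ _ _ => rfl
  add_mem' h h' := by
    filter_upwards [h, h'] with y h1 h2 g hg
    rw [Pi.add_apply, h1 g hg, h2 g hg, add_zero]
  neg_mem' h := by
    filter_upwards [h] with y h1 g hg
    rw [Pi.neg_apply, h1 g hg, neg_zero]

variable {M}

/-- The germ at `x` of a function on the arrows. -/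
abbrev coindMk (x : X) : (∀ g : Arrows X, M g.source) →+
    ((∀ g : Arrows X, M g.source) ⧸ coindNull M x) := QuotientAddGroup.mk' _

lemma coindMk_eq_zero {x : X} {φ : ∀ g : Arrows X, M g.source} :
    coindMk x φ = 0 ↔ ∀ᶠ y in 𝓝 x, ∀ g : Arrows X, g.range = y → φ g = 0 :=
  QuotientAddGroup.eq_zero_iff _

lemma coindMk_eq {x : X} {φ ψ : ∀ g : Arrows X, M g.source} :
    coindMk x φ = coindMk x ψ ↔ ∀ᶠ y in 𝓝 x, ∀ g : Arrows X, g.range = y → φ g = ψ g := by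
  rw [← sub_eq_zero, ← map_sub, coindMk_eq_zero]
  simp only [Pi.sub_apply, sub_eq_zero]

variable (M) in
/-- The sheaf `r_* s^* M`, whose sections over `U` are the functions on `r⁻¹(U)` with values in
the groups `M (s g)`. -/
abbrev coindLoc : LocSheaf.{u, max u w} X where
  stalk x := (∀ g : Arrows X, M g.source) ⧸ coindNull M x
  sec x s := ∃ φ, ∀ᶠ y in 𝓝 x, s y = coindMk y φ
  sec_congr := by
    rintro x s t ⟨φ, h⟩ h'
    exact ⟨φ, by filter_upwards [h, h'] with y h1 h2 using h2.symm.trans h1⟩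
  sec_eventually := by
    rintro x s ⟨φ, h⟩
    exact h.eventually_nhds.mono fun y hy => ⟨φ, hy⟩
  sec_sub := by
    rintro x s t ⟨φ, h⟩ ⟨ψ, h'⟩
    exact ⟨φ - ψ, by filter_upwards [h, h'] with y h1 h2 using by rw [h1, h2, map_sub]⟩
  exists_sec x e := by
    obtain ⟨φ, rfl⟩ := QuotientAddGroup.mk'_surjective _ e
    exact ⟨fun y => coindMk y φ, ⟨φ, .of_forall fun _ => rfl⟩, rfl⟩
  eventually_zero := by
    rintro x s ⟨φ, h⟩ h0
    rw [h.self_of_nhds, coindMk_eq_zero] at h0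
    filter_upwards [h, h0.eventually_nhds] with y h1 h2
    rw [h1, coindMk_eq_zero]
    exact h2

/-- The value at an arrow of a germ at its range. -/
def coindVal (g : Arrows X) : (coindLoc M).stalk g.range →+ M g.source :=
  QuotientAddGroup.lift _ (Pi.evalAddMonoidHom _ g) fun _ h => h.self_of_nhds g rfl

lemma coindVal_mk (g : Arrows X) (φ : ∀ g : Arrows X, M g.source) :
    coindVal g (coindMk g.range φ) = φ g := rfl

lemma coindLoc_sec_global (s : ∀ x, (coindLoc M).stalk x) (x : X) :
    (coindLoc M).sec x fun y => coindMk y fun g => coindVal g (s g.range) :=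
  ⟨_, .of_forall fun _ => rfl⟩

lemma coindLoc_eventually_eq {s : ∀ x, (coindLoc M).stalk x} {x : X} (h : (coindLoc M).sec x s) :
    ∀ᶠ y in 𝓝 x, s y = coindMk y fun g => coindVal g (s g.range) := by
  obtain ⟨φ, h⟩ := h
  filter_upwards [h.eventually_nhds] with y hy
  rw [hy.self_of_nhds, coindMk_eq]
  filter_upwards [hy] with z hz
  rintro g rfl
  rw [hz, coindVal_mk]

/-- The function `ψ` is the translate of `φ` by arrows near `a`, near the range of `a`. -/
def IsTranslate (a : Arrows X) (φ ψ : ∀ g : Arrows X, M g.source) : Prop :=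
  ∀ᶠ b in 𝓝 a, ∀ (g : Arrows X) (h : b.range = g.range), ψ g = φ (divArrow b g h)

lemma IsTranslate.sub {a : Arrows X} {φ ψ φ' ψ' : ∀ g : Arrows X, M g.source}
    (h : IsTranslate a φ ψ) (h' : IsTranslate a φ' ψ') :
    IsTranslate a (φ - φ') (ψ - ψ') := by
  filter_upwards [h, h'] with b h1 h2 g hg
  rw [Pi.sub_apply, h1 g hg, h2 g hg]
  rfl

variable [IsEtaleGroupoid X]

lemma eventually_range_iff {a : Arrows X} {p : X → Prop} :
    (∀ᶠ b : Arrows X in 𝓝 a, p b.range) ↔ ∀ᶠ y in 𝓝 a.range, p y := by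
  rw [← IsEtaleGroupoid.isLocalHomeomorph_range.map_nhds_eq a, eventually_map]

lemma bisec_injOn (a : Arrows X) : Set.InjOn Arrows.range (bisec a) :=
  IsEtaleGroupoid.isLocalHomeomorph_range.injOn_localInverseAt_target

/-- Sections of the range map through the same arrow agree near it. -/
lemma eventually_eq_of_range {a : Arrows X} {p : Arrows X → Prop}
    (h : ∀ᶠ w in 𝓝 a.range, ∃ b ∈ bisec a, b.range = w ∧ p b) : ∀ᶠ b in 𝓝 a, p b := by
  filter_upwards [eventually_range_iff.mpr h, (isOpen_bisec a).mem_nhds (self_mem_bisec a)] with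
    b ⟨c, hc, hcb, hp⟩ hb
  rwa [← bisec_injOn a hc hb hcb]

/-- If `b` is near `a`, its source is near the source of `a`, and `b⁻¹ g` has that source as its
range; so `φ` vanishes there. -/
lemma IsTranslate.mem_null {a : Arrows X} {φ ψ : ∀ g : Arrows X, M g.source}
    (h : IsTranslate a φ ψ) (hφ : φ ∈ coindNull M a.source) : ψ ∈ coindNull M a.range := by
  have h1 : ∀ᶠ b : Arrows X in 𝓝 a, ∀ g : Arrows X, g.range = b.range → ψ g = 0 := by
    filter_upwards [h, (Strings.isLocalHomeomorph_source X).continuous.continuousAt.eventually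
      (hφ : ∀ᶠ y in 𝓝 a.source, ∀ g : Arrows X, g.range = y → φ g = 0)] with b h1 h2 g hg
    rw [h1 g hg.symm]
    exact h2 (divArrow b g hg.symm) rfl
  exact eventually_range_iff.mp h1

/-- The units form an open set of arrows: near a unit, an arrow and the unit at its range lie in one
bisection, hence are equal. Translation by units does nothing. -/
lemma isTranslate_unit (x : X) (φ : ∀ g : Arrows X, M g.source) :
    IsTranslate (unitArrow x) φ φ := by
  have h1 : ∀ᶠ b : Arrows X in 𝓝 (unitArrow x), b = unitArrow b.range := by
    refine eventually_eq_of_range ?_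
    have : (unitArrow : X → Arrows X) ⁻¹' bisec (unitArrow x) ∈ 𝓝 x :=
      IsEtaleGroupoid.continuous_unit.continuousAt.preimage_mem_nhds
        ((isOpen_bisec _).mem_nhds (self_mem_bisec _))
    filter_upwards [this] with w hw
    exact ⟨_, hw, rfl, rfl⟩
  filter_upwards [h1] with b hb g hg
  exact (apply_divArrow_unit φ (hb.trans (congrArg _ hg)) hg).symm

/-- Products of arrows near the two factors have all ranges near the range of the product and lie in
one bisection, so they exhaust the arrows near the product. For them the claim is associativity. -/
lemma IsTranslate.comp (p : ComposablePair X) {φ ψ χ : ∀ g : Arrows X, M g.source}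
    (h : IsTranslate ⟨p.x, p.y, p.g⟩ φ ψ) (h' : IsTranslate ⟨p.y, p.z, p.h⟩ ψ χ) :
    IsTranslate (mulArrow p) φ χ := by
  refine eventually_eq_of_range ?_
  have h1 : mulArrow ⁻¹' bisec (mulArrow p) ∈ 𝓝 p :=
    IsEtaleGroupoid.continuous_mul.continuousAt.preimage_mem_nhds
      ((isOpen_bisec _).mem_nhds (self_mem_bisec _))
  rw [nhds_induced, Filter.mem_comap] at h1
  obtain ⟨N, hN, hNsub⟩ := h1
  obtain ⟨B, hB, C, hC, hBC⟩ := mem_nhds_prod_iff.mp hN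
  have h2 := eventually_exists_arrow ⟨p.y, p.z, p.h⟩ (inter_mem hB h')
  have h3 := (tendsto_theta ⟨p.y, p.z, p.h⟩).eventually
    (eventually_exists_arrow ⟨p.x, p.y, p.g⟩ (inter_mem hC h))
  filter_upwards [h2, h3] with w hw hw'
  obtain ⟨⟨b₁, b₂, b⟩, hbB, hbr, hbs⟩ := hw
  obtain ⟨⟨c₁, c₂, c⟩, hcC, hcr, hcs⟩ := hw'
  dsimp only at hbr hbs hcr hcs
  have h4 : c₂ = b₁ := hcr.trans hbs.symm
  subst h4 hbr
  refine ⟨mulArrow ⟨c, b⟩, hNsub (hBC ⟨hbB.1, hcC.1⟩), rfl, fun g hg => ?_⟩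
  rw [apply_divArrow_mul φ ⟨c, b⟩ g hg, hbB.2 g hg]
  exact hcC.2 (divArrow ⟨c₂, b₂, b⟩ g hg) rfl

open Classical in
/-- A translate of `φ`, as a function. -/
noncomputable def translateFun (a : Arrows X) (φ : ∀ g : Arrows X, M g.source) (g : Arrows X) :
    M g.source :=
  if h : ∃ b ∈ bisec a, b.range = g.range then φ (divArrow h.choose g h.choose_spec.2) else 0

lemma translateFun_pos {a : Arrows X} (φ : ∀ g : Arrows X, M g.source) {g : Arrows X}
    (h : ∃ b ∈ bisec a, b.range = g.range) :
    translateFun a φ g = φ (divArrow h.choose g h.choose_spec.2) := dif_pos h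

lemma translateFun_neg {a : Arrows X} (φ : ∀ g : Arrows X, M g.source) {g : Arrows X}
    (h : ¬ ∃ b ∈ bisec a, b.range = g.range) : translateFun a φ g = 0 := dif_neg h

/-- A translate of `φ`. -/
noncomputable def translate (a : Arrows X) :
    (∀ g : Arrows X, M g.source) →+ (∀ g : Arrows X, M g.source) where
  toFun := translateFun a
  map_zero' := funext fun g => by
    by_cases h : ∃ b ∈ bisec a, b.range = g.range
    exacts [translateFun_pos _ h, translateFun_neg _ h]
  map_add' φ ψ := funext fun g => by
    rw [Pi.add_apply]
    by_cases h : ∃ b ∈ bisec a, b.range = g.range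
    · rw [translateFun_pos _ h, translateFun_pos _ h, translateFun_pos _ h]
      rfl
    · rw [translateFun_neg _ h, translateFun_neg _ h, translateFun_neg _ h, add_zero]

lemma isTranslate_translate (a : Arrows X) (φ : ∀ g : Arrows X, M g.source) :
    IsTranslate a φ (translate a φ) := by
  filter_upwards [(isOpen_bisec a).mem_nhds (self_mem_bisec a)] with b hb g hg
  have h : ∃ b ∈ bisec a, b.range = g.range := ⟨b, hb, hg⟩
  have h1 : translate a φ g = φ (divArrow h.choose g h.choose_spec.2) := translateFun_pos φ h
  rw [h1]
  have key : ∀ (c : Arrows X) (hc : c.range = g.range), c = b →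
      φ (divArrow c g hc) = φ (divArrow b g hg) := by rintro c hc rfl; rfl
  -- The range map is injective on the bisection, so the chosen arrow is `b`.
  exact key _ _ (bisec_injOn a h.choose_spec.1 hb (h.choose_spec.2.trans hg.symm))

/-- The action of an arrow on the stalks of a coinduced sheaf. -/
noncomputable def coindAct {x y : X} (g : x ⟶ y) :
    (coindLoc M).stalk x →+ (coindLoc M).stalk y :=
  QuotientAddGroup.map _ _ (translate ⟨x, y, g⟩) fun φ hφ =>
    (isTranslate_translate ⟨x, y, g⟩ φ).mem_null hφ

/-- The difference of two translates of `φ` is a translate of `0`, hence null; so the action may be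
computed with any translate in place of the chosen one. -/
lemma IsTranslate.coindAct_mk {x y : X} {g : x ⟶ y} {φ ψ : ∀ g : Arrows X, M g.source}
    (h : IsTranslate ⟨x, y, g⟩ φ ψ) : coindAct g (coindMk x φ) = coindMk y ψ := by
  have h1 := ((isTranslate_translate ⟨x, y, g⟩ φ).sub h).mem_null (by
    rw [sub_self]; exact zero_mem _)
  exact sub_eq_zero.mp ((QuotientAddGroup.eq_zero_iff _).mpr h1)

variable (M) in
/-- The `𝒢`-sheaf coinduced from a family of abelian groups. -/
noncomputable def coind : GSheaf.{u, max u w} X :=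
  GSheaf.ofLoc IsEtaleGroupoid.isLocalHomeomorph_range.continuous (coindLoc M) coindAct
    (fun x e => by
      obtain ⟨φ, rfl⟩ := QuotientAddGroup.mk'_surjective _ e
      exact (isTranslate_unit x φ).coindAct_mk)
    (fun {x y z} g h e => by
      obtain ⟨φ, rfl⟩ := QuotientAddGroup.mk'_surjective _ e
      exact (IsTranslate.comp ⟨g, h⟩ (isTranslate_translate ⟨x, y, g⟩ φ)
        (isTranslate_translate ⟨y, z, h⟩ _)).coindAct_mk)
    (fun a s ⟨φ, hs⟩ => by
      refine ⟨fun y => coindMk y (translate a φ), ⟨_, .of_forall fun _ => rfl⟩, ?_⟩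
      filter_upwards [(isTranslate_translate a φ).eventually_nhds,
        (Strings.isLocalHomeomorph_source X).continuous.continuousAt.eventually hs] with b h1 h2
      rw [h2]
      exact IsTranslate.coindAct_mk h1)

lemma coind_sec {x : X} {s : ∀ x, (coindLoc M).stalk x} :
    (coind M).toLoc.sec x s ↔ (coindLoc M).sec x s := GSheaf.ofLoc_sec

-- Evaluating any family of germs at the arrows gives a function on all arrows, subject to no
-- condition, hence a global section. Where the family was a section, this function has the same
-- germs (`coindLoc_eventually_eq`).
variable (M) in
lemma isCSoft_coind : (coind M).IsCSoft := by
  intro K U s _ hU hKU hs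
  rw [GSheaf.isSectionOn_iff hU] at hs
  have h1 : ∀ᶠ y in 𝓝ˢ K, s y = coindMk y (fun g => coindVal g (s g.range)) ∧ y ∈ U :=
    eventually_nhdsSet_iff_forall.mpr fun x hx =>
      (coindLoc_eventually_eq (coind_sec.mp (hs x (hKU hx)))).and (hU.eventually_mem (hKU hx))
  obtain ⟨V, hV, hKV, h⟩ := eventually_nhdsSet_iff_exists.mp h1
  exact ⟨V, fun y => coindMk y fun g => coindVal g (s g.range), hV, hKV, fun y hy => (h y hy).2,
    GSheaf.isSectionOn_univ_iff.mpr fun x => coind_sec.mpr (coindLoc_sec_global s x),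
    fun x hx => (h x hx).1.symm⟩

section Adjoint

variable {T : GSheaf.{u, w'} X} (l : ∀ y, T.stalk y →+ M y)

/-- The function on the arrows that belongs to a section `s`. -/
def coindFun (s : ∀ x, T.stalk x) (g : Arrows X) : M g.source :=
  l g.source (T.act (Groupoid.inv g.hom) (s g.range))

variable {l}

lemma coindFun_congr {s t : ∀ x, T.stalk x} {x : X} (h : ∀ᶠ y in 𝓝 x, s y = t y) :
    coindMk x (coindFun l s) = coindMk x (coindFun l t) := by
  rw [coindMk_eq]
  filter_upwards [h] with y hy
  rintro g rfl
  rw [coindFun, coindFun, hy]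

/-- The germ depends only on the value of the section at `x`, since sections with equal values agree
nearby. This makes the map on stalks in `toCoind` independent of the chosen section. -/
lemma coindFun_through {s : ∀ x, T.stalk x} {x : X} (hs : T.toLoc.sec x s) :
    coindMk x (coindFun l (T.toLoc.through (s x))) = coindMk x (coindFun l s) :=
  coindFun_congr (LocSheaf.sec_eventuallyEq (LocSheaf.sec_through _) hs (LocSheaf.through_self _))

lemma coindFun_through_add {x : X} (e e' : T.stalk x) :
    coindMk x (coindFun l (T.toLoc.through (e + e'))) =
      coindMk x (coindFun l (T.toLoc.through e)) + coindMk x (coindFun l (T.toLoc.through e')) := by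
  have h1 := coindFun_through (l := l)
    (LocSheaf.sec_add (LocSheaf.sec_through e) (LocSheaf.sec_through e'))
  simp only [LocSheaf.through_self] at h1
  rw [h1, ← map_add]
  congr 1
  funext g
  simp [coindFun]

variable (l) in
/-- The morphism to a coinduced sheaf given by homomorphisms from the stalks. -/
noncomputable def toCoind : GSheafHom T (coind M) :=
  GSheafHom.ofSec (fun x => AddMonoidHom.mk' (fun e => coindMk x (coindFun l (T.toLoc.through e)))
    coindFun_through_add)
    (fun x s hs => coind_sec.mpr ⟨coindFun l s, (T.toLoc.sec_eventually hs).mono fun y hy =>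
      coindFun_through hy⟩)
    (fun {x y} g e => by
      obtain ⟨s, hs, rfl⟩ := T.toLoc.exists_sec x e
      obtain ⟨t, ht, hst⟩ := T.exists_sec_act ⟨x, y, g⟩ hs
      have h1 : T.act g (s x) = t y := hst.self_of_nhds
      change coindMk y (coindFun l (T.toLoc.through (T.act g (s x)))) =
        coindAct g (coindMk x (coindFun l (T.toLoc.through (s x))))
      rw [h1, coindFun_through ht, coindFun_through hs]
      refine (IsTranslate.coindAct_mk ?_).symm
      -- For `b` near the given arrow and `k` with the same range, `k⁻¹ t` and `(k⁻¹ b) s` agree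
      -- because `t` is the translate of `s` by `b`.
      filter_upwards [hst] with b hb k hk
      obtain ⟨k₁, k₂, k⟩ := k
      obtain ⟨b₁, b₂, b⟩ := b
      dsimp only at hk hb
      subst hk
      simp only [coindFun, divArrow, ← hb, ← T.act_comp]
      simp [Groupoid.inv_eq_inv]
      rfl)

lemma toCoind_apply {s : ∀ x, T.stalk x} {x : X} (hs : T.toLoc.sec x s) :
    (toCoind l).app x (s x) = coindMk x (coindFun l s) := coindFun_through hs

/-- At the unit arrow the function that belongs to a section is `l` of its value. Conversely, if the
kernel of `l` is open in the étale space and stable under the action, vanishing of `l` at `x`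
spreads to all arrows with range near `x`. -/
lemma toCoind_eq_zero_iff (h : ∀ {x y : X} (g : x ⟶ y) (e : T.stalk x), l x e = 0 →
    l y (T.act g e) = 0) (hs : ∀ {x : X} {s : ∀ x, T.stalk x}, T.toLoc.sec x s → l x (s x) = 0 →
      ∀ᶠ y in 𝓝 x, l y (s y) = 0) {x : X} (e : T.stalk x) :
    (toCoind l).app x e = 0 ↔ l x e = 0 := by
  obtain ⟨s, hsec, rfl⟩ := T.toLoc.exists_sec x e
  rw [toCoind_apply hsec]
  refine coindMk_eq_zero.trans ⟨fun h0 => ?_, fun h0 => ?_⟩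
  · have h1 := h0.self_of_nhds (unitArrow x) rfl
    have h2 : T.act (Groupoid.inv (𝟙 x)) (s x) = s x := by
      rw [Groupoid.inv_eq_inv, IsIso.inv_id, T.act_id]
    rw [← h2]
    exact h1
  · filter_upwards [hs hsec h0] with y hy
    rintro g rfl
    exact h _ _ hy

/-- Extension of morphisms to a sheaf coinduced from injective groups. -/
theorem exists_extend_coind {S : GSheaf.{u, w₁} X} {T : GSheaf.{u, w₂} X} (d : GSheafHom S T)
    (hM : ∀ y, ExtendsHoms.{w, w₁, w₂} (M y)) (ψ : GSheafHom S (coind M))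
    (h0 : ∀ x e, d.app x e = 0 → ψ.app x e = 0) :
    ∃ ψ' : GSheafHom T (coind M), ∀ x e, ψ'.app x (d.app x e) = ψ.app x e := by
  -- A morphism to a coinduced sheaf is determined by its values at unit arrows, and any
  -- homomorphisms from the stalks occur. So only these homomorphisms have to be extended, one stalk
  -- at a time and without regard to continuity.
  have h1 : ∀ y, ∃ l : T.stalk y →+ M y, ∀ e, l (d.app y e) =
      coindVal (unitArrow y) (ψ.app y e) := fun y =>
    hM y (d.app y) ((coindVal (unitArrow y)).comp (ψ.app y)) fun e he => by
      change coindVal (unitArrow y) (ψ.app y e) = 0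
      rw [h0 y e he]
      exact map_zero _
  choose l hl using h1
  refine ⟨toCoind l, fun x e => ?_⟩
  obtain ⟨s, hs, rfl⟩ := S.toLoc.exists_sec x e
  rw [toCoind_apply (d.map_sec hs)]
  obtain ⟨χ, hχ⟩ := coind_sec.mp (ψ.map_sec hs)
  have hχ' : ∀ᶠ y in 𝓝 x, ψ.app y (s y) = coindMk y χ := hχ
  refine Eq.trans ?_ hχ'.self_of_nhds.symm
  refine coindMk_eq.mpr ?_
  filter_upwards [hχ'] with y hy
  rintro g rfl
  -- At an arbitrary arrow `g` the comparison is reduced to the unit at its source by acting with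
  -- `g⁻¹`.
  rw [coindFun, ← d.app_act, hl, ψ.app_act, hy]
  have h2 : (coind M).act (Groupoid.inv g.hom) (coindMk g.range χ) =
      coindMk g.source (translate (invArrow g) χ) := rfl
  rw [h2]
  have h3 := (isTranslate_translate (invArrow g) χ).self_of_nhds (unitArrow g.source) rfl
  exact h3.trans (apply_divArrow_inv χ g)

end Adjoint

end Coind

/-! ### Morphisms of resolutions and their homotopies -/

section Sequences

/-- Dependent recursion in which the invariant `good` makes the next step possible and `rel` records
what the step achieves. -/
lemma exists_seq_of_step {P : ℕ → Type w} (good : ∀ n, P n → Prop)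
    (rel : ∀ n, P n → P (n + 1) → Prop) (p₀ : P 0) (h₀ : good 0 p₀)
    (step : ∀ n p, good n p → ∃ p', rel n p p' ∧ good (n + 1) p') :
    ∃ p : ∀ n, P n, p 0 = p₀ ∧ ∀ n, rel n (p n) (p (n + 1)) := by
  choose s hs hg using step
  let q : ∀ n, {p : P n // good n p} := fun n =>
    Nat.rec ⟨p₀, h₀⟩ (fun n p => ⟨s n p.1 p.2, hg n p.1 p.2⟩) n
  exact ⟨fun n => (q n).1, rfl, fun n => hs n (q n).1 (q n).2⟩

end Sequences

section Homs

variable {X : Type u} [Groupoid.{u} X] [TopologicalSpace X] [TopologicalSpace (Arrows X)]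

namespace GSheafHom

variable {S : GSheaf.{u, w₁} X} {T : GSheaf.{u, w₂} X} {U : GSheaf.{u, w₃} X}

/-- Composition of morphisms. -/
def comp (ψ : GSheafHom T U) (φ : GSheafHom S T) : GSheafHom S U :=
  ofSec (fun x => (ψ.app x).comp (φ.app x)) (fun _ _ hs => ψ.map_sec (φ.map_sec hs))
    fun g e => (congrArg (ψ.app _) (φ.app_act g e)).trans (ψ.app_act g _)

/-- The difference of two morphisms. -/
def sub (φ ψ : GSheafHom S T) : GSheafHom S T :=
  ofSec (fun x => φ.app x - ψ.app x) (fun _ _ hs => T.toLoc.sec_sub (φ.map_sec hs) (ψ.map_sec hs))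
    fun g e => by simp [φ.app_act, ψ.app_act]

/-- The zero morphism. -/
def zero (S : GSheaf.{u, w₁} X) (T : GSheaf.{u, w₂} X) : GSheafHom S T :=
  ofSec (fun _ => 0) (fun x _ _ => T.toLoc.sec_zero x) fun g e => by simp

lemma comp_app (ψ : GSheafHom T U) (φ : GSheafHom S T) (x : X) (e : S.stalk x) :
    (ψ.comp φ).app x e = ψ.app x (φ.app x e) := rfl

lemma sub_app (φ ψ : GSheafHom S T) (x : X) (e : S.stalk x) :
    (φ.sub ψ).app x e = φ.app x e - ψ.app x e := rfl

end GSheafHom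

/-- Morphisms to `T` extend along monomorphisms. -/
def GSheaf.IsInjective (T : GSheaf.{u, w} X) : Prop :=
  ∀ {S : GSheaf.{u, w₁} X} {S' : GSheaf.{u, w₂} X} (d : GSheafHom S S') (ψ : GSheafHom S T),
    (∀ x e, d.app x e = 0 → ψ.app x e = 0) →
      ∃ ψ' : GSheafHom S' T, ∀ x e, ψ'.app x (d.app x e) = ψ.app x e

namespace CSoftResolution

variable {A : GSheaf.{u, w} X} (R : CSoftResolution A)

lemma d_augmentation (x : X) (e : A.stalk x) : (R.d 0).app x (R.augmentation.app x e) = 0 :=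
  (R.exact_zero x _).mpr ⟨e, rfl⟩

lemma d_d (q : ℕ) (x : X) (e : (R.sheaf q).stalk x) :
    (R.d (q + 1)).app x ((R.d q).app x e) = 0 :=
  (R.exact_succ q x _).mpr ⟨e, rfl⟩

end CSoftResolution

variable {A : GSheaf.{u, w} X} {R R' : CSoftResolution A}

/-- Extension of a morphism in degree `0` to a morphism of resolutions. -/
theorem exists_resolutionHom (f₀ : GSheafHom (R.sheaf 0) (R'.sheaf 0))
    (hf₀ : ∀ x e, f₀.app x (R.augmentation.app x e) = R'.augmentation.app x e)
    (hinj : ∀ q, (R'.sheaf (q + 1)).IsInjective.{u, u, u, u}) :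
    ∃ f : ResolutionHom R R', f.hom 0 = f₀ := by
  obtain ⟨f, hf, hfd⟩ := exists_seq_of_step
    (P := fun q => GSheafHom (R.sheaf q) (R'.sheaf q))
    -- The invariant says that `d f` vanishes on the kernel of `d`, which is what injectivity needs
    -- to extend it along `d`.
    (fun q f => ∀ x e, (R.d q).app x e = 0 → (R'.d q).app x (f.app x e) = 0)
    (fun q f f' => ∀ x e, f'.app x ((R.d q).app x e) = (R'.d q).app x (f.app x e)) f₀
    (fun x e he => by
      obtain ⟨e, rfl⟩ := (R.exact_zero x e).mp he
      rw [hf₀, R'.d_augmentation])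
    (fun q f hf => by
      obtain ⟨f', hf'⟩ := hinj q (R.d q) ((R'.d q).comp f) hf
      refine ⟨f', hf', fun x e he => ?_⟩
      obtain ⟨e, rfl⟩ := (R.exact_succ q x e).mp he
      rw [hf', GSheafHom.comp_app, R'.d_d])
  exact ⟨⟨f, by rwa [hf], hfd⟩, hf⟩

/-- Two morphisms of resolutions are homotopic if the target is injective. -/
theorem exists_homotopy (f g : ResolutionHom R R')
    (hinj : ∀ q, (R'.sheaf q).IsInjective.{u, u, u, u}) :
    ∃ h : ∀ q, GSheafHom (R.sheaf (q + 1)) (R'.sheaf q),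
      (∀ x e, (h 0).app x ((R.d 0).app x e) = (f.hom 0).app x e - (g.hom 0).app x e) ∧
      ∀ q x e, (h (q + 1)).app x ((R.d (q + 1)).app x e) + (R'.d q).app x ((h q).app x e) =
        (f.hom (q + 1)).app x e - (g.hom (q + 1)).app x e := by
  obtain ⟨h₀, hh₀⟩ := hinj 0 (R.d 0) ((f.hom 0).sub (g.hom 0)) fun x e he => by
    obtain ⟨e, rfl⟩ := (R.exact_zero x e).mp he
    rw [GSheafHom.sub_app, f.hom_augmentation, g.hom_augmentation, sub_self]
  obtain ⟨h, hh, hhd⟩ := exists_seq_of_step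
    (P := fun q => GSheafHom (R.sheaf (q + 1)) (R'.sheaf q))
    -- The defect `f - g - d h` must vanish on the kernel of `d`; it then factors through `d`, and
    -- the extension is the next term of the homotopy.
    (fun q h => ∀ x e, (R.d (q + 1)).app x e = 0 →
      (f.hom (q + 1)).app x e - (g.hom (q + 1)).app x e - (R'.d q).app x (h.app x e) = 0)
    (fun q h h' => ∀ x e, h'.app x ((R.d (q + 1)).app x e) =
      (f.hom (q + 1)).app x e - (g.hom (q + 1)).app x e - (R'.d q).app x (h.app x e)) h₀
    (fun x e he => by
      obtain ⟨e, rfl⟩ := (R.exact_succ 0 x e).mp he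
      rw [f.hom_d, g.hom_d, hh₀, GSheafHom.sub_app, map_sub, sub_self])
    (fun q h hh => by
      obtain ⟨h', hh'⟩ := hinj (q + 1) (R.d (q + 1))
        (((f.hom (q + 1)).sub (g.hom (q + 1))).sub ((R'.d q).comp h)) hh
      refine ⟨h', hh', fun x e he => ?_⟩
      obtain ⟨e, rfl⟩ := (R.exact_succ (q + 1) x e).mp he
      rw [f.hom_d, g.hom_d, hh']
      simp only [GSheafHom.sub_app, GSheafHom.comp_app, map_sub, R'.d_d]
      abel)
  exact ⟨h, fun x e => by rw [hh, hh₀, GSheafHom.sub_app], fun q x e => by rw [hhd]; abel⟩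

variable [IsEtaleGroupoid X]

/-! ### Resolutions by coinduced injective sheaves -/

section Next

variable {S : GSheaf.{u, w₁} X} {T : GSheaf.{u, w₂} X} (d : GSheafHom S T)

/-- The homomorphisms that define `nextHom`. -/
def nextFam (y : X) : T.stalk y →+ CharHull (T.stalk y ⧸ (d.app y).range) :=
  (toCharHull _).comp (QuotientAddGroup.mk' _)

lemma nextFam_eq_zero_iff {y : X} {e : T.stalk y} :
    nextFam d y e = 0 ↔ e ∈ (d.app y).range := by
  refine ⟨fun h => (QuotientAddGroup.eq_zero_iff _).mp (eq_zero_of_toCharHull h), fun h => ?_⟩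
  rw [nextFam, AddMonoidHom.comp_apply, QuotientAddGroup.mk'_apply,
    (QuotientAddGroup.eq_zero_iff _).mpr h, map_zero]

/-- An injective `𝒢`-sheaf that contains the cokernel of `d`. -/
noncomputable def next : GSheaf.{u, max u w₂} X :=
  coind fun y => CharHull (T.stalk y ⧸ (d.app y).range)

/-- The morphism to an injective `𝒢`-sheaf with kernel the image of `d`. -/
noncomputable def nextHom : GSheafHom T (next d) := toCoind (nextFam d)

/-- The kernel of `nextFam d` is the image of `d`, which is stable under the action and open in the
étale space, as `d` maps sections to sections; so `toCoind_eq_zero_iff` applies. -/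
lemma exact_nextHom (x : X) : Function.Exact (d.app x) ((nextHom d).app x) := by
  intro e
  refine (toCoind_eq_zero_iff (fun g e he => ?_) (fun {x s} hs h0 => ?_) e).trans
    (nextFam_eq_zero_iff d)
  · rw [nextFam_eq_zero_iff] at he ⊢
    obtain ⟨c, rfl⟩ := he
    exact ⟨S.act g c, d.app_act g c⟩
  · obtain ⟨c, hc⟩ := (nextFam_eq_zero_iff d).mp h0
    filter_upwards [LocSheaf.sec_eventuallyEq hs (d.map_sec (S.toLoc.sec_through c))
      (by rw [LocSheaf.through_self, hc])] with y hy
    rw [nextFam_eq_zero_iff, hy]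
    exact ⟨_, rfl⟩

lemma isCSoft_next : (next d).IsCSoft := isCSoft_coind _

lemma isInjective_next : (next d).IsInjective.{u, max u w₂, w, w'} := fun d' ψ h =>
  exists_extend_coind d' (fun _ => extendsHoms_charHull _) ψ h

end Next

section Resolve

variable {S₀ : GSheaf.{u, u} X} (ε : GSheafHom A S₀)

/-- The differentials of a resolution that continues a monomorphism `ε`. -/
noncomputable def resolveStage : ℕ → Σ S : GSheaf.{u, u} X, Σ T : GSheaf.{u, u} X, GSheafHom S T
  | 0 => ⟨S₀, next ε, nextHom ε⟩
  | q + 1 => ⟨(resolveStage q).2.1, next (resolveStage q).2.2, nextHom (resolveStage q).2.2⟩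

/-- A resolution that continues a monomorphism `ε` to a `c`-soft `𝒢`-sheaf. -/
noncomputable def resolve (hε : ∀ x, Function.Injective (ε.app x)) (hS : S₀.IsCSoft) :
    CSoftResolution A where
  sheaf q := (resolveStage ε q).1
  augmentation := ε
  d q := (resolveStage ε q).2.2
  augmentation_injective := hε
  exact_zero x := exact_nextHom ε x
  exact_succ q x := exact_nextHom (resolveStage ε q).2.2 x
  isCSoft
    | 0 => hS
    | 1 => isCSoft_next ε
    | q + 2 => isCSoft_next (resolveStage ε q).2.2

/-- Only degree `0` is prescribed; all later sheaves are coinduced from injective groups. -/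
lemma isInjective_resolve_succ (hε : ∀ x, Function.Injective (ε.app x)) (hS : S₀.IsCSoft) :
    ∀ q, ((resolve ε hε hS).sheaf (q + 1)).IsInjective.{u, u, w₁, w₂}
  | 0 => isInjective_next ε
  | q + 1 => isInjective_next (resolveStage ε q).2.2

end Resolve

section InjectiveResolution

variable (A : GSheaf.{u, 0} X)

/-- The image of the zero morphism is zero, so exactness makes the next morphism an embedding of `A`
in an injective `𝒢`-sheaf. -/
lemma nextHom_zero_injective (x : X) :
    Function.Injective ((nextHom (GSheafHom.zero A A)).app x) := by
  refine (injective_iff_map_eq_zero _).mpr fun e he => ?_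
  obtain ⟨c, rfl⟩ := (exact_nextHom (GSheafHom.zero A A) x e).mp he
  rfl

/-- A resolution by injective `𝒢`-sheaves. -/
noncomputable def injectiveResolution : CSoftResolution A :=
  resolve (nextHom (GSheafHom.zero A A)) (nextHom_zero_injective A) (isCSoft_next _)

lemma isInjective_injectiveResolution :
    ∀ q, ((injectiveResolution A).sheaf q).IsInjective.{u, u, w₁, w₂}
  | 0 => isInjective_next (GSheafHom.zero A A)
  | q + 1 => isInjective_resolve_succ _ _ _ q

lemma exists_hom_injectiveResolution (R : CSoftResolution A) :
    Nonempty (ResolutionHom R (injectiveResolution A)) := by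
  obtain ⟨f₀, hf₀⟩ := isInjective_injectiveResolution A 0 R.augmentation
    (injectiveResolution A).augmentation fun x e he => by
      rw [R.augmentation_injective x (he.trans (map_zero _).symm), map_zero]
  obtain ⟨f, -⟩ := exists_resolutionHom f₀ hf₀ fun q => isInjective_injectiveResolution A (q + 1)
  exact ⟨f⟩

end InjectiveResolution

end Homs

/-! ### Iterated fibre sums and the identity `δ ∘ δ = 0` -/

section Finsum

variable {M : Type*} [AddCommMonoid M]

lemma finsum_fiberwise {α β : Type*} (π : α → β) (φ : α → M) (h : (Function.support φ).Finite) :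
    ∑ᶠ b, ∑ᶠ a : {a // π a = b}, φ a = ∑ᶠ a, φ a := by
  classical
  have hin : ∀ b, ∑ᶠ a : {a // π a = b}, φ a = ∑ a ∈ h.toFinset with π a = b, φ a := by
    intro b
    rw [finsum_eq_sum_of_support_subset (s := h.toFinset.subtype fun a => π a = b)]
    · rw [Finset.sum_subtype_eq_sum_filter]
    · intro a ha
      simpa using ha
  simp only [hin]
  rw [finsum_eq_sum_of_support_subset (s := h.toFinset.image π), finsum_eq_sum φ h]
  · exact Finset.sum_fiberwise_of_maps_to (fun a ha => Finset.mem_image_of_mem π ha) _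
  · intro b hb
    obtain ⟨a, ha, -⟩ := Finset.exists_ne_zero_of_sum_ne_zero hb
    rw [Finset.mem_filter] at ha
    exact Finset.mem_coe.mpr (Finset.mem_image.mpr ⟨a, ha⟩)

lemma finsum_fiber_fiber {α β γ : Type*} (f : α → β) (g : β → γ) (c : γ)
    (φ : {a // g (f a) = c} → M) (h : (Function.support φ).Finite) :
    ∑ᶠ b : {b // g b = c}, ∑ᶠ a : {a // f a = b.1}, φ ⟨a.1, (congrArg g a.2).trans b.2⟩ =
      ∑ᶠ a, φ a := by
  rw [← finsum_fiberwise (fun a : {a // g (f a) = c} => (⟨f a.1, a.2⟩ : {b // g b = c})) φ h]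
  refine finsum_congr fun b => ?_
  let e : {a // f a = b.1} ≃
      {a : {a // g (f a) = c} // (⟨f a.1, a.2⟩ : {b // g b = c}) = b} :=
    { toFun := fun a => ⟨⟨a.1, (congrArg g a.2).trans b.2⟩, Subtype.ext a.2⟩
      invFun := fun a => ⟨a.1.1, congrArg Subtype.val a.2⟩
      left_inv := fun _ => rfl
      right_inv := fun _ => rfl }
  exact finsum_comp_equiv e (f := fun a => φ a.1)

end Finsum

section Faces

lemma succAbove_succAbove_comm {n : ℕ} {i : Fin (n + 2)} {j : Fin (n + 3)}
    (h : (j : ℕ) ≤ i) (k : Fin (n + 1)) :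
    j.succAbove (i.succAbove k) =
      i.succ.succAbove ((j.castLT (h.trans_lt i.2)).succAbove k) := by
  apply Fin.ext
  simp only [Fin.succAbove, Fin.lt_def]
  split_ifs <;> simp_all <;> lia

variable {X : Type u} [Groupoid.{u} X]

namespace Strings

lemma arrow_congr {n : ℕ} (F : Strings X n) {i j i' j' : Fin (n + 1)} (hi : i = i') (hj : j = j')
    (h : i ≤ j) (h' : i' ≤ j') : F.arrow h = F.arrow h' := by
  subst hi hj; rfl

lemma face_face {n : ℕ} {i : Fin (n + 2)} {j : Fin (n + 3)} (h : (j : ℕ) ≤ i)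
    (F : Strings X (n + 2)) :
    (F.face j).face i = (F.face i.succ).face (j.castLT (h.trans_lt i.2)) :=
  ext_arrow fun k => by
    simp only [arrow_face]
    exact F.arrow_congr (succAbove_succAbove_comm h 0) (succAbove_succAbove_comm h k) _ _

/-- The inverse of the arrow `x₀ ← xᵢ`, with a prescribed target. -/
def invHom {n : ℕ} (F : Strings X n) (i : Fin (n + 1)) {y : X} (h : F.vertex i = y) :
    F.vertex 0 ⟶ y :=
  Groupoid.inv (F.hom (Fin.zero_le i)) ≫ eqToHom h

lemma invHom_congr {n : ℕ} (F : Strings X n) {i i' : Fin (n + 1)} (e : i = i') {y : X}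
    (h : F.vertex i = y) (h' : F.vertex i' = y) : F.invHom i h = F.invHom i' h' := by
  subst e; rfl

end Strings

namespace GSheaf

open Strings

/-- Both sides are the inverse of the arrow from the initial vertex of the double face to `x₀`.
Hence the twist of an iterated face depends only on the position of that vertex. -/
lemma faceHom_comp {p : ℕ} (i : Fin (p + 2)) (j : Fin (p + 3)) (H : Strings X (p + 2))
    {y : X} (h : H.vertex (j.succAbove (i.succAbove 0)) = y) :
    faceHom j H ≫ faceHom i (H.face j) ≫ eqToHom h =
      H.invHom (j.succAbove (i.succAbove 0)) h := by
  have h1 := H.hom_comp (Fin.zero_le (j.succAbove 0))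
    ((Fin.strictMono_succAbove j).monotone (Fin.zero_le (i.succAbove 0)))
  change Groupoid.inv (H.hom (Fin.zero_le (j.succAbove 0))) ≫ Groupoid.inv
    (H.hom ((Fin.strictMono_succAbove j).monotone (Fin.zero_le (i.succAbove 0)))) ≫ eqToHom h = _
  rw [invHom, ← h1]
  simp only [Groupoid.inv_eq_inv, IsIso.inv_comp, Category.assoc]

variable [TopologicalSpace X] [TopologicalSpace (Arrows X)]

section Value

variable (S : GSheaf.{u, w} X) [IsEtaleGroupoid X] [T2Space (Arrows X)]

lemma faceSum_apply (p : ℕ) (i : Fin (p + 2)) (σ : S.barGroup (p + 1)) (F : Strings X p) :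
    (S.faceSum p i σ).1 F = ∑ᶠ G : {G : Strings X (p + 1) // G.face i = F},
      S.act (faceHom i G.1 ≫ eqToHom (congrArg (vertex 0) G.2)) (σ.1 G.1) := by
  change (∑ᶠ G : {G : Strings X (p + 1) // G.face i = F},
    S.castStalk _ (S.act (faceHom i G.1) (σ.1 G.1))) = _
  refine finsum_congr fun G => ?_
  rw [castStalk, ← S.act_comp]

lemma finite_support_faceSum {p : ℕ} (i : Fin (p + 2)) (σ : S.barGroup (p + 1)) (F : Strings X p) :
    (Function.support fun G : {G : Strings X (p + 1) // G.face i = F} =>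
      S.act (faceHom i G.1 ≫ eqToHom (congrArg (vertex 0) G.2)) (σ.1 G.1)).Finite := by
  refine (hasFiniteSupport_push (ρ := vertex 0) (isLocalHomeomorph_face i)
    (S.twist p i σ).2.2 F).subset fun G hG h0 => hG ?_
  dsimp only at h0 ⊢
  rw [S.act_comp]
  exact h0

/-- Two successive sums over fibres are one sum over the fibre of the composite, and the two twists
compose to one. In this form only the composite face map matters, so the simplicial identities carry
over to the `δᵢ`. -/
lemma faceSum_faceSum_apply (p : ℕ) (i : Fin (p + 2)) (j : Fin (p + 3))
    (σ : S.barGroup (p + 2)) (F : Strings X p) :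
    (S.faceSum p i (S.faceSum (p + 1) j σ)).1 F =
      ∑ᶠ H : {H : Strings X (p + 2) // (H.face j).face i = F},
        S.act (H.1.invHom (j.succAbove (i.succAbove 0)) (congrArg (vertex 0) H.2)) (σ.1 H.1) := by
  rw [faceSum_apply, ← finsum_fiber_fiber (face j) (face i) F]
  · refine finsum_congr fun G => ?_
    rw [faceSum_apply, AddMonoidHom.map_finsum _ (S.finite_support_faceSum j σ G.1)]
    refine finsum_congr fun H => ?_
    obtain ⟨G, rfl⟩ := G
    obtain ⟨H, hH⟩ := H
    dsimp only at hH
    subst hH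
    rw [← S.act_comp]
    refine congrArg (fun k => S.act k (σ.1 H)) (Eq.trans ?_ (faceHom_comp i j H rfl))
    simp only [eqToHom_refl, Category.comp_id]
    exact congrArg (faceHom j H ≫ ·) (Category.comp_id _).symm
  · refine Set.Finite.of_finite_image (f := Subtype.val) ?_ Subtype.val_injective.injOn
    refine (finite_fiber ((isLocalHomeomorph_face i).comp (isLocalHomeomorph_face j))
      σ.2.2 F).subset ?_
    rintro _ ⟨⟨H, hH⟩, h, rfl⟩
    refine ⟨subset_closure fun h0 => h ?_, hH⟩
    simp [h0]

lemma faceSum_faceSum {p : ℕ} {i : Fin (p + 2)} {j : Fin (p + 3)} (h : (j : ℕ) ≤ i)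
    (σ : S.barGroup (p + 2)) :
    S.faceSum p i (S.faceSum (p + 1) j σ) =
      S.faceSum p (j.castLT (h.trans_lt i.2)) (S.faceSum (p + 1) i.succ σ) := by
  refine Subtype.ext (funext fun F => ?_)
  rw [faceSum_faceSum_apply, faceSum_faceSum_apply]
  let e : {H : Strings X (p + 2) // (H.face j).face i = F} ≃
      {H : Strings X (p + 2) // (H.face i.succ).face (j.castLT (h.trans_lt i.2)) = F} :=
    Equiv.subtypeEquivRight fun H => by rw [face_face h]
  rw [← finsum_comp_equiv e]
  refine finsum_congr fun H => ?_
  exact congrArg (fun k => S.act k (σ.1 H.1)) (H.1.invHom_congr (succAbove_succAbove_comm h 0) _ _)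

/-- The usual cancellation of the alternating sum: the pairs `(i, j)` with `j ≤ i` are matched with
the remaining ones by `(i, j) ↦ (j, i + 1)`, which changes the sign. -/
lemma barDifferential_barDifferential (p : ℕ) (σ : S.barGroup (p + 2)) :
    S.barDifferential p (S.barDifferential (p + 1) σ) = 0 := by
  simp only [barDifferential, AddMonoidHom.finsetSum_apply, map_sum, AddMonoidHom.smul_apply,
    map_zsmul, Finset.smul_sum, smul_smul]
  rw [Finset.sum_comm, ← Finset.sum_product']
  let I := Fin (p + 2) × Fin (p + 3)
  let J : Finset I := {ij : I | (ij.2 : ℕ) ≤ (ij.1 : ℕ)}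
  rw [Finset.univ_product_univ, ← Finset.sum_add_sum_compl J, ← eq_neg_iff_add_eq_zero,
    ← Finset.sum_neg_distrib]
  let φ : ∀ ij : I, ij ∈ J → I := fun ij hij =>
    (Fin.castLT ij.2 (lt_of_le_of_lt (Finset.mem_filter.mp hij).right (Fin.is_lt ij.1)), ij.1.succ)
  apply Finset.sum_bij φ
  · intro ij hij
    simp_rw [J, φ, Finset.compl_filter, Finset.mem_filter_univ, Fin.val_succ,
      Fin.val_castLT] at hij ⊢
    lia
  · rintro ⟨i, j⟩ hij ⟨i', j'⟩ hij' h
    rw [Prod.mk_inj]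
    exact ⟨by simpa [φ] using! congr_arg Prod.snd h,
      by simpa [φ, Fin.castSucc_castLT] using! congr_arg Fin.castSucc (congr_arg Prod.fst h)⟩
  · rintro ⟨i', j'⟩ hij'
    simp_rw [J, Finset.compl_filter, Finset.mem_filter_univ, not_le] at hij'
    refine ⟨(j'.pred <| ?_, Fin.castSucc i'), ?_, ?_⟩
    · rintro rfl
      simp only [Fin.val_zero, not_lt_zero] at hij'
    · simpa [J] using! Nat.le_sub_one_of_lt hij'
    · simp only [φ, Fin.castLT_castSucc, Fin.succ_pred]
  · rintro ⟨i, j⟩ hij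
    have h : (j : ℕ) ≤ i := (Finset.mem_filter.mp hij).2
    dsimp only [φ]
    rw [S.faceSum_faceSum h, ← neg_smul]
    congr 1
    rw [Fin.val_succ, Fin.val_castLT, pow_succ]
    ring

end Value

end GSheaf

end Faces

/-! ### Direct sums of soft sheaves -/

section

namespace LocSheaf

variable {X : Type u} [TopologicalSpace X] {L : LocSheaf.{u, w} X} {L' : LocSheaf.{u, w'} X}

lemma IsSoft.prod (h : L.IsSoft) (h' : L'.IsSoft) : (L.prod L').IsSoft := by
  intro K s hK hs
  obtain ⟨t, ht, hts⟩ := h K (fun y => (s y).1) hK fun x hx => (hs x hx).1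
  obtain ⟨t', ht', hts'⟩ := h' K (fun y => (s y).2) hK fun x hx => (hs x hx).2
  exact ⟨fun y => (t y, t' y), fun x => ⟨ht x, ht' x⟩, by
    filter_upwards [hts, hts'] with y h1 h2 using Prod.ext h1 h2⟩

variable {Y : Type v} [TopologicalSpace Y] {τ : Y → X} (hτ : Continuous τ)

lemma pull_prod_sec_iff {σ : ∀ y, (L.prod L').stalk (τ y)} {y : Y} :
    ((L.prod L').pull hτ).sec y σ ↔
      (L.pull hτ).sec y (fun y => (σ y).1) ∧ (L'.pull hτ).sec y fun y => (σ y).2 := by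
  constructor
  · rintro ⟨s, hs, h⟩
    exact ⟨⟨_, hs.1, h.mono fun _ h => congrArg Prod.fst h⟩,
      ⟨_, hs.2, h.mono fun _ h => congrArg Prod.snd h⟩⟩
  · rintro ⟨⟨s, hs, h⟩, ⟨s', hs', h'⟩⟩
    exact ⟨fun y => (s y, s' y), ⟨hs, hs'⟩, by
      filter_upwards [h, h'] with y h1 h2 using Prod.ext h1 h2⟩

end LocSheaf

lemma GSheaf.IsCSoft.isSoft {X : Type u} [Groupoid.{u} X] [TopologicalSpace X]
    [TopologicalSpace (Arrows X)] {S : GSheaf.{u, w} X} (h : S.IsCSoft) : S.toLoc.IsSoft := by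
  intro K s hK hs
  obtain ⟨U, hU, hKU, hsU⟩ := eventually_nhdsSet_iff_exists.mp (LocSheaf.eventually_nhdsSet_sec hs)
  obtain ⟨V, t, hV, hKV, -, ht, hts⟩ := h K U s hK hU hKU ((GSheaf.isSectionOn_iff hU).mpr hsU)
  exact ⟨t, GSheaf.isSectionOn_univ_iff.mp ht,
    eventually_nhdsSet_iff_exists.mpr ⟨V, hV, hKV, hts⟩⟩

variable {X : Type u} [Groupoid.{u} X] [TopologicalSpace X] [TopologicalSpace (Arrows X)]
  {A : GSheaf.{u, w} X} {R R' : CSoftResolution A} (f : ResolutionHom R R')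

/-! ### The mapping cone -/

/-- The differential of the mapping cone in degree `0`. -/
def coneHomZero : (R.sheaf 0).toLoc.Hom ((R.sheaf 1).toLoc.prod (R'.sheaf 0).toLoc) where
  app x := ((R.d 0).app x).prod ((f.hom 0).app x)
  map_sec h := ⟨(R.d 0).map_sec h, (f.hom 0).map_sec h⟩

/-- The differential of the mapping cone in positive degrees. -/
def coneHomSucc (m : ℕ) : ((R.sheaf (m + 1)).toLoc.prod (R'.sheaf m).toLoc).Hom
    ((R.sheaf (m + 2)).toLoc.prod (R'.sheaf (m + 1)).toLoc) where
  app x :=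
    (((R.d (m + 1)).app x).comp
      (AddMonoidHom.fst ((R.sheaf (m + 1)).stalk x) ((R'.sheaf m).stalk x))).prod
    (((f.hom (m + 1)).app x).comp
        (AddMonoidHom.fst ((R.sheaf (m + 1)).stalk x) ((R'.sheaf m).stalk x)) -
      ((R'.d m).app x).comp (AddMonoidHom.snd ((R.sheaf (m + 1)).stalk x) ((R'.sheaf m).stalk x)))
  map_sec h := ⟨(R.d _).map_sec h.1,
    LocSheaf.sec_sub _ ((f.hom _).map_sec h.1) ((R'.d _).map_sec h.2)⟩

lemma coneHomSucc_app {m : ℕ} {x : X} (b : (R.sheaf (m + 1)).stalk x) (a : (R'.sheaf m).stalk x) :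
    (coneHomSucc f m).app x (b, a) =
      ((R.d (m + 1)).app x b, (f.hom (m + 1)).app x b - (R'.d m).app x a) := rfl

lemma coneHomZero_app {x : X} (b : (R.sheaf 0).stalk x) :
    (coneHomZero f).app x b = ((R.d 0).app x b, (f.hom 0).app x b) := rfl

include f in
-- If `d b = 0`, then `b` comes from `A`, and `f` maps it to the augmentation of the same element in
-- `R'`, which is injective.
lemma eq_zero_of_coneHomZero {x : X} {b : (R.sheaf 0).stalk x} (h : (R.d 0).app x b = 0)
    (h' : (f.hom 0).app x b = 0) : b = 0 := by
  obtain ⟨e, rfl⟩ := (R.exact_zero x b).mp h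
  rw [f.hom_augmentation] at h'
  rw [R'.augmentation_injective x (h'.trans (map_zero _).symm), map_zero]

/-- If `b = d b'` and `f b = d a`, then `f b' - a` is a cocycle of degree `0`, so it comes from `A`;
changing `b'` by the same element of `A` corrects it. -/
lemma exact_coneHomZero (x : X) :
    Function.Exact ((coneHomZero f).app x) ((coneHomSucc f 0).app x) := by
  rintro ⟨b, a⟩
  rw [coneHomSucc_app]
  constructor
  · intro h
    obtain ⟨h1, h2⟩ := Prod.mk.inj h
    obtain ⟨b, rfl⟩ := (R.exact_succ 0 x b).mp h1
    have h3 : (R'.d 0).app x ((f.hom 0).app x b - a) = 0 := by rw [map_sub, ← f.hom_d, h2]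
    obtain ⟨e, he⟩ := (R'.exact_zero x _).mp h3
    refine ⟨b - R.augmentation.app x e, ?_⟩
    rw [coneHomZero_app, map_sub, map_sub, R.d_augmentation, f.hom_augmentation, he]
    simp
  · rintro ⟨b, h⟩
    rw [coneHomZero_app] at h
    obtain ⟨rfl, rfl⟩ := Prod.mk.inj h
    rw [R.d_d, f.hom_d, sub_self]
    rfl

/-- If `b = d b'` and `f b = d a`, then `f b' - a` is a cocycle of positive degree, hence some `d
e`, and `(b', e)` is a preimage. -/
lemma exact_coneHomSucc (m : ℕ) (x : X) :
    Function.Exact ((coneHomSucc f m).app x) ((coneHomSucc f (m + 1)).app x) := by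
  rintro ⟨b, a⟩
  rw [coneHomSucc_app]
  constructor
  · intro h
    obtain ⟨h1, h2⟩ := Prod.mk.inj h
    obtain ⟨b, rfl⟩ := (R.exact_succ _ x b).mp h1
    have h3 : (R'.d (m + 1)).app x ((f.hom (m + 1)).app x b - a) = 0 := by
      rw [map_sub, ← f.hom_d, h2]
    obtain ⟨e, he⟩ := (R'.exact_succ _ x _).mp h3
    refine ⟨(b, e), ?_⟩
    rw [coneHomSucc_app, he]
    simp
  · rintro ⟨⟨b, e⟩, h⟩
    rw [coneHomSucc_app] at h
    obtain ⟨rfl, rfl⟩ := Prod.mk.inj h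
    rw [R.d_d, map_sub, f.hom_d, R'.d_d]
    simp

lemma kerSoft_coneHomZero : (coneHomZero f).KerSoft :=
  LocSheaf.Hom.kerSoft_of_injective _ fun x e h => by
    obtain ⟨h1, h2⟩ := Prod.mk.inj h
    exact eq_zero_of_coneHomZero f h1 h2

section Support

variable {Y : Type v} [TopologicalSpace Y]

lemma closure_ne_zero_prod {M N : Y → Type*} [∀ y, Zero (M y)] [∀ y, Zero (N y)]
    {β : ∀ y, M y} {α : ∀ y, N y} (h : IsCompact (closure {y | β y ≠ 0}))
    (h' : IsCompact (closure {y | α y ≠ 0})) :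
    IsCompact (closure {y | ((β y, α y) : M y × N y) ≠ 0}) := by
  refine (h.union h').of_isClosed_subset isClosed_closure
    (closure_minimal (fun y hy => ?_) (isClosed_closure.union isClosed_closure))
  by_cases hb : β y = 0
  · exact Or.inr (subset_closure fun ha => hy (Prod.ext hb ha))
  · exact Or.inl (subset_closure hb)

lemma isCompact_closure_mono {M N : Y → Type*} [∀ y, Zero (M y)] [∀ y, Zero (N y)]
    {σ : ∀ y, M y} {β : ∀ y, N y} (h : IsCompact (closure {y | σ y ≠ 0}))
    (hβ : ∀ y, σ y = 0 → β y = 0) : IsCompact (closure {y | β y ≠ 0}) :=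
  h.of_isClosed_subset isClosed_closure (closure_mono fun y hy h0 => hy (hβ y h0))

end Support

section Compact

variable [CompactSpace X] [T2Space X]

/-- Induction along the cone, which begins with the zero kernel in degree `0`: each kernel is the
image of the previous differential, a quotient of soft by soft. -/
lemma kerSoft_coneHomSucc : ∀ m, (coneHomSucc f m).KerSoft
  | 0 => LocSheaf.kerSoft_of_exact (exact_coneHomZero f) (kerSoft_coneHomZero f)
      (R.isCSoft 0).isSoft
  | m + 1 => LocSheaf.kerSoft_of_exact (exact_coneHomSucc f m) (kerSoft_coneHomSucc m)
      ((R.isCSoft (m + 1)).isSoft.prod (R'.isCSoft m).isSoft)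

variable {Y : Type v} [TopologicalSpace Y] [T2Space Y] {τ : Y → X} (hτ : IsLocalHomeomorph τ)

/-- Exactness of the mapping cone on compactly supported sections, in degree `1`. -/
lemma exists_cone_lift_zero (β : (R.sheaf 1).sectionsC hτ.continuous)
    (α : (R'.sheaf 0).sectionsC hτ.continuous)
    (h : (R.d 1).mapC hτ.continuous β = 0)
    (h' : (f.hom 1).mapC hτ.continuous β = (R'.d 0).mapC hτ.continuous α) :
    ∃ β₀ : (R.sheaf 0).sectionsC hτ.continuous, (R.d 0).mapC hτ.continuous β₀ = β ∧
      (f.hom 0).mapC hτ.continuous β₀ = α := by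
  have h1 : ∀ y, (R.d 1).app (τ y) (β.1 y) = 0 := fun y => congrFun (congrArg Subtype.val h) y
  have h2 : ∀ y, (f.hom 1).app (τ y) (β.1 y) = (R'.d 0).app (τ y) (α.1 y) := fun y =>
    congrFun (congrArg Subtype.val h') y
  obtain ⟨β₀, hβ₀, hc, hl⟩ := LocSheaf.exists_lift_compactSupport hτ (exact_coneHomZero f)
    (kerSoft_coneHomZero f) (kerSoft_coneHomSucc f 0) (σ := fun y => (β.1 y, α.1 y))
    (fun y => (LocSheaf.pull_prod_sec_iff hτ.continuous).mpr
      ⟨(GSheaf.isSectionAlong_iff hτ.continuous).mp β.2.1 y,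
        (GSheaf.isSectionAlong_iff hτ.continuous).mp α.2.1 y⟩)
    (closure_ne_zero_prod β.2.2 α.2.2)
    (fun y => by rw [coneHomSucc_app, h1, h2, sub_self]; rfl)
  refine ⟨⟨β₀, (GSheaf.isSectionAlong_iff hτ.continuous).mpr hβ₀, hc⟩,
    Subtype.ext (funext fun y => ?_), Subtype.ext (funext fun y => ?_)⟩
  exacts [congrArg Prod.fst (hl y), congrArg Prod.snd (hl y)]

/-- Exactness of the mapping cone on compactly supported sections, in degrees `≥ 2`. -/
lemma exists_cone_lift_succ (m : ℕ) (β : (R.sheaf (m + 2)).sectionsC hτ.continuous)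
    (α : (R'.sheaf (m + 1)).sectionsC hτ.continuous)
    (h : (R.d (m + 2)).mapC hτ.continuous β = 0)
    (h' : (f.hom (m + 2)).mapC hτ.continuous β = (R'.d (m + 1)).mapC hτ.continuous α) :
    ∃ (β₀ : (R.sheaf (m + 1)).sectionsC hτ.continuous)
      (α₀ : (R'.sheaf m).sectionsC hτ.continuous), (R.d (m + 1)).mapC hτ.continuous β₀ = β ∧
      (f.hom (m + 1)).mapC hτ.continuous β₀ - (R'.d m).mapC hτ.continuous α₀ = α := by
  have h1 : ∀ y, (R.d (m + 2)).app (τ y) (β.1 y) = 0 := fun y =>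
    congrFun (congrArg Subtype.val h) y
  have h2 : ∀ y, (f.hom (m + 2)).app (τ y) (β.1 y) = (R'.d (m + 1)).app (τ y) (α.1 y) := fun y =>
    congrFun (congrArg Subtype.val h') y
  obtain ⟨β₀, hβ₀, hc, hl⟩ := LocSheaf.exists_lift_compactSupport hτ (exact_coneHomSucc f m)
    (kerSoft_coneHomSucc f m) (kerSoft_coneHomSucc f (m + 1)) (σ := fun y => (β.1 y, α.1 y))
    (fun y => (LocSheaf.pull_prod_sec_iff hτ.continuous).mpr
      ⟨(GSheaf.isSectionAlong_iff hτ.continuous).mp β.2.1 y,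
        (GSheaf.isSectionAlong_iff hτ.continuous).mp α.2.1 y⟩)
    (closure_ne_zero_prod β.2.2 α.2.2)
    (fun y => by rw [coneHomSucc_app, h1, h2, sub_self]; rfl)
  have hβ₀' := fun y => (LocSheaf.pull_prod_sec_iff hτ.continuous).mp (hβ₀ y)
  refine ⟨⟨fun y => (β₀ y).1, (GSheaf.isSectionAlong_iff hτ.continuous).mpr fun y => (hβ₀' y).1,
      isCompact_closure_mono hc fun y h0 => congrArg Prod.fst h0⟩,
    ⟨fun y => (β₀ y).2, (GSheaf.isSectionAlong_iff hτ.continuous).mpr fun y => (hβ₀' y).2,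
      isCompact_closure_mono hc fun y h0 => congrArg Prod.snd h0⟩,
    Subtype.ext (funext fun y => ?_), Subtype.ext (funext fun y => ?_)⟩
  exacts [congrArg Prod.fst (hl y), congrArg Prod.snd (hl y)]

end Compact

end

/-! ### The total complex and chain homotopies -/

section

variable {X : Type u} [Groupoid.{u} X] [TopologicalSpace X] [TopologicalSpace (Arrows X)]
  [IsEtaleGroupoid X] [T2Space (Arrows X)] {A : GSheaf.{u, w} X}

namespace CSoftResolution

variable (R : CSoftResolution A)

/-- The inclusion of a term of the double complex. -/
abbrev ofTerm (p q : ℕ) : (R.sheaf q).barGroup p →+ R.Total :=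
  DirectSum.of (fun pq : ℕ × ℕ => (R.sheaf pq.2).barGroup pq.1) (p, q)

lemma ofTerm_same (p q : ℕ) (σ : (R.sheaf q).barGroup p) : R.ofTerm p q σ (p, q) = σ :=
  DirectSum.of_eq_same _ _

lemma ofTerm_ne {p q p' q' : ℕ} (h : (p, q) ≠ (p', q')) (σ : (R.sheaf q).barGroup p) :
    R.ofTerm p q σ (p', q') = 0 :=
  DirectSum.of_eq_of_ne _ _ _ h.symm

lemma differential_ofTerm_zero (q : ℕ) (σ : (R.sheaf q).barGroup 0) :
    R.differential (R.ofTerm 0 q σ) = R.ofTerm 0 (q + 1) ((R.d q).bar 0 σ) := by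
  classical
  simp [differential, ofTerm]

lemma differential_ofTerm_succ (p q : ℕ) (σ : (R.sheaf q).barGroup (p + 1)) :
    R.differential (R.ofTerm (p + 1) q σ) = R.ofTerm p q ((R.sheaf q).barDifferential p σ) +
      (-1 : ℤ) ^ (p + 1) • R.ofTerm (p + 1) (q + 1) ((R.d q).bar (p + 1) σ) := by
  classical
  simp [differential, ofTerm]

lemma zsmul_apply {R : CSoftResolution A} (k : ℤ) (a : R.Total) (p q : ℕ) :
    (k • a) (p, q) = k • a (p, q) :=
  map_zsmul (DFinsupp.evalAddMonoidHom (p, q)) k a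

lemma total_induction {P : R.Total → Prop} (h0 : P 0)
    (hof : ∀ p q σ, P (R.ofTerm p q σ)) (hadd : ∀ a b, P a → P b → P (a + b)) (a : R.Total) :
    P a := DirectSum.induction_on a h0 (fun pq σ => hof pq.1 pq.2 σ) hadd

/-- No vertical map ends in row `0`. -/
lemma differential_apply_zero (b : R.Total) (p : ℕ) :
    (R.differential b) (p, 0) = (R.sheaf 0).barDifferential p (b (p + 1, 0)) := by
  induction b using R.total_induction with
  | h0 => simp
  | hadd a b ha hb =>
    rw [map_add, DirectSum.add_apply, ha, hb, DirectSum.add_apply, map_add]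
  | hof p' q' σ =>
    cases p' with
    | zero =>
      rw [differential_ofTerm_zero, ofTerm_ne _ (by simp), ofTerm_ne _ (by simp), map_zero]
    | succ p' =>
      rw [differential_ofTerm_succ, DirectSum.add_apply, CSoftResolution.zsmul_apply,
        R.ofTerm_ne (q := q' + 1) (by simp), smul_zero, add_zero]
      by_cases h : (p', q') = (p, 0)
      · obtain ⟨rfl, rfl⟩ := Prod.mk.inj h
        rw [ofTerm_same, ofTerm_same]
      · rw [ofTerm_ne _ h, ofTerm_ne _ (by simpa using h), map_zero]

lemma differential_apply_succ (b : R.Total) (p q : ℕ) :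
    (R.differential b) (p, q + 1) = (R.sheaf (q + 1)).barDifferential p (b (p + 1, q + 1)) +
      (-1 : ℤ) ^ p • (R.d q).bar p (b (p, q)) := by
  induction b using R.total_induction with
  | h0 => simp
  | hadd a b ha hb =>
    rw [map_add, DirectSum.add_apply, ha, hb, DirectSum.add_apply, DirectSum.add_apply, map_add,
      map_add, smul_add]
    abel
  | hof p' q' σ =>
    cases p' with
    | zero =>
      rw [differential_ofTerm_zero, R.ofTerm_ne (p := 0) (p' := p + 1) (by simp), map_zero]
      refine Eq.trans ?_ (zero_add _).symm
      by_cases h : (0, q') = (p, q)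
      · obtain ⟨rfl, rfl⟩ := Prod.mk.inj h
        rw [ofTerm_same, ofTerm_same, pow_zero, one_smul]
      · rw [ofTerm_ne _ h, ofTerm_ne _ (by simpa using h), map_zero, smul_zero]
    | succ p' =>
      rw [differential_ofTerm_succ, DirectSum.add_apply, CSoftResolution.zsmul_apply]
      congr 1
      · by_cases h : (p', q') = (p, q + 1)
        · obtain ⟨rfl, rfl⟩ := Prod.mk.inj h
          rw [ofTerm_same, ofTerm_same]
        · rw [ofTerm_ne _ h, ofTerm_ne _ (by simpa using h), map_zero]
      · by_cases h : (p' + 1, q') = (p, q)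
        · obtain ⟨rfl, rfl⟩ := Prod.mk.inj h
          rw [ofTerm_same, ofTerm_same]
        · rw [ofTerm_ne _ h, ofTerm_ne _ (by simpa using h), map_zero, smul_zero,
            smul_zero]

lemma bar_d_d (p q : ℕ) (σ : (R.sheaf q).barGroup p) :
    (R.d (q + 1)).bar p ((R.d q).bar p σ) = 0 :=
  Subtype.ext (funext fun F => R.d_d q _ (σ.1 F))

/-- Horizontal and vertical maps commute, and the sign `(-1)ᵖ` of the vertical map differs between
adjacent columns, so the mixed terms cancel. -/
lemma differential_differential (a : R.Total) : R.differential (R.differential a) = 0 := by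
  induction a using R.total_induction with
  | h0 => simp
  | hadd a b ha hb => rw [map_add, map_add, ha, hb, add_zero]
  | hof p q σ =>
    cases p with
    | zero => rw [differential_ofTerm_zero, differential_ofTerm_zero, bar_d_d, map_zero]
    | succ p =>
      rw [differential_ofTerm_succ, map_add, map_zsmul, differential_ofTerm_succ, bar_d_d,
        map_zero, smul_zero, add_zero, ← GSheafHom.bar_barDifferential]
      cases p with
      | zero =>
        rw [differential_ofTerm_zero]
        simp
      | succ p =>
        rw [differential_ofTerm_succ, GSheaf.barDifferential_barDifferential, map_zero, zero_add,
          pow_succ (-1 : ℤ) (p + 1), mul_neg_one, neg_smul, add_neg_cancel]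

lemma ofTerm_mem_chains (p q : ℕ) {n : ℤ} (h : (p : ℤ) - q = n) (σ : (R.sheaf q).barGroup p) :
    R.ofTerm p q σ ∈ R.chains n := by
  intro p' q' h'
  refine R.ofTerm_ne (fun e => h' ?_) σ
  obtain ⟨rfl, rfl⟩ := Prod.mk.inj e
  exact h

lemma differential_mem_chains {n : ℤ} {a : R.Total} (ha : a ∈ R.chains n) :
    R.differential a ∈ R.chains (n - 1) := by
  intro p q h
  cases q with
  | zero => rw [differential_apply_zero, ha _ _ (by push_cast at h ⊢; lia), map_zero]
  | succ q =>
    rw [differential_apply_succ, ha _ _ (by push_cast at h ⊢; lia),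
      ha _ _ (by push_cast at h ⊢; lia), map_zero, map_zero, smul_zero, add_zero]

/-- An element of the direct sum meets only finitely many columns; this makes the induction over
columns terminate. -/
lemma exists_bound (a : R.Total) : ∃ N, ∀ p q, N ≤ p → a (p, q) = 0 := by
  induction a using R.total_induction with
  | h0 => exact ⟨0, fun _ _ _ => rfl⟩
  | hadd a b ha hb =>
    obtain ⟨N, hN⟩ := ha
    obtain ⟨N', hN'⟩ := hb
    exact ⟨max N N', fun p q h => by
      rw [DirectSum.add_apply, hN p q (le_of_max_le_left h), hN' p q (le_of_max_le_right h),
        add_zero]⟩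
  | hof p q σ =>
    refine ⟨p + 1, fun p' q' h => R.ofTerm_ne (fun e => ?_) σ⟩
    obtain ⟨rfl, rfl⟩ := Prod.mk.inj e
    lia

end CSoftResolution

variable {R R' : CSoftResolution A}

lemma ResolutionHom.total_apply (f : ResolutionHom R R') (a : R.Total) (p q : ℕ) :
    f.total a (p, q) = (f.hom q).bar p (a (p, q)) := by
  simp [ResolutionHom.total]

lemma ResolutionHom.total_ofTerm (f : ResolutionHom R R') (p q : ℕ)
    (σ : (R.sheaf q).barGroup p) :
    f.total (R.ofTerm p q σ) = R'.ofTerm p q ((f.hom q).bar p σ) := by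
  simp [ResolutionHom.total, CSoftResolution.ofTerm]

section Homotopy

variable (h : ∀ q, GSheafHom (R.sheaf (q + 1)) (R'.sheaf q))

/-- The map of total complexes induced by a homotopy. -/
noncomputable def totalHomotopy : R.Total →+ R'.Total :=
  DirectSum.toAddMonoid fun
    | (_, 0) => 0
    | (p, q + 1) => (-1 : ℤ) ^ p • (R'.ofTerm p q).comp ((h q).bar p)

lemma totalHomotopy_ofTerm_zero (p : ℕ) (σ : (R.sheaf 0).barGroup p) :
    totalHomotopy h (R.ofTerm p 0 σ) = 0 := by
  simp [totalHomotopy, CSoftResolution.ofTerm]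

lemma totalHomotopy_ofTerm_succ (p q : ℕ) (σ : (R.sheaf (q + 1)).barGroup p) :
    totalHomotopy h (R.ofTerm p (q + 1) σ) = (-1 : ℤ) ^ p • R'.ofTerm p q ((h q).bar p σ) := by
  simp [totalHomotopy, CSoftResolution.ofTerm]

lemma totalHomotopy_mem_chains {n : ℤ} {a : R.Total} (ha : a ∈ R.chains n) :
    totalHomotopy h a ∈ R'.chains (n + 1) := by
  have key : ∀ (b : R.Total) (p q : ℕ), totalHomotopy h b (p, q) =
      (-1 : ℤ) ^ p • (h q).bar p (b (p, q + 1)) := by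
    intro b p q
    induction b using R.total_induction with
    | h0 => simp
    | hadd a b ha hb =>
      rw [map_add, DirectSum.add_apply, ha, hb, DirectSum.add_apply, map_add, smul_add]
    | hof p' q' σ =>
      cases q' with
      | zero =>
        rw [totalHomotopy_ofTerm_zero, R.ofTerm_ne (by simp), map_zero, smul_zero]
        rfl
      | succ q' =>
        rw [totalHomotopy_ofTerm_succ, CSoftResolution.zsmul_apply]
        by_cases e : (p', q') = (p, q)
        · obtain ⟨rfl, rfl⟩ := Prod.mk.inj e
          rw [CSoftResolution.ofTerm_same, CSoftResolution.ofTerm_same]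
        · rw [CSoftResolution.ofTerm_ne _ e, CSoftResolution.ofTerm_ne _ (by simpa using e),
            map_zero, smul_zero, smul_zero]
  intro p q hpq
  rw [key, ha _ _ (by push_cast; lia), map_zero, smul_zero]

lemma neg_one_pow_smul_smul {M : Type*} [AddCommGroup M] (p : ℕ) (m : M) :
    (-1 : ℤ) ^ p • (-1 : ℤ) ^ p • m = m := by
  rw [smul_smul, ← mul_pow, neg_one_mul, neg_neg, one_pow, one_smul]

variable {h} {f g : ResolutionHom R R'}

/-- The sign `(-1)ᵖ` in the homotopy cancels the one of the vertical differential, leaving `d h + h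
d`; the horizontal contributions from adjacent columns have opposite signs and cancel. -/
lemma totalHomotopy_spec
    (h0 : ∀ x e, (h 0).app x ((R.d 0).app x e) = (f.hom 0).app x e - (g.hom 0).app x e)
    (hs : ∀ q x e, (h (q + 1)).app x ((R.d (q + 1)).app x e) + (R'.d q).app x ((h q).app x e) =
      (f.hom (q + 1)).app x e - (g.hom (q + 1)).app x e) (a : R.Total) :
    R'.differential (totalHomotopy h a) + totalHomotopy h (R.differential a) =
      f.total a - g.total a := by
  have h0' : ∀ p (σ : (R.sheaf 0).barGroup p), (h 0).bar p ((R.d 0).bar p σ) =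
      (f.hom 0).bar p σ - (g.hom 0).bar p σ := fun p σ =>
    Subtype.ext (funext fun F => h0 _ (σ.1 F))
  have hs' : ∀ p q (σ : (R.sheaf (q + 1)).barGroup p),
      (h (q + 1)).bar p ((R.d (q + 1)).bar p σ) =
        (f.hom (q + 1)).bar p σ - (g.hom (q + 1)).bar p σ - (R'.d q).bar p ((h q).bar p σ) :=
    fun p q σ => Subtype.ext (funext fun F => eq_sub_of_add_eq (hs q _ (σ.1 F)))
  induction a using R.total_induction with
  | h0 => simp
  | hadd a b ha hb =>
    simp only [map_add]
    rw [add_add_add_comm, ha, hb]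
    abel
  | hof p q σ =>
    cases p with
    | zero =>
      cases q with
      | zero =>
        rw [totalHomotopy_ofTerm_zero, R.differential_ofTerm_zero, totalHomotopy_ofTerm_succ, h0',
          f.total_ofTerm, g.total_ofTerm, map_zero, zero_add, pow_zero, one_smul, map_sub]
      | succ q =>
        rw [totalHomotopy_ofTerm_succ, R.differential_ofTerm_zero, totalHomotopy_ofTerm_succ, hs',
          f.total_ofTerm, g.total_ofTerm, pow_zero, one_smul, one_smul,
          R'.differential_ofTerm_zero, map_sub, map_sub]
        abel
    | succ p =>
      cases q with
      | zero =>
        rw [totalHomotopy_ofTerm_zero, R.differential_ofTerm_succ, map_add, map_zsmul,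
          totalHomotopy_ofTerm_zero, totalHomotopy_ofTerm_succ, neg_one_pow_smul_smul, h0',
          f.total_ofTerm, g.total_ofTerm, map_zero, zero_add, zero_add, map_sub]
      | succ q =>
        rw [totalHomotopy_ofTerm_succ, R.differential_ofTerm_succ, map_add, map_zsmul, map_zsmul,
          totalHomotopy_ofTerm_succ, totalHomotopy_ofTerm_succ, neg_one_pow_smul_smul, hs',
          f.total_ofTerm, g.total_ofTerm, R'.differential_ofTerm_succ, smul_add,
          neg_one_pow_smul_smul, GSheafHom.bar_barDifferential, map_sub, map_sub, pow_succ,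
          mul_neg_one, neg_smul]
        abel

/-- Homotopic morphisms agree on homology. -/
theorem mapHomology_eq_of_homotopy
    (h0 : ∀ x e, (h 0).app x ((R.d 0).app x e) = (f.hom 0).app x e - (g.hom 0).app x e)
    (hs : ∀ q x e, (h (q + 1)).app x ((R.d (q + 1)).app x e) + (R'.d q).app x ((h q).app x e) =
      (f.hom (q + 1)).app x e - (g.hom (q + 1)).app x e) (n : ℤ) :
    f.mapHomology n = g.mapHomology n := by
  refine AddMonoidHom.ext fun c => ?_
  obtain ⟨a, rfl⟩ := QuotientAddGroup.mk_surjective c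
  change (QuotientAddGroup.mk (f.mapCycles n a) : R'.Homology n) =
    QuotientAddGroup.mk (g.mapCycles n a)
  rw [QuotientAddGroup.eq_iff_sub_mem]
  refine ⟨totalHomotopy h a.1, totalHomotopy_mem_chains h a.2.1, ?_⟩
  have h1 := totalHomotopy_spec h0 hs a.1
  have h2 : R.differential a.1 = 0 := a.2.2
  rw [h2, map_zero, add_zero] at h1
  exact h1

end Homotopy

end

/-! ### Independence of the resolution -/

section

variable {X : Type u} [Groupoid.{u} X] [TopologicalSpace X] [TopologicalSpace (Arrows X)]
  [IsEtaleGroupoid X] [T2Space (Arrows X)] {A : GSheaf.{u, w} X} {R R' : CSoftResolution A}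

section QuasiIso

variable [CompactSpace X] (f : ResolutionHom R R')

/-- The top column of a cycle of the mapping cone is a boundary. -/
lemma exists_column_lift {n : ℤ} {N : ℕ} {b : R.Total} {a : R'.Total} (hb : b ∈ R.chains (n - 1))
    (ha : a ∈ R'.chains n) (hbN : ∀ p q, N < p → b (p, q) = 0) (haN : ∀ p q, N < p → a (p, q) = 0)
    (hDb : R.differential b = 0) (hfb : f.total b = R'.differential a) :
    ∃ b' ∈ R.chains n, ∃ a' ∈ R'.chains (n + 1), (∀ p q, N < p → b' (p, q) = 0) ∧
      (∀ p q, N < p → a' (p, q) = 0) ∧ (∀ q, (R.differential b') (N, q) = b (N, q)) ∧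
      ∀ q, f.total b' (N, q) - (R'.differential a') (N, q) = a (N, q) := by
  have : T2Space X := Strings.t2Space_base X
  -- Nothing enters column `N` from column `N + 1`, so there the equations `D b = 0` and `f b = D a`
  -- involve vertical maps only: up to the sign `(-1)ᴺ`, the column is a cocycle of the cone of
  -- sheaves.
  have hd : ∀ q, (R.d q).bar N (b (N, q)) = 0 := by
    intro q
    have h1 := congrArg (fun c : R.Total => c (N, q + 1)) hDb
    simp only [R.differential_apply_succ, hbN (N + 1) (q + 1) (by lia), map_zero, zero_add] at h1
    have h2 := congrArg (fun c => (-1 : ℤ) ^ N • c) h1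
    simpa only [neg_one_pow_smul_smul, DirectSum.zero_apply, smul_zero] using h2
  have hf0 : (f.hom 0).bar N (b (N, 0)) = 0 := by
    rw [← f.total_apply, hfb, R'.differential_apply_zero, haN _ _ (by lia), map_zero]
  have hfs : ∀ q, (f.hom (q + 1)).bar N (b (N, q + 1)) =
      (R'.d q).bar N ((-1 : ℤ) ^ N • a (N, q)) := by
    intro q
    rw [← f.total_apply, hfb, R'.differential_apply_succ, haN _ _ (by lia), map_zero, zero_add,
      map_zsmul]
  have hb0 : b (N, 0) = 0 := Subtype.ext (funext fun F =>
    eq_zero_of_coneHomZero f (congrFun (congrArg Subtype.val (hd 0)) F)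
      (congrFun (congrArg Subtype.val hf0) F))
  -- Column `N` has a term of total degree `n` only in row `m = N - n`. If `N < n`, then `a`
  -- vanishes in this column, and `b` can be nonzero at most in row `0`, where `hb0` applies.
  by_cases hm : ∃ m : ℕ, (N : ℤ) - m = n
  swap
  · push Not at hm
    refine ⟨0, zero_mem _, 0, zero_mem _, fun _ _ _ => rfl, fun _ _ _ => rfl, fun q => ?_,
      fun q => ?_⟩
    · rw [map_zero]
      cases q with
      | zero => exact hb0.symm
      | succ q => exact (hb _ _ (by have := hm q; push_cast; lia)).symm
    · rw [map_zero, map_zero, ha _ _ (hm q)]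
      exact sub_self _
  obtain ⟨m, hm⟩ := hm
  -- In row `0` the cone consists of the sheaf of `R` alone, so no correction `a'` is available or
  -- needed; in higher rows `a'` is the second component of the lift.
  have key : ∃ (β : (R.sheaf m).barGroup N) (a' : R'.Total), a' ∈ R'.chains (n + 1) ∧
      (∀ p q, N < p → a' (p, q) = 0) ∧ (R.d m).bar N β = b (N, m + 1) ∧
      (-1 : ℤ) ^ N • (f.hom m).bar N β - (R'.differential a') (N, m) = a (N, m) := by
    cases m with
    | zero =>
      obtain ⟨β, h1, h2⟩ := exists_cone_lift_zero f Strings.isLocalHomeomorph_vertex_zero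
        (b (N, 1)) ((-1 : ℤ) ^ N • a (N, 0)) (hd 1) (hfs 0)
      refine ⟨β, 0, zero_mem _, fun _ _ _ => rfl, h1, ?_⟩
      rw [map_zero, DirectSum.zero_apply, sub_zero]
      exact (congrArg ((-1 : ℤ) ^ N • ·) h2).trans (neg_one_pow_smul_smul _ _)
    | succ m =>
      obtain ⟨β, α, h1, h2⟩ := exists_cone_lift_succ f Strings.isLocalHomeomorph_vertex_zero m
        (b (N, m + 2)) ((-1 : ℤ) ^ N • a (N, m + 1)) (hd _) (hfs _)
      refine ⟨β, R'.ofTerm N m α, R'.ofTerm_mem_chains N m (by push_cast at hm; lia) α,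
        fun p q hp => R'.ofTerm_ne (fun e => ?_) α, h1, ?_⟩
      · obtain ⟨rfl, -⟩ := Prod.mk.inj e
        exact lt_irrefl _ hp
      · rw [R'.differential_apply_succ, R'.ofTerm_same, R'.ofTerm_ne (by simp), map_zero,
          zero_add, ← smul_sub]
        exact (congrArg ((-1 : ℤ) ^ N • ·) h2).trans (neg_one_pow_smul_smul _ _)
  obtain ⟨β, a', ha', ha'N, h1, h2⟩ := key
  have hb' : (-1 : ℤ) ^ N • R.ofTerm N m β ∈ R.chains n :=
    zsmul_mem (R.ofTerm_mem_chains N m hm β) _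
  refine ⟨(-1 : ℤ) ^ N • R.ofTerm N m β, hb', a', ha', fun p q hp => ?_, ha'N, fun q => ?_,
    fun q => ?_⟩
  · rw [CSoftResolution.zsmul_apply, R.ofTerm_ne (fun e => ?_) β, smul_zero]
    obtain ⟨rfl, -⟩ := Prod.mk.inj e
    exact lt_irrefl _ hp
  · by_cases hq : (N : ℤ) - q = n - 1
    · obtain rfl : q = m + 1 := by lia
      rw [R.differential_apply_succ, CSoftResolution.zsmul_apply, CSoftResolution.zsmul_apply,
        R.ofTerm_same, R.ofTerm_ne (by simp), smul_zero, map_zero, zero_add, map_zsmul,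
        neg_one_pow_smul_smul, h1]
    · rw [R.differential_mem_chains hb' _ _ hq, hb _ _ hq]
  · by_cases hq : (N : ℤ) - q = n
    · obtain rfl : q = m := by lia
      rw [f.total_apply, CSoftResolution.zsmul_apply, R.ofTerm_same, map_zsmul, h2]
    · rw [f.total_mem_chains hb' _ _ hq, ha _ _ hq,
        R'.differential_mem_chains ha' _ _ (by simpa using hq), sub_zero]

/-- The mapping cone of a morphism of resolutions has no homology. -/
lemma exists_cone_boundary {n : ℤ} (N : ℕ) {b : R.Total} {a : R'.Total}
    (hb : b ∈ R.chains (n - 1)) (ha : a ∈ R'.chains n) (hbN : ∀ p q, N ≤ p → b (p, q) = 0)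
    (haN : ∀ p q, N ≤ p → a (p, q) = 0) (hDb : R.differential b = 0)
    (hfb : f.total b = R'.differential a) :
    ∃ b' ∈ R.chains n, ∃ a' ∈ R'.chains (n + 1), R.differential b' = b ∧
      f.total b' - R'.differential a' = a := by
  induction N generalizing b a with
  | zero =>
    obtain rfl : b = 0 := DFinsupp.ext fun pq => hbN pq.1 pq.2 (Nat.zero_le _)
    obtain rfl : a = 0 := DFinsupp.ext fun pq => haN pq.1 pq.2 (Nat.zero_le _)
    exact ⟨0, zero_mem _, 0, zero_mem _, by simp, by simp⟩
  | succ N ih =>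
    obtain ⟨b₁, hb₁, a₁, ha₁, hb₁N, ha₁N, hbd, had⟩ := exists_column_lift f hb ha hbN haN hDb hfb
    have hD : ∀ {R : CSoftResolution A} {c : R.Total}, (∀ p q, N < p → c (p, q) = 0) →
        ∀ p q, N < p → (R.differential c) (p, q) = 0 := by
      intro R c hc p q hp
      cases q with
      | zero => rw [R.differential_apply_zero, hc _ _ (by lia), map_zero]
      | succ q =>
        rw [R.differential_apply_succ, hc _ _ (by lia), hc _ _ hp, map_zero, map_zero, smul_zero,
          add_zero]
    -- Subtracting the boundary of `(b₁, a₁)` in the cone removes column `N` and creates nothing to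
    -- its right, so the induction hypothesis applies to the difference.
    obtain ⟨b₂, hb₂, a₂, ha₂, h1, h2⟩ := ih (b := b - R.differential b₁)
      (a := a - (f.total b₁ - R'.differential a₁))
      (sub_mem hb (R.differential_mem_chains hb₁))
      (sub_mem ha (sub_mem (f.total_mem_chains hb₁)
        (by simpa using R'.differential_mem_chains ha₁)))
      (fun p q hp => by
        rw [DirectSum.sub_apply]
        rcases hp.eq_or_lt with rfl | hp
        · rw [hbd, sub_self]
        · rw [hbN p q hp, hD hb₁N p q hp, sub_zero])
      (fun p q hp => by
        rw [DirectSum.sub_apply, DirectSum.sub_apply]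
        rcases hp.eq_or_lt with rfl | hp
        · rw [had, sub_self]
        · rw [haN p q hp, f.total_apply, hb₁N p q hp, hD ha₁N p q hp, map_zero, sub_zero, sub_zero])
      (by rw [map_sub, hDb, R.differential_differential, sub_zero])
      (by rw [map_sub, map_sub, map_sub, hfb, R'.differential_differential, f.total_differential,
        sub_zero])
    refine ⟨b₁ + b₂, add_mem hb₁ hb₂, a₁ + a₂, add_mem ha₁ ha₂, ?_, ?_⟩
    · rw [map_add, h1, add_sub_cancel]
    · rw [map_add, map_add, add_sub_add_comm, h2, add_sub_cancel]

/-- Morphisms of resolutions induce isomorphisms on homology. -/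
theorem mapHomology_bijective (n : ℤ) : Function.Bijective (f.mapHomology n) := by
  constructor
  · refine (injective_iff_map_eq_zero _).mpr fun c hc => ?_
    obtain ⟨b, rfl⟩ := QuotientAddGroup.mk_surjective c
    obtain ⟨a, ha, hab⟩ := (QuotientAddGroup.eq_zero_iff (f.mapCycles n b)).mp hc
    obtain ⟨N, hN⟩ := R.exists_bound b.1
    obtain ⟨N', hN'⟩ := R'.exists_bound a
    -- If `f b = D a`, then `(b, a)` is a cycle of the cone, and a chain that bounds it contains a
    -- chain that bounds `b`.
    obtain ⟨b', hb', -, -, h1, -⟩ := exists_cone_boundary f (n := n + 1) (max N N') (b := b.1)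
      (a := a) (by simpa using b.2.1) ha (fun p q h => hN p q (le_of_max_le_left h))
      (fun p q h => hN' p q (le_of_max_le_right h)) b.2.2 hab.symm
    exact (QuotientAddGroup.eq_zero_iff b).mpr ⟨b', hb', h1⟩
  · intro c
    obtain ⟨a, rfl⟩ := QuotientAddGroup.mk_surjective c
    obtain ⟨N, hN⟩ := R'.exists_bound a.1
    have hDa : R'.differential a.1 = 0 := a.2.2
    -- For a cycle `a`, the pair `(0, a)` is a cycle of the cone; a chain `(b', a')` that bounds it
    -- provides a cycle `b'` whose image is homologous to `a`.
    obtain ⟨b', hb', a', ha', h1, h2⟩ := exists_cone_boundary f (n := n) N (b := 0) (a := a.1)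
      (zero_mem _) a.2.1 (fun _ _ _ => rfl) hN (map_zero _) (by rw [map_zero, hDa])
    refine ⟨QuotientAddGroup.mk ⟨b', hb', h1⟩, ?_⟩
    change (QuotientAddGroup.mk (f.mapCycles n ⟨b', hb', h1⟩) : R'.Homology n) =
      QuotientAddGroup.mk a
    rw [QuotientAddGroup.eq_iff_sub_mem]
    refine ⟨a', ha', ?_⟩
    change R'.differential a' = f.total b' - a.1
    rw [← h2, sub_sub_cancel]

end QuasiIso

section Independence

variable [CompactSpace X] (A : GSheaf.{u, 0} X)

/-- Every `c`-soft resolution computes the homology of the groupoid. -/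
theorem groupoidHomology_bijective (n : ℤ) (R : CSoftResolution A) :
    Function.Bijective fun c : groupoidHomology A n => c.1 R := by
  let I := injectiveResolution A
  have φ : ∀ R, ResolutionHom R I := fun R => (exists_hom_injectiveResolution A R).some
  -- The isomorphism of each homology group with that of `I` is canonical, since any two morphisms
  -- to `I` are homotopic.
  have huniq : ∀ {R} (f g : ResolutionHom R I), f.mapHomology n = g.mapHomology n := by
    intro R f g
    obtain ⟨h, h0, hs⟩ := exists_homotopy f g (isInjective_injectiveResolution A)
    exact mapHomology_eq_of_homotopy h0 hs n
  constructor
  · intro c c' (hcc : c.1 R = c'.1 R)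
    refine Subtype.ext (funext fun R' => (mapHomology_bijective (φ R') n).1 ?_)
    rw [c.2 R' I, c'.2 R' I, ← c.2 R I (φ R), ← c'.2 R I (φ R), hcc]
  · intro e
    -- The family is obtained by transporting the image of `e` in the homology of `I` back to every
    -- resolution.
    choose ψ hψ using fun R' => (mapHomology_bijective (φ R') n).2 ((φ R).mapHomology n e)
    refine ⟨⟨ψ, fun R₁ R₂ g => (mapHomology_bijective (φ R₂) n).1 ?_⟩,
      (mapHomology_bijective (φ R) n).1 (hψ R)⟩
    rw [hψ]
    -- Compatibility with `g` holds because `φ R₂` after `g` is another morphism from `R₁` to `I`,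
    -- so it agrees with `φ R₁` on homology.
    let k : ResolutionHom R₁ I :=
      { hom := fun q => ((φ R₂).hom q).comp (g.hom q)
        hom_augmentation := fun x e => by
          rw [GSheafHom.comp_app, g.hom_augmentation, (φ R₂).hom_augmentation]
        hom_d := fun q x e => by
          rw [GSheafHom.comp_app, g.hom_d, (φ R₂).hom_d, GSheafHom.comp_app] }
    have hk : ∀ c, (φ R₂).mapHomology n (g.mapHomology n c) = k.mapHomology n c := by
      intro c
      obtain ⟨a, rfl⟩ := QuotientAddGroup.mk_surjective c
      refine congrArg QuotientAddGroup.mk (Subtype.ext ?_)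
      change (φ R₂).total (g.total a.1) = k.total a.1
      refine DFinsupp.ext fun pq => ?_
      obtain ⟨p, q⟩ := pq
      rw [(φ R₂).total_apply, g.total_apply, k.total_apply]
      rfl
    rw [hk, huniq k (φ R₁), hψ]

end Independence

end

/-! ### Sub-`𝒢`-sheaves -/

namespace GSheaf

section Subsheaf

variable {X : Type u} [Groupoid.{u} X] [TopologicalSpace X] [TopologicalSpace (Arrows X)]
  (S : GSheaf.{u, w} X) (H : ∀ x, AddSubgroup (S.stalk x))
  (hH : ∀ {x s}, S.toLoc.sec x s → s x ∈ H x → ∀ᶠ y in 𝓝 x, s y ∈ H y)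
  (hact : ∀ {x y : X} (g : x ⟶ y) (e : S.stalk x), e ∈ H x → S.act g e ∈ H y)

/-- A section of `S` with nearby values in `H` becomes a function to `H`, with `0` where the value
lies outside. -/
lemma exists_sec_of_eventually_mem {x : X} {s : ∀ x, S.stalk x} (hs : S.toLoc.sec x s)
    (h : ∀ᶠ y in 𝓝 x, s y ∈ H y) :
    ∃ t : ∀ x, H x, S.toLoc.sec x (fun y => (t y).1) ∧ ∀ᶠ y in 𝓝 x, (t y).1 = s y := by
  classical
  let t : ∀ x, H x := fun y => if hy : s y ∈ H y then ⟨s y, hy⟩ else 0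
  have ht : ∀ᶠ y in 𝓝 x, (t y).1 = s y := h.mono fun y hy => by simp [t, hy]
  exact ⟨t, S.toLoc.sec_congr hs (ht.mono fun _ e => e.symm), ht⟩

variable [IsEtaleGroupoid X]

/-- The sub-`𝒢`-sheaf with given stalks. -/
def subsheaf : GSheaf.{u, w} X :=
  GSheaf.ofLoc IsEtaleGroupoid.isLocalHomeomorph_range.continuous
    { stalk := fun x => H x
      sec := fun x s => S.toLoc.sec x (fun y => (s y).1)
      sec_congr := fun h e => S.toLoc.sec_congr h (e.mono fun _ h => congrArg _ h)
      sec_eventually := fun h => S.toLoc.sec_eventually h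
      sec_sub := fun h h' => S.toLoc.sec_sub h h'
      exists_sec := fun x e => by
        obtain ⟨s, hs, h⟩ := S.toLoc.exists_sec x e.1
        obtain ⟨t, ht, hts⟩ := S.exists_sec_of_eventually_mem H hs (hH hs (by rw [h]; exact e.2))
        exact ⟨t, ht, Subtype.ext (hts.self_of_nhds.trans h)⟩
      eventually_zero := fun h e => (S.toLoc.eventually_zero h (congrArg Subtype.val e)).mono
        fun _ h => Subtype.ext h }
    (fun {x y} g => ((S.act g).comp (H x).subtype).codRestrict (H y) fun e => hact g e.1 e.2)
    (fun x e => Subtype.ext (S.act_id x e.1))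
    (fun g h e => Subtype.ext (S.act_comp g h e.1))
    (fun a s hs => by
      obtain ⟨t, ht, hst⟩ := S.exists_sec_act a hs
      have h1 : ∀ᶠ y in 𝓝 a.range, t y ∈ H y := hH ht (by
        rw [← hst.self_of_nhds]
        exact hact _ _ (s a.source).2)
      obtain ⟨t', ht', h2⟩ := S.exists_sec_of_eventually_mem H ht h1
      refine ⟨t', ht', ?_⟩
      filter_upwards [hst, IsEtaleGroupoid.isLocalHomeomorph_range.continuous.continuousAt.eventually
        h2] with b hb hb'
      exact Subtype.ext (hb.trans hb'.symm))

variable {S H hH hact}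

lemma subsheaf_sec {x : X} {s : ∀ x, (S.subsheaf H hH hact).stalk x} :
    (S.subsheaf H hH hact).toLoc.sec x s ↔
      S.toLoc.sec x (fun y => (show H y from s y).1) := ofLoc_sec

variable (S H hH hact) in
/-- The inclusion of a sub-`𝒢`-sheaf. -/
def subsheafHom : GSheafHom (S.subsheaf H hH hact) S :=
  GSheafHom.ofSec (fun x => (H x).subtype) (fun _ _ h => subsheaf_sec.mp h) fun _ _ => rfl

/-- A morphism of `𝒢`-sheaves with values in a sub-`𝒢`-sheaf. -/
def codRestrict {T : GSheaf.{u, w'} X} (φ : GSheafHom T S) (h : ∀ x e, φ.app x e ∈ H x) :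
    GSheafHom T (S.subsheaf H hH hact) :=
  GSheafHom.ofSec (fun x => (φ.app x).codRestrict (H x) (h x))
    (fun _ _ hs => subsheaf_sec.mpr (φ.map_sec hs)) fun g e => Subtype.ext (φ.app_act g e)

end Subsheaf

end GSheaf

/-! ### Borel functions with values in a subgroup, and Borel resolutions -/

section BorelSheaves

variable {X : Type u} [TopologicalSpace X] [MeasurableSpace X]

/-- The germs of `V`-valued functions. -/
def valuedGerms (V : AddSubgroup ℂ) (x : X) : AddSubgroup (borelGerms x) where
  carrier := {γ | γ.1.LiftPred (· ∈ V)}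
  zero_mem' := Eventually.of_forall fun _ => V.zero_mem
  add_mem' := by
    rintro ⟨_, U, f, hU, hx, hf, rfl⟩ ⟨_, U', f', hU', hx', hf', rfl⟩ h h'
    exact (Filter.Eventually.and h h').mono fun _ h => V.add_mem h.1 h.2
  neg_mem' := by
    rintro ⟨_, U, f, hU, hx, hf, rfl⟩ h
    exact Eventually.mono h fun _ h => V.neg_mem h

lemma value_mem_of_mem_valuedGerms {V : AddSubgroup ℂ} {x : X} {γ : borelGerms x}
    (h : γ ∈ valuedGerms V x) : γ.1.value ∈ V := by
  obtain ⟨_, U, f, hU, hx, hf, rfl⟩ := γ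
  exact Eventually.self_of_nhds (p := fun y => f y ∈ V) h

lemma mem_valuedGerms_of_coe_eq {V : AddSubgroup ℂ} {x : X} {γ : borelGerms x} {f : X → ℂ}
    (h : γ.1 = ↑f) (hf : ∀ᶠ y in 𝓝 x, f y ∈ V) : γ ∈ valuedGerms V x := by
  change γ.1.LiftPred (· ∈ V)
  rw [h]
  exact hf

lemma mem_valuedGerms_top {x : X} (γ : borelGerms x) : γ ∈ valuedGerms ⊤ x := by
  obtain ⟨_, U, f, hU, hx, hf, rfl⟩ := γ
  exact Eventually.of_forall fun _ => trivial

lemma value_eq_of_coe_eq {x : X} {γ : borelGerms x} {f : X → ℂ} (h : γ.1 = ↑f) :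
    γ.1.value = f x := by rw [h]; rfl

variable [Groupoid.{u} X] [TopologicalSpace (Arrows X)] [BorelSpace X] [IsEtaleGroupoid X]

/-- Continuity into the space of germs means that, near `x`, all germs are those of one Borel
function, namely any representative of the germ at `x`. -/
lemma borelSheaf_sec_iff {x : X} {s : ∀ x, (borelSheaf X).stalk x} :
    (borelSheaf X).toLoc.sec x s ↔ ∃ U f, IsOpen U ∧ x ∈ U ∧ IsBorelSection U f ∧
      ∀ y ∈ U, (show borelGerms y from s y).1 = ↑f := by
  constructor
  · intro h
    obtain ⟨f, hx, hf⟩ := BorelSection.exists_germ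
      (⟨x, s x⟩ : EtaleSpace (fun x : X => borelGerms x))
    have h1 := f.eventually_eq_germ ⟨x, hx⟩
    rw [hf] at h1
    obtain ⟨N, hN, hNo, hxN⟩ := eventually_nhds_iff.mp (Filter.Tendsto.eventually h h1)
    refine ⟨N ∩ f.dom, f.toFun, hNo.inter f.isOpen_dom, ⟨hxN, hx⟩,
      f.isBorelSection.mono Set.inter_subset_right, fun y hy => ?_⟩
    obtain ⟨hy', e⟩ := hN y hy.1
    exact congrArg Subtype.val (borelGerms_mk_inj e)
  · rintro ⟨U, f, hU, hx, hf, h⟩ W hW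
    let φ : BorelSection X := ⟨U, f, hU, hf⟩
    have h1 : ∀ y (hy : y ∈ U), φ.germ ⟨y, hy⟩ = ⟨y, s y⟩ := fun y hy =>
      congrArg (EtaleSpace.mk y) (Subtype.ext (h y hy).symm)
    have h2 := φ.eventually_germ_mem ⟨x, hx⟩ (W := W) (by rw [h1]; exact hW)
    refine Filter.mem_map.mpr ?_
    filter_upwards [h2, hU.mem_nhds hx] with y hy hyU
    have := hy hyU
    rwa [h1] at this

lemma eventually_mem_valuedGerms (V : AddSubgroup ℂ) {x : X} {s : ∀ x, (borelSheaf X).stalk x}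
    (h : (borelSheaf X).toLoc.sec x s) (hx : s x ∈ valuedGerms V x) :
    ∀ᶠ y in 𝓝 x, s y ∈ valuedGerms V y := by
  obtain ⟨U, f, hU, hxU, hf, h1⟩ := borelSheaf_sec_iff.mp h
  have h2 : ∀ᶠ y in 𝓝 x, f y ∈ V := by
    have : (show borelGerms x from s x).1.LiftPred (· ∈ V) := hx
    rwa [h1 x hxU] at this
  filter_upwards [h2.eventually_nhds, hU.mem_nhds hxU] with y hy hyU
  exact mem_valuedGerms_of_coe_eq (h1 y hyU) hy

lemma borelAct_mem_valuedGerms (V : AddSubgroup ℂ) {x y : X} (g : x ⟶ y) (γ : borelGerms x)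
    (h : γ ∈ valuedGerms V x) : borelAct g γ ∈ valuedGerms V y := by
  obtain ⟨_, U, f, hU, hx, hf, rfl⟩ := γ
  exact (tendsto_theta ⟨x, y, g⟩).eventually h

lemma value_borelAct {x y : X} (g : x ⟶ y) (γ : borelGerms x) :
    (borelAct g γ).1.value = γ.1.value := by
  obtain ⟨_, U, f, hU, hx, hf, rfl⟩ := γ
  exact congrArg f (theta_range (self_mem_bisec ⟨x, y, g⟩))

variable (X) in
/-- The `𝒢`-sheaf of `V`-valued Borel functions that are bounded on compact sets. -/
noncomputable def valuedBorelSheaf (V : AddSubgroup ℂ) : GSheaf.{u, u} X :=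
  (borelSheaf X).subsheaf (valuedGerms V) (eventually_mem_valuedGerms V)
    (borelAct_mem_valuedGerms V)

-- Take the function of values of the germs and set it to `0` outside an open `W` with `K ⊆ W` and
-- closure in `U`. Near points of `U` it is a representative times the indicator of `W`, hence Borel
-- and locally bounded; near the other points it is `0`. Values stay in `V` because `0 ∈ V`.
open Classical in
lemma isCSoft_valuedBorelSheaf [T2Space X] [CompactSpace X] (V : AddSubgroup ℂ) :
    (valuedBorelSheaf X V).IsCSoft := by
  intro K U s hK hU hKU hs
  have hs' : ∀ x ∈ U, (borelSheaf X).toLoc.sec x (fun y => (show valuedGerms V y from s y).1) :=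
    fun x hx => GSheaf.subsheaf_sec.mp ((GSheaf.isSectionOn_iff hU).mp hs x hx)
  obtain ⟨W, hW, hKW, hWU⟩ := normal_exists_closure_subset hK.isClosed hU hKU
  let f : X → ℂ := fun y => (show valuedGerms V y from s y).1.1.value
  let g : X → ℂ := fun y => if y ∈ W then f y else 0
  have hgV : ∀ y, g y ∈ V := by
    intro y
    by_cases hy : y ∈ W
    · simpa only [g, if_pos hy] using! value_mem_of_mem_valuedGerms (show valuedGerms V y from s y).2
    · simp only [g, if_neg hy, V.zero_mem]
  have hg : ∀ y, ∃ N, IsOpen N ∧ y ∈ N ∧ IsBorelSection N g := by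
    intro y
    by_cases hy : y ∈ U
    · obtain ⟨N, h, hN, hyN, hh, e⟩ := borelSheaf_sec_iff.mp (hs' y hy)
      have hgh : ∀ z ∈ N, g z = W.indicator h z := fun z hz => by
        by_cases hzW : z ∈ W
        · simp only [g, f, if_pos hzW, Set.indicator_of_mem hzW]
          exact value_eq_of_coe_eq (e z hz)
        · simp only [g, if_neg hzW, Set.indicator_of_notMem hzW]
      refine ⟨N, hN, hyN, ?_, fun L hL hLc => ?_⟩
      · have h1 : (fun z : N => g z) = (Subtype.val ⁻¹' W : Set N).indicator fun z : N => h z := by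
          funext z
          exact hgh z.1 z.2
        rw [h1]
        exact hh.1.indicator (hW.measurableSet.preimage measurable_subtype_coe)
      · obtain ⟨C, hC⟩ := hh.2 L hL hLc
        refine ⟨C, fun z hz => ?_⟩
        rw [hgh z (hL hz)]
        exact (norm_indicator_le_norm_self _ _).trans (hC z hz)
    · have h0 : ∀ z ∈ (closure W)ᶜ, g z = 0 := fun z hz => if_neg fun h => hz (subset_closure h)
      refine ⟨(closure W)ᶜ, isClosed_closure.isOpen_compl, fun h => hy (hWU h), ?_, fun L hL _ =>
        ⟨0, fun z hz => by rw [h0 z (hL hz), norm_zero]⟩⟩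
      have h1 : (fun z : ((closure W)ᶜ : Set X) => g z) = fun _ => 0 :=
        funext fun z => h0 z.1 z.2
      rw [h1]
      exact measurable_const
  choose N hN hyN hNg using hg
  let t : ∀ y, (valuedBorelSheaf X V).stalk y := fun y =>
    (⟨⟨↑g, N y, g, hN y, hyN y, hNg y, rfl⟩, mem_valuedGerms_of_coe_eq rfl (.of_forall hgV)⟩ :
      valuedGerms V y)
  refine ⟨W, t, hW, hKW, subset_closure.trans hWU, GSheaf.isSectionOn_univ_iff.mpr fun y => ?_,
    fun y hy => ?_⟩
  · exact GSheaf.subsheaf_sec.mpr (borelSheaf_sec_iff.mpr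
      ⟨N y, g, hN y, hyN y, hNg y, fun z _ => rfl⟩)
  · obtain ⟨N', h, hN', hyN', hh, e⟩ := borelSheaf_sec_iff.mp
      (hs' y (hWU (subset_closure hy)))
    refine Subtype.ext (Subtype.ext ?_)
    refine Eq.trans ?_ (e y hyN').symm
    refine Filter.Germ.coe_eq.mpr ?_
    filter_upwards [hN'.mem_nhds hyN', hW.mem_nhds hy] with z hz hzW
    simp only [g, f, if_pos hzW]
    exact value_eq_of_coe_eq (e z hz)

lemma constToBorel_injective (x : X) : Function.Injective ((constToBorel X).app x) := by
  intro m n h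
  have h1 := congrArg (fun γ : borelGerms x => γ.1.value) h
  exact Int.cast_injective (α := ℂ) h1

variable (X) in
/-- The Borel resolution that continues the inclusion of the integers in the sheaf of `V`-valued
Borel functions. -/
noncomputable def borelResolution [T2Space X] [CompactSpace X] (V : AddSubgroup ℂ)
    (hV : ∀ n : ℤ, (n : ℂ) ∈ V) : BorelResolution X where
  toCSoftResolution := resolve
    (GSheaf.codRestrict (hH := eventually_mem_valuedGerms V) (hact := borelAct_mem_valuedGerms V)
      (constToBorel X) fun _ n => mem_valuedGerms_of_coe_eq rfl (.of_forall fun _ => hV n))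
    (fun x _ _ h => constToBorel_injective x (congrArg Subtype.val h))
    (isCSoft_valuedBorelSheaf V)
  inclusion := (borelSheaf X).subsheafHom (valuedGerms V) (eventually_mem_valuedGerms V)
    (borelAct_mem_valuedGerms V)
  inclusion_injective _ := Subtype.val_injective
  inclusion_augmentation _ _ := rfl

variable [T2Space (Arrows X)]

lemma baseFunction_borelResolution_mem [T2Space X] [CompactSpace X] {V : AddSubgroup ℂ}
    {hV : ∀ n : ℤ, (n : ℂ) ∈ V} (a : (borelResolution X V hV).Total) (x : X) :
    (borelResolution X V hV).baseFunction a x ∈ V :=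
  value_mem_of_mem_valuedGerms
    (show valuedGerms V x from (a (0, 0)).1 (Strings.ofBase x)).2

/-- Every Borel resolution maps to the one by all Borel functions. -/
lemma exists_hom_borelResolution [T2Space X] [CompactSpace X] (B : BorelResolution X) :
    ∃ f : ResolutionHom B.toCSoftResolution
        (borelResolution X ⊤ fun _ => trivial).toCSoftResolution,
      ∀ a x, (borelResolution X ⊤ fun _ => trivial).baseFunction (f.total a) x =
        B.baseFunction a x := by
  -- The target is injective only in positive degrees, so the morphism in degree `0` is prescribed:
  -- it is the inclusion in `𝓑`, which is also why values, and with them `a₀`, are preserved.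
  let f₀ : GSheafHom (B.sheaf 0) (valuedBorelSheaf X ⊤) :=
    GSheaf.codRestrict B.inclusion fun _ _ => mem_valuedGerms_top _
  obtain ⟨f, hf⟩ := exists_resolutionHom (R := B.toCSoftResolution)
    (R' := (borelResolution X ⊤ fun _ => trivial).toCSoftResolution) f₀
    (fun x n => Subtype.ext (B.inclusion_augmentation x n))
    (isInjective_resolve_succ _ _ (isCSoft_valuedBorelSheaf ⊤))
  refine ⟨f, fun a x => ?_⟩
  have h1 : (f.total a (0, 0)).1 (Strings.ofBase x) =
      f₀.app x ((a (0, 0)).1 (Strings.ofBase x)) := by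
    rw [f.total_apply]
    change (f.hom 0).app _ _ = _
    rw [hf]
    rfl
  unfold BorelResolution.baseFunction
  rw [h1]
  rfl

end BorelSheaves

/-! ### Fibre sums and invariant measures -/

section FiberSums

variable {X : Type u} {Y : Type v}

/-- The sums of a function over the fibres of `t`. -/
noncomputable def fiberSum (t : Y → X) (b : Y → ℂ) (x : X) : ℂ := ∑ᶠ y : {y // t y = x}, b y

/-- Each fibre contains at most one point of `N`, so the sum has at most one nonzero term. This
turns integrals of fibre sums into integrals over `N` for the pulled back measure. -/
lemma fiberSum_eq_extend {t : Y → X} {N : Set Y} (ht : N.InjOn t) {b : Y → ℂ}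
    (hb : ∀ y ∉ N, b y = 0) :
    fiberSum t b = Function.extend (fun y : N => t y) (fun y : N => b y) 0 := by
  funext x
  by_cases h : ∃ y : N, t y = x
  · obtain ⟨y, rfl⟩ := h
    refine Eq.trans ?_ (ht.injective.extend_apply _ _ _).symm
    refine finsum_eq_single _ (⟨y.1, rfl⟩ : {z // t z = t y}) fun z hz => hb _ fun hzN => hz ?_
    exact Subtype.ext (ht hzN y.2 z.2)
  · rw [Function.extend_apply' _ _ _ h]
    exact finsum_eq_zero_of_forall_eq_zero fun y => hb _ fun hy => h ⟨⟨y.1, hy⟩, y.2⟩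

lemma finite_support_of_injOn {t : Y → X} {N : Set Y} (ht : N.InjOn t) {b : Y → ℂ}
    (hb : ∀ y ∉ N, b y = 0) (x : X) :
    (Function.support fun y : {y // t y = x} => b y).Finite := by
  refine Set.Subsingleton.finite fun y hy z hz => Subtype.ext (ht ?_ ?_ (y.2.trans z.2.symm))
  · by_contra h; exact hy (hb _ h)
  · by_contra h; exact hz (hb _ h)

lemma isOpenEmbedding_of_injOn [TopologicalSpace X] [TopologicalSpace Y] {t : Y → X} (ht : IsLocalHomeomorph t) {N : Set Y} (hN : IsOpen N)
    (hi : N.InjOn t) : IsOpenEmbedding fun y : N => t y :=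
  IsOpenEmbedding.of_continuous_injective_isOpenMap (ht.continuous.comp continuous_subtype_val)
    hi.injective (ht.isOpenMap.domRestrict hN)

/-- The restriction of `b` to `N` is measurable and bounded. -/
def IsBoundedMeasurableOn [MeasurableSpace Y] (b : Y → ℂ) (N : Set Y) : Prop :=
  Measurable (fun y : N => b y) ∧ ∃ C : ℝ, ∀ y ∈ N, ‖b y‖ ≤ C

lemma IsBoundedMeasurableOn.mono [MeasurableSpace Y] {b : Y → ℂ} {N M : Set Y} (h : IsBoundedMeasurableOn b N) (hMN : M ⊆ N) :
    IsBoundedMeasurableOn b M :=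
  ⟨h.1.comp (measurable_inclusion hMN), h.2.imp fun _ h y hy => h y (hMN hy)⟩

variable [MeasurableSpace X]

/-- The sums of `b` over the fibres of `t` and of `t'` are integrable and have the same
integral. -/
structure IsBalanced (μ : Measure X) (t t' : Y → X) (b : Y → ℂ) : Prop where
  finite_left : ∀ x, (Function.support fun y : {y // t y = x} => b y).Finite
  finite_right : ∀ x, (Function.support fun y : {y // t' y = x} => b y).Finite
  integrable_left : Integrable (fiberSum t b) μ
  integrable_right : Integrable (fiberSum t' b) μ
  integral_eq : ∫ x, fiberSum t b x ∂μ = ∫ x, fiberSum t' b x ∂μ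

/-- Finiteness of the supports on the fibres is part of `IsBalanced` because it makes `finsum`
additive. -/
lemma IsBalanced.add {μ : Measure X} {t t' : Y → X} {b c : Y → ℂ} (hb : IsBalanced μ t t' b)
    (hc : IsBalanced μ t t' c) : IsBalanced μ t t' (b + c) := by
  have h1 : fiberSum t (b + c) = fiberSum t b + fiberSum t c := funext fun x =>
    finsum_add_distrib (hb.finite_left x) (hc.finite_left x)
  have h2 : fiberSum t' (b + c) = fiberSum t' b + fiberSum t' c := funext fun x =>
    finsum_add_distrib (hb.finite_right x) (hc.finite_right x)
  refine ⟨fun x => ((hb.finite_left x).union (hc.finite_left x)).subset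
    (Function.support_add _ _), fun x => ((hb.finite_right x).union (hc.finite_right x)).subset
    (Function.support_add _ _), ?_, ?_, ?_⟩
  · rw [h1]; exact hb.integrable_left.add hc.integrable_left
  · rw [h2]; exact hb.integrable_right.add hc.integrable_right
  · rw [h1, h2, integral_add' hb.integrable_left hc.integrable_left,
      integral_add' hb.integrable_right hc.integrable_right, hb.integral_eq, hc.integral_eq]

lemma MeasurableEmbedding.integral_extend [MeasurableSpace Y] {i : Y → X}
    (hi : MeasurableEmbedding i) (μ : Measure X) (b : Y → ℂ) :
    ∫ x, Function.extend i b 0 x ∂μ = ∫ y, b y ∂(μ.comap i) := by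
  have h1 : ∀ y, Function.extend i b 0 (i y) = b y := fun y => hi.injective.extend_apply _ _ _
  rw [← setIntegral_eq_integral_of_forall_compl_eq_zero (s := Set.range i) fun x hx =>
    (Function.extend_apply' (g := b) (e' := 0) (f := i) x fun ⟨y, h⟩ => hx ⟨y, h⟩), ← hi.map_comap, hi.integral_map]
  simp_rw [h1]

lemma MeasurableEmbedding.integrable_extend [MeasurableSpace Y] {i : Y → X}
    (hi : MeasurableEmbedding i) (μ : Measure X) [IsFiniteMeasure μ] {b : Y → ℂ}
    (hb : Measurable b) {C : ℝ} (hC : ∀ y, ‖b y‖ ≤ C) : Integrable (Function.extend i b 0) μ := by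
  refine Integrable.of_bound (hi.measurable_extend hb measurable_const).aestronglyMeasurable
    (max C 0) (.of_forall fun x => ?_)
  by_cases h : ∃ y, i y = x
  · obtain ⟨y, rfl⟩ := h
    rw [hi.injective.extend_apply]
    exact (hC y).trans (le_max_left _ _)
  · rw [Function.extend_apply' _ _ _ h]
    simp

variable [TopologicalSpace X] [LocallyCompactSpace X] [BorelSpace X]
  [TopologicalSpace Y] [T2Space Y] [MeasurableSpace Y] [BorelSpace Y]

variable {μ : Measure X} [μ.Regular] {t t' : Y → X}
  (ht : IsLocalHomeomorph t) (ht' : IsLocalHomeomorph t')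
  (hinv : ∀ f : Y → ℂ, Continuous f → HasCompactSupport f →
    ∫ x, fiberSum t f x ∂μ = ∫ x, fiberSum t' f x ∂μ)

-- Both measures on `N` are regular, and by invariance, applied to functions supported in `N`, they
-- have the same integrals on continuous functions of compact support; such measures are equal.
include hinv ht ht' in
lemma comap_eq_comap {N : Set Y} (hN : IsOpen N) (hi : N.InjOn t) (hi' : N.InjOn t') :
    μ.comap (fun y : N => t y) = μ.comap (fun y : N => t' y) := by
  have h := isOpenEmbedding_of_injOn ht hN hi
  have h' := isOpenEmbedding_of_injOn ht' hN hi'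
  have : LocallyCompactSpace N := h.locallyCompactSpace
  have : (μ.comap (fun y : N => t y)).Regular := Measure.Regular.comap' μ h
  have : (μ.comap (fun y : N => t' y)).Regular := Measure.Regular.comap' μ h'
  refine Measure.ext_of_integral_eq_on_compactlySupported fun f => ?_
  let F : N → ℂ := fun y => (f y : ℂ)
  have hF : HasCompactSupport F := f.hasCompactSupport.comp_left Complex.ofReal_zero
  -- The extension by zero is continuous: the support of `F` is compact, hence closed in the
  -- Hausdorff space `Y`, so `G` vanishes near all points outside `N`.
  let G : Y → ℂ := Function.extend Subtype.val F 0
  have hGN : (fun y : N => G y) = F := funext fun y => Subtype.val_injective.extend_apply _ _ _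
  have hG0 : ∀ y ∉ N, G y = 0 := fun y hy =>
    Function.extend_apply' _ _ _ fun ⟨z, hz⟩ => hy (hz ▸ z.2)
  have hGs : ∀ y, G y ≠ 0 → y ∈ Subtype.val '' tsupport F := by
    intro y hy
    by_cases hyN : y ∈ N
    · refine ⟨⟨y, hyN⟩, subset_closure ?_, rfl⟩
      have := congrFun hGN ⟨y, hyN⟩
      exact fun h0 => hy (this.trans h0)
    · exact absurd (hG0 y hyN) hy
  have hK : IsCompact (Subtype.val '' tsupport F) :=
    IsCompact.image hF continuous_subtype_val
  have hGc : HasCompactSupport G := HasCompactSupport.intro hK fun y hy => by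
    by_contra h0
    exact hy (hGs y h0)
  have hGcont : Continuous G := by
    refine continuous_iff_continuousAt.mpr fun y => ?_
    by_cases hy : y ∈ N
    · refine (continuousOn_iff_continuous_domRestrict.mpr ?_).continuousAt (hN.mem_nhds hy)
      change Continuous (fun y : N => G y)
      rw [hGN]
      exact Complex.continuous_ofReal.comp f.continuous
    · have h1 : ∀ᶠ z in 𝓝 y, G z = 0 := by
        filter_upwards [hK.isClosed.isOpen_compl.mem_nhds
          (show y ∈ (Subtype.val '' tsupport F)ᶜ from fun ⟨z, _, hz⟩ => hy (hz ▸ z.2))] with z hz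
        by_contra h0
        exact hz (hGs z h0)
      exact (continuousAt_const (y := (0 : ℂ))).congr (h1.mono fun _ h => h.symm)
  have h1 := hinv G hGcont hGc
  rw [fiberSum_eq_extend hi hG0, fiberSum_eq_extend hi' hG0,
    MeasurableEmbedding.integral_extend h.measurableEmbedding,
    MeasurableEmbedding.integral_extend h'.measurableEmbedding, hGN] at h1
  have h2 : ∀ ν : Measure N, ∫ y, F y ∂ν = ((∫ y, f y ∂ν : ℝ) : ℂ) := fun ν => integral_ofReal
  rw [h2, h2] at h1
  exact Complex.ofReal_injective h1

variable [IsFiniteMeasure μ]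

-- Both fibre sums are extensions by zero of the same bounded function on `N`, and the two pulled
-- back measures on `N` coincide.
include hinv ht ht' in
lemma isBalanced_indicator {b : Y → ℂ} {N A : Set Y} (hN : IsOpen N) (hi : N.InjOn t)
    (hi' : N.InjOn t') (hb : IsBoundedMeasurableOn b N) (hA : MeasurableSet A) (hAN : A ⊆ N) :
    IsBalanced μ t t' (A.indicator b) := by
  have h := (isOpenEmbedding_of_injOn ht hN hi).measurableEmbedding
  have h' := (isOpenEmbedding_of_injOn ht' hN hi').measurableEmbedding
  have h0 : ∀ y ∉ N, A.indicator b y = 0 := fun y hy => Set.indicator_of_notMem (fun h => hy (hAN h)) _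
  have hm : Measurable (fun y : N => A.indicator b y) :=
    hb.1.indicator (hA.preimage measurable_subtype_coe)
  obtain ⟨C, hC⟩ := hb.2
  have hC' : ∀ y : N, ‖A.indicator b y‖ ≤ C := fun y =>
    (norm_indicator_le_norm_self _ _).trans (hC y.1 y.2)
  refine ⟨finite_support_of_injOn hi h0, finite_support_of_injOn hi' h0, ?_, ?_, ?_⟩
  · rw [fiberSum_eq_extend hi h0]
    exact MeasurableEmbedding.integrable_extend h μ hm hC'
  · rw [fiberSum_eq_extend hi' h0]
    exact MeasurableEmbedding.integrable_extend h' μ hm hC'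
  · rw [fiberSum_eq_extend hi h0, fiberSum_eq_extend hi' h0,
      MeasurableEmbedding.integral_extend h, MeasurableEmbedding.integral_extend h',
      comap_eq_comap ht ht' hinv hN hi hi']

include hinv ht ht' in
/-- The invariance of a measure extends to locally bounded Borel functions of compact support. -/
theorem isBalanced_of_isCompact {b : Y → ℂ} {K : Set Y} (hK : IsCompact K)
    (hbK : ∀ y ∉ K, b y = 0) (hb : ∀ y, ∃ N, IsOpen N ∧ y ∈ N ∧ IsBoundedMeasurableOn b N) :
    IsBalanced μ t t' b := by
  -- The claim is made for all Borel subsets of a neighbourhood, so that two neighbourhoods can be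
  -- combined by splitting a set into disjoint Borel pieces; a continuous partition of unity is not
  -- needed.
  have key : ∃ W, IsOpen W ∧ K ⊆ W ∧ ∀ A ⊆ W, MeasurableSet A →
      IsBalanced μ t t' (A.indicator b) := by
    refine hK.induction_on ?_ ?_ ?_ ?_
    · refine ⟨∅, isOpen_empty, subset_rfl, fun A hA hm => ?_⟩
      exact isBalanced_indicator ht ht' hinv isOpen_empty (Set.injOn_empty _) (Set.injOn_empty _)
        ⟨measurable_of_empty _, 0, fun _ h => h.elim⟩ hm hA
    · rintro s s' hs ⟨W, hW, hsW, h⟩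
      exact ⟨W, hW, hs.trans hsW, h⟩
    · rintro s s' ⟨W, hW, hsW, h⟩ ⟨W', hW', hsW', h'⟩
      refine ⟨W ∪ W', hW.union hW', Set.union_subset_union hsW hsW', fun A hA hm => ?_⟩
      have h1 : A.indicator b = (A ∩ W).indicator b + (A \ W).indicator b := by
        refine Eq.trans ?_ (Set.indicator_union_of_disjoint
          (Set.disjoint_sdiff_right.mono_left Set.inter_subset_right) b)
        rw [Set.inter_union_sdiff]
      rw [h1]
      exact (h _ Set.inter_subset_right (hm.inter hW.measurableSet)).add
        (h' _ (fun y hy => (hA hy.1).resolve_left hy.2) (hm.diff hW.measurableSet))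
    · intro y _
      obtain ⟨N, hN, hy, hbN⟩ := hb y
      let e := ht.localInverseAt y
      let e' := ht'.localInverseAt y
      refine ⟨N ∩ (e.target ∩ e'.target), mem_nhdsWithin_of_mem_nhds
        ((hN.inter (e.open_target.inter e'.open_target)).mem_nhds
          ⟨hy, ht.self_mem_localInverseAt_target, ht'.self_mem_localInverseAt_target⟩), _,
        hN.inter (e.open_target.inter e'.open_target), subset_rfl, fun A hA hm => ?_⟩
      exact isBalanced_indicator ht ht' hinv (hN.inter (e.open_target.inter e'.open_target))
        (ht.injOn_localInverseAt_target.mono fun _ h => h.2.1)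
        (ht'.injOn_localInverseAt_target.mono fun _ h => h.2.2)
        (hbN.mono Set.inter_subset_left) hm hA
  obtain ⟨W, hW, hKW, h⟩ := key
  have h1 := h W subset_rfl hW.measurableSet
  rwa [Set.indicator_eq_self.mpr fun y hy => hKW (by by_contra h; exact hy (hbK y h))] at h1

end FiberSums

/-! ### Integrability of the values of Borel sections -/

section Values

/-- By compactness finitely many of the open sets cover `X`, so the function is Borel and bounded
everywhere. -/
lemma integrable_of_isBoundedMeasurableOn {X : Type u} [TopologicalSpace X] [CompactSpace X]
    [MeasurableSpace X] [BorelSpace X] {b : X → ℂ}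
    (hb : ∀ x, ∃ N, IsOpen N ∧ x ∈ N ∧ IsBoundedMeasurableOn b N) (μ : Measure X)
    [IsFiniteMeasure μ] : Integrable b μ := by
  have key : ∃ W, IsOpen W ∧ Set.univ ⊆ W ∧ IsBoundedMeasurableOn b W := by
    refine isCompact_univ.induction_on ?_ ?_ ?_ ?_
    · exact ⟨∅, isOpen_empty, subset_rfl, measurable_of_empty _, 0, fun _ h => h.elim⟩
    · rintro s s' hs ⟨W, hW, hsW, h⟩
      exact ⟨W, hW, hs.trans hsW, h⟩
    · rintro s s' ⟨W, hW, hsW, h, C, hC⟩ ⟨W', hW', hsW', h', C', hC'⟩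
      refine ⟨W ∪ W', hW.union hW', Set.union_subset_union hsW hsW', ?_, max C C', ?_⟩
      · refine measurable_of_measurable_union_cover (Subtype.val ⁻¹' W) (Subtype.val ⁻¹' W')
          (hW.measurableSet.preimage measurable_subtype_coe)
          (hW'.measurableSet.preimage measurable_subtype_coe) (fun x _ => x.2) ?_ ?_
        · exact h.comp ((measurable_subtype_coe.comp measurable_subtype_coe).subtype_mk
            (h := fun x => x.2))
        · exact h'.comp ((measurable_subtype_coe.comp measurable_subtype_coe).subtype_mk
            (h := fun x => x.2))
      · rintro x (hx | hx)
        · exact (hC x hx).trans (le_max_left _ _)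
        · exact (hC' x hx).trans (le_max_right _ _)
    · intro x _
      obtain ⟨N, hN, hx, h⟩ := hb x
      exact ⟨N, mem_nhdsWithin_of_mem_nhds (hN.mem_nhds hx), N, hN, subset_rfl, h⟩
  obtain ⟨W, hW, hu, hm, C, hC⟩ := key
  refine Integrable.of_bound (Measurable.aestronglyMeasurable ?_) C
    (.of_forall fun x => hC x (hu trivial))
  exact hm.comp (measurable_id.subtype_mk (h := fun x => hu trivial))

variable {X : Type u} [TopologicalSpace X] [LocallyCompactSpace X]
  [Groupoid.{u} X] [TopologicalSpace (Arrows X)] [MeasurableSpace X] [BorelSpace X]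
  [IsEtaleGroupoid X]

/-- Sections of pullbacks of `𝓑` have locally bounded and locally Borel measurable values. -/
lemma exists_isBoundedMeasurableOn {Y : Type v} [TopologicalSpace Y] [MeasurableSpace Y]
    [BorelSpace Y] {τ : Y → X} (hτ : Continuous τ) {σ : ∀ y, (borelSheaf X).stalk (τ y)}
    (h : (borelSheaf X).IsSectionAlong τ σ) (y : Y) : ∃ N, IsOpen N ∧ y ∈ N ∧
      IsBoundedMeasurableOn (fun y => (show borelGerms (τ y) from σ y).1.value) N := by
  obtain ⟨s, hs, e⟩ := (GSheaf.isSectionAlong_iff hτ).mp h y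
  obtain ⟨U, f, hU, hyU, hf, hsf⟩ := borelSheaf_sec_iff.mp hs
  -- Sections of `𝓑` are bounded on compact sets only, so `N` is chosen to map into a compact
  -- neighbourhood `L`.
  obtain ⟨L, hL, hLU, hLc⟩ := local_compact_nhds (hU.mem_nhds hyU)
  obtain ⟨N, hN, hNo, hyN⟩ := eventually_nhds_iff.mp
    (e.and (hτ.continuousAt.eventually hL))
  have hv : ∀ z ∈ N, (show borelGerms (τ z) from σ z).1.value = f (τ z) := fun z hz =>
    value_eq_of_coe_eq ((congrArg (fun γ : borelGerms (τ z) => γ.1) (hN z hz).1).trans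
      (hsf _ (hLU (hN z hz).2)))
  refine ⟨N, hNo, hyN, ?_, ?_⟩
  · have h1 : Measurable fun z : N => (⟨τ z, hLU (hN z z.2).2⟩ : U) :=
      (hτ.measurable.comp measurable_subtype_coe).subtype_mk
    have h2 := hf.1.comp h1
    exact (funext fun z : N => hv z.1 z.2 :
      (fun z : N => (show borelGerms (τ z) from σ z).1.value) = fun z : N => f (τ z)) ▸ h2
  · obtain ⟨C, hC⟩ := hf.2 L hLU hLc
    refine ⟨C, fun z hz => ?_⟩
    dsimp only
    rw [hv z hz]
    exact hC _ (hN z hz).2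

end Values

/-! ### Strings of length zero and one -/

namespace Strings

variable {X : Type u} [Groupoid.{u} X]

lemma ofBase_vertex_zero (F : Strings X 0) : ofBase (F.vertex 0) = F :=
  ext_arrow fun j => by
    obtain rfl : j = 0 := Subsingleton.elim (α := Fin 1) j 0
    rw [arrow_refl, arrow_refl]
    rfl

lemma arrow_injective : Function.Injective (arrow (Fin.zero_le 1) : Strings X 1 → Arrows X) := by
  intro F F' h
  refine ext_arrow fun j => ?_
  fin_cases j
  · change F.arrow (le_refl 0) = F'.arrow (le_refl 0)
    rw [arrow_refl, arrow_refl]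
    exact congrArg unitArrow (congrArg Arrows.range h)
  · exact h

lemma arrow_surjective : Function.Surjective (arrow (Fin.zero_le 1) : Strings X 1 → Arrows X) := by
  intro a
  let b : Fin 2 → Arrows X := ![unitArrow a.range, a]
  have hb : ∀ j, (b j).range = a.range := by
    intro j
    fin_cases j <;> rfl
  exact ⟨ofArrows a.range b hb, arrow_ofArrows a.range b hb rfl 1⟩

variable [TopologicalSpace X] [TopologicalSpace (Arrows X)]

lemma continuous_ofBase : Continuous (ofBase : X → Strings X 0) := by
  refine continuous_induced_rng.mpr (Continuous.prodMk (continuous_pi fun _ => continuous_id)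
    (continuous_pi fun j => j.elim0))

variable [IsEtaleGroupoid X]

variable (X) in
/-- Strings of length `1` are arrows. -/
noncomputable def homeomorphArrows : Strings X 1 ≃ₜ Arrows X :=
  (Equiv.ofBijective (arrow (Fin.zero_le 1)) ⟨arrow_injective, arrow_surjective⟩).toHomeomorphOfContinuousOpen
    (continuous_arrow _) (IsLocalHomeomorph.of_comp (f := arrow (Fin.zero_le 1)) (g := Arrows.range) isLocalHomeomorph_vertex_zero
      IsEtaleGroupoid.isLocalHomeomorph_range (continuous_arrow _)).isOpenMap

end Strings

/-! ### The pairing with invariant measures -/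

section Invariance

lemma fiberSum_comp_equiv {X Y Z : Type*} (e : Y ≃ Z) (t : Z → X) (b : Y → ℂ) :
    fiberSum t (b ∘ e.symm) = fiberSum (t ∘ e) b := by
  funext x
  refine finsum_eq_of_bijective _ (e.symm.subtypeEquiv fun z => ?_).bijective fun z => rfl
  simp

variable {X : Type u} [Groupoid.{u} X] [TopologicalSpace X] [TopologicalSpace (Arrows X)]
  [MeasurableSpace X] [IsEtaleGroupoid X]

/-- Under the identification of strings `x₀ ← x₁` with arrows, `x₀` is the range and `x₁` the
source. -/
lemma IsInvariantMeasure.integral_fiberSum {μ : Measure X} (h : IsInvariantMeasure μ)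
    (f : Strings X 1 → ℂ) (hf : Continuous f) (hc : HasCompactSupport f) :
    ∫ x, fiberSum (Strings.vertex 1) f x ∂μ = ∫ x, fiberSum (Strings.vertex 0) f x ∂μ := by
  let e := Strings.homeomorphArrows X
  have h1 := h (f ∘ e.symm) (hf.comp e.symm.continuous) (hc.comp_homeomorph e.symm)
  change ∫ x, fiberSum Arrows.range (f ∘ e.toEquiv.symm) x ∂μ =
    ∫ x, fiberSum Arrows.source (f ∘ e.toEquiv.symm) x ∂μ at h1
  rw [fiberSum_comp_equiv, fiberSum_comp_equiv] at h1
  exact h1.symm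

variable [BorelSpace X]

/-- The value of a germ. -/
noncomputable def borelValue (x : X) : (borelSheaf X).stalk x →+ ℂ where
  toFun γ := (show borelGerms x from γ).1.value
  map_zero' := rfl
  map_add' := by
    rintro ⟨_, U, f, hU, hx, hf, rfl⟩ ⟨_, U', f', hU', hx', hf', rfl⟩
    rfl

lemma borelValue_act {x y : X} (g : x ⟶ y) (γ : (borelSheaf X).stalk x) :
    borelValue y ((borelSheaf X).act g γ) = borelValue x γ := value_borelAct g γ

variable [T2Space (Arrows X)]

/-- The action transports germs without changing their values, so the twist disappears. The vertex
that survives under `dᵢ` is `x₁` for `i = 0` and `x₀` for `i = 1`. -/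
lemma borelValue_faceSum (i : Fin 2) (σ : (borelSheaf X).barGroup 1) (x : X) :
    borelValue x (((borelSheaf X).faceSum 0 i σ).1 (Strings.ofBase x)) =
      fiberSum (Strings.vertex (i.succAbove 0)) (fun G => borelValue (G.vertex 0) (σ.1 G)) x := by
  rw [GSheaf.faceSum_apply]
  refine (AddMonoidHom.map_finsum (borelValue x)
    ((borelSheaf X).finite_support_faceSum (p := 0) i σ (Strings.ofBase x))).trans ?_
  let e : {G : Strings X 1 // G.face i = Strings.ofBase x} ≃
      {G : Strings X 1 // G.vertex (i.succAbove 0) = x} :=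
    Equiv.subtypeEquivRight fun G => by
      constructor
      · intro h
        exact congrArg (Strings.vertex 0) h
      · rintro rfl
        exact (Strings.ofBase_vertex_zero (G.face i)).symm
  exact finsum_eq_of_bijective e e.bijective fun G => borelValue_act _ _

namespace BorelResolution

variable (B : BorelResolution X)

lemma baseFunction_eq (a : B.Total) (x : X) :
    B.baseFunction a x = borelValue x ((B.inclusion.bar 0 (a (0, 0))).1 (Strings.ofBase x)) := rfl

lemma baseFunction_add (a b : B.Total) :
    B.baseFunction (a + b) = B.baseFunction a + B.baseFunction b := by
  funext x
  simp only [Pi.add_apply, baseFunction_eq, DirectSum.add_apply, map_add]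
  exact map_add (borelValue x) _ _

end BorelResolution

variable [CompactSpace X]

/-- `δ = δ₀ - δ₁` becomes the difference of the sums of one Borel function over the fibres of `x₁`
and of `x₀`. The function has compact support and is locally bounded, so invariance gives equal
integrals. -/
lemma integral_barDifferential {μ : Measure X} [IsFiniteMeasure μ] [μ.Regular]
    (h : IsInvariantMeasure μ) (σ : (borelSheaf X).barGroup 1) :
    ∫ x, borelValue x (((borelSheaf X).barDifferential 0 σ).1 (Strings.ofBase x)) ∂μ = 0 := by
  have := Strings.t2Space_base X
  let _ : MeasurableSpace (Strings X 1) := borel _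
  have : BorelSpace (Strings X 1) := ⟨rfl⟩
  have hb := isBalanced_of_isCompact (μ := μ) (Strings.isLocalHomeomorph_vertex (X := X) (n := 1) 1)
    (Strings.isLocalHomeomorph_vertex 0) h.integral_fiberSum
    (b := fun G => borelValue (G.vertex 0) (σ.1 G)) σ.2.2
    (fun G hG => by
      have : σ.1 G = 0 := by
        by_contra h0
        exact hG (subset_closure h0)
      rw [this, map_zero])
    (exists_isBoundedMeasurableOn (Strings.continuous_vertex 0) σ.2.1)
  have h1 : ∀ x, borelValue x (((borelSheaf X).barDifferential 0 σ).1 (Strings.ofBase x)) =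
      fiberSum (Strings.vertex 1) (fun G => borelValue (G.vertex 0) (σ.1 G)) x -
        fiberSum (Strings.vertex 0) (fun G => borelValue (G.vertex 0) (σ.1 G)) x := by
    intro x
    have h2 : (borelSheaf X).barDifferential 0 σ =
        (borelSheaf X).faceSum 0 0 σ - (borelSheaf X).faceSum 0 1 σ := by
      simp [GSheaf.barDifferential, Fin.sum_univ_two, sub_eq_add_neg]
    rw [h2]
    refine (map_sub (borelValue x) _ _).trans ?_
    rw [borelValue_faceSum, borelValue_faceSum]
    rfl
  simp_rw [h1]
  rw [integral_sub hb.integrable_left hb.integrable_right, hb.integral_eq, sub_self]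

namespace BorelResolution

variable (B : BorelResolution X)

lemma integrable_baseFunction (a : B.Total) (μ : Measure X) [IsFiniteMeasure μ] :
    Integrable (B.baseFunction a) μ := by
  have := Strings.t2Space_base X
  refine integrable_of_isBoundedMeasurableOn (exists_isBoundedMeasurableOn
    (τ := id) continuous_id
    (σ := fun x => (B.inclusion.bar 0 (a (0, 0))).1 (Strings.ofBase x)) ?_) μ
  exact (B.inclusion.bar 0 (a (0, 0))).2.1.comp Strings.continuous_ofBase

/-- Row `0` receives only horizontal maps, so `a₀` of a boundary is `δ` of its component in
`Γ_c(𝒢⁽¹⁾; S⁰)`; the inclusion in `𝓑` commutes with `δ`. -/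
lemma integral_baseFunction_differential (a : B.Total) {μ : Measure X} [IsFiniteMeasure μ]
    [μ.Regular] (h : IsInvariantMeasure μ) : ∫ x, B.baseFunction (B.differential a) x ∂μ = 0 := by
  simp_rw [baseFunction_eq]
  rw [CSoftResolution.differential_apply_zero, GSheafHom.bar_barDifferential]
  exact integral_barDifferential h _

/-- The integral of the base function, on homology. -/
noncomputable def integral {μ : Measure X} [IsFiniteMeasure μ] [μ.Regular]
    (h : IsInvariantMeasure μ) : B.Homology 0 →+ ℂ :=
  QuotientAddGroup.lift _
    { toFun := fun a => ∫ x, B.baseFunction a.1 x ∂μ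
      map_zero' := by
        have := B.integral_baseFunction_differential 0 h
        rwa [map_zero] at this
      map_add' := fun a b => by
        change ∫ x, B.baseFunction (a.1 + b.1) x ∂μ = _
        rw [baseFunction_add]
        exact integral_add (B.integrable_baseFunction _ μ) (B.integrable_baseFunction _ μ) }
    fun a ⟨b, _, hba⟩ => by
      change ∫ x, B.baseFunction a.1 x ∂μ = 0
      rw [show a.1 = B.differential b from hba.symm]
      exact B.integral_baseFunction_differential b h

lemma integral_homologyClass {μ : Measure X} [IsFiniteMeasure μ] [μ.Regular]
    (h : IsInvariantMeasure μ) (a : B.cycles 0) :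
    B.integral h (B.homologyClass 0 a) = ∫ x, B.baseFunction a.1 x ∂μ := rfl

/-- Compatible classes have the same integral in all Borel resolutions. -/
lemma integral_eq_integral_borelResolution [T2Space X] {μ : Measure X} [IsFiniteMeasure μ] [μ.Regular]
    (h : IsInvariantMeasure μ) (c : groupoidHomology (constInt X) 0) :
    B.integral h (c.1 B.toCSoftResolution) = (borelResolution X ⊤ fun _ => trivial).integral h
      (c.1 (borelResolution X ⊤ fun _ => trivial).toCSoftResolution) := by
  obtain ⟨f, hf⟩ := exists_hom_borelResolution B
  obtain ⟨a, ha⟩ := QuotientAddGroup.mk'_surjective _ (c.1 B.toCSoftResolution)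
  rw [← c.2 _ _ f, ← ha]
  change ∫ x, B.baseFunction a.1 x ∂μ =
    ∫ x, (borelResolution X ⊤ fun _ => trivial).baseFunction (f.total a.1) x ∂μ
  simp_rw [hf]

end BorelResolution

end Invariance

end EtaleGpd

theorem proposition2 {X : Type u} [Groupoid.{u} X] [TopologicalSpace X]
    [TopologicalSpace (Arrows X)] [IsEtaleGroupoid X] [T2Space (Arrows X)]
    [LocallyCompactSpace (Arrows X)] [CompactSpace X] [MeasurableSpace X] [BorelSpace X] :
    -- Borel resolutions exist
    Nonempty (BorelResolution X) ∧
    -- every resolution of `𝒵` by `c`-soft `𝒢`-sheaves computes `H₀(𝒢)`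
    (∀ R : CSoftResolution (constInt X),
      Function.Bijective fun c : groupoidHomology (constInt X) 0 => c.1 R) ∧
    -- the pairing of invariant probability measures and `0`-chains is defined
    (∀ (B : BorelResolution X) (μ : invariantMeasures X), ∀ a ∈ B.chains 0,
      Integrable (B.baseFunction a) (μ.1 : Measure X)) ∧
    -- it descends to `H₀(𝒢)`, to the same pairing for all Borel resolutions
    ∃ ρ : invariantMeasures X → (groupoidHomology (constInt X) 0 →+ ℂ),
      (∀ (μ : invariantMeasures X) (c : groupoidHomology (constInt X) 0) (B : BorelResolution X)
        (a : B.cycles 0), B.homologyClass 0 a = c.1 B.toCSoftResolution →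
          ρ μ c = ∫ x, B.baseFunction a.1 x ∂(μ.1 : Measure X)) ∧
      -- the values of the pairing are real
      ∀ (μ : invariantMeasures X) (c : groupoidHomology (constInt X) 0), (ρ μ c).im = 0 := by
  have := Strings.t2Space_base X
  let B₀ := borelResolution X ⊤ fun _ => trivial
  refine ⟨⟨B₀⟩, fun R => groupoidHomology_bijective _ _ R,
    fun B μ a _ => B.integrable_baseFunction a _, ?_⟩
  have hρ : ∀ μ : invariantMeasures X, ∃ ρ : groupoidHomology (constInt X) 0 →+ ℂ,
      ∀ (c : groupoidHomology (constInt X) 0) (B : BorelResolution X) (a : B.cycles 0),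
        B.homologyClass 0 a = c.1 B.toCSoftResolution →
          ρ c = ∫ x, B.baseFunction a.1 x ∂(μ.1 : Measure X) := by
    intro μ
    have := μ.2.1
    -- The pairing is defined through the resolution `B₀` that begins with all of `𝓑`, to which
    -- every other Borel resolution is compared.
    refine ⟨(B₀.integral μ.2.2).comp ((Pi.evalAddMonoidHom _ B₀.toCSoftResolution).comp
      (groupoidHomology (constInt X) 0).subtype), fun c B a ha => ?_⟩
    rw [← B.integral_homologyClass μ.2.2, ha, B.integral_eq_integral_borelResolution]
    rfl
  choose ρ hρ using hρ
  refine ⟨ρ, hρ, fun μ c => ?_⟩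
  -- `V` is the group of real numbers. As the pairing may be computed in any Borel resolution, a
  -- representative with real-valued `a₀` can be used.
  let V : AddSubgroup ℂ := Complex.imAddGroupHom.ker
  let B₁ := borelResolution X V fun n => Complex.intCast_im n
  obtain ⟨a, ha⟩ := QuotientAddGroup.mk'_surjective _ (c.1 B₁.toCSoftResolution)
  rw [hρ μ c B₁ a ha]
  have h1 : ∀ x, (B₁.baseFunction a.1 x).im = 0 := fun x =>
    AddMonoidHom.mem_ker.mp (baseFunction_borelResolution_mem (V := V) a.1 x)
  rw [← Complex.imCLM_apply, ← Complex.imCLM.integral_comp_comm (B₁.integrable_baseFunction _ _)]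
  simp [h1]
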